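/- Let $3\le n\le 7$, let $m\in\{n-1,n-2\}$ and let $\lambda>0$. Put $$C_0=\frac{m^2-mn+m+n}{2(m^2-nm+2n-2)}.$$ For a Riemannian $n$-manifold $(N,g)$, a point $p\in N$ and orthonormal vectors $e_1,\dots,e_m\in T_pN$, extended to an orthonormal basis $e_1,\dots,e_n$ of $T_pN$, the $m$-intermediate curvature is $$C_m(e_1,\dots,e_m)=\sum_{i=1}^{m}\sum_{j=i+1}^{n}R(e_i,e_j,e_i,e_j),$$ with the sign convention in which $R(X,Y,X,Y)$ is the sectional curvature for orthonormal $X,Y$; $C_m\ge\lambda$ means that $C_m(e_1,\dots,e_m)\ge\lambda$ for all orthonormal $e_1,\dots,e_m$ at all points of $N$. Then $C_0>0$, and there exist a sequence of closed connected smooth Riemannian $n$-manifolds $(N^k,g_k)$ with $C_m\ge\lambda$, and closed connected orientable smoothly embedded submanifolds $\Sigma^k\subset N^k$ of dimension $n-m+1$ with $[\Sigma^k]\neq 0$ in $H_{n-m+1}(N^k;\mathbb Z)$, such that the diameters $\operatorname{diam}(\Sigma^k)$ of $\Sigma^k$ with respect to the Riemannian distance of the induced metric are strictly increasing in $k$ and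 $$\lim_{k\to\infty}\operatorname{diam}(\Sigma^k)=\frac{\pi}{\sqrt{\lambda C_0}}.$$ -/

import Mathlib

open Filter Topology

noncomputable section

namespace IntermediateCurvature

open CategoryTheory CategoryTheory.Limits Manifold Bundle
open scoped ContDiff ENNReal

/-! ### Local Riemannian geometry in coordinates

`g : ℝⁿ → Mat` is the matrix field of the components of a metric in a chart. -/

/-- The `i`-th partial derivative of a function on `ℝⁿ`. -/
def partialDeriv {n : ℕ} (i : Fin n) (f : EuclideanSpace ℝ (Fin n) → ℝ)
    (y : EuclideanSpace ℝ (Fin n)) : ℝ :=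
  fderiv ℝ f y (EuclideanSpace.single i 1)

/-- The Christoffel symbol
`Γᵃᵢⱼ = ½ ∑ₗ gᵃˡ (∂ᵢ gⱼₗ + ∂ⱼ gᵢₗ - ∂ₗ gᵢⱼ)` of a metric given in coordinates. -/
def christoffel {n : ℕ} (g : EuclideanSpace ℝ (Fin n) → Matrix (Fin n) (Fin n) ℝ)
    (a i j : Fin n) (y : EuclideanSpace ℝ (Fin n)) : ℝ :=
  (1 / 2 : ℝ) * ∑ l, (g y)⁻¹ a l *
    (partialDeriv i (fun z => g z j l) y + partialDeriv j (fun z => g z i l) y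
      - partialDeriv l (fun z => g z i j) y)

/-- The components `Rᵢⱼₖₗ = g(R(∂ᵢ, ∂ⱼ)∂ₗ, ∂ₖ)` of the Riemann curvature tensor of a metric given
in coordinates, where `R(X, Y) = ∇_X ∇_Y - ∇_Y ∇_X - ∇_[X, Y]`. With this sign convention
`Rᵢⱼᵢⱼ` is positive on round spheres. -/
def curvatureCoeff {n : ℕ} (g : EuclideanSpace ℝ (Fin n) → Matrix (Fin n) (Fin n) ℝ)
    (i j k l : Fin n) (y : EuclideanSpace ℝ (Fin n)) : ℝ :=
  ∑ a, g y k a *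
    (partialDeriv i (christoffel g a j l) y - partialDeriv j (christoffel g a i l) y
      + ∑ b, (christoffel g b j l y * christoffel g a i b y
        - christoffel g b i l y * christoffel g a j b y))

/-! ### Closed Riemannian manifolds -/

/-- A closed (compact, connected, without boundary) smooth Riemannian manifold of dimension `n`. -/
structure ClosedRiemannianManifold (n : ℕ) where
  Carrier : Type
  [topologicalSpace : TopologicalSpace Carrier]
  [chartedSpace : ChartedSpace (EuclideanSpace ℝ (Fin n)) Carrier]
  [isManifold : IsManifold (𝓡 n) ∞ Carrier]
  [t2Space : T2Space Carrier]
  [compactSpace : CompactSpace Carrier]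
  [connectedSpace : ConnectedSpace Carrier]
  metric : ContMDiffRiemannianMetric (𝓡 n) ∞ (EuclideanSpace ℝ (Fin n))
    (fun x : Carrier => TangentSpace (𝓡 n) x)

namespace ClosedRiemannianManifold

attribute [instance] topologicalSpace chartedSpace isManifold t2Space compactSpace connectedSpace

variable {n : ℕ} (M : ClosedRiemannianManifold n)

/-- The components of the metric in the preferred chart `φ` at `p`:
`gᵢⱼ(y) = g(∂ᵢ, ∂ⱼ)` at the point `φ⁻¹(y)`, with `∂ᵢ = D(φ⁻¹)_y(eᵢ)`. -/
def metricCoeff (p : M.Carrier) (y : EuclideanSpace ℝ (Fin n)) : Matrix (Fin n) (Fin n) ℝ :=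
  Matrix.of fun i j =>
    M.metric.inner ((extChartAt (𝓡 n) p).symm y)
      (mfderiv (𝓡 n) (𝓡 n) (extChartAt (𝓡 n) p).symm y (EuclideanSpace.single i (1 : ℝ)))
      (mfderiv (𝓡 n) (𝓡 n) (extChartAt (𝓡 n) p).symm y (EuclideanSpace.single j (1 : ℝ)))

/-- The Riemann curvature tensor `R(X, Y, Z, W)` at `p`. By Mathlib's definition of the tangent
space, a vector of `T_p M` is the vector of its components in the preferred chart at `p`. -/
def curvatureTensor (p : M.Carrier) (X Y Z W : TangentSpace (𝓡 n) p) : ℝ :=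
  let x : EuclideanSpace ℝ (Fin n) := X
  let y : EuclideanSpace ℝ (Fin n) := Y
  let z : EuclideanSpace ℝ (Fin n) := Z
  let w : EuclideanSpace ℝ (Fin n) := W
  ∑ i, ∑ j, ∑ k, ∑ l, x i * y j * z k * w l *
    curvatureCoeff (M.metricCoeff p) i j k l (extChartAt (𝓡 n) p p)

/-- `e` is an orthonormal basis of `T_p M` (`n` orthonormal vectors in dimension `n`). -/
def IsOrthonormalFrame (p : M.Carrier) (e : Fin n → TangentSpace (𝓡 n) p) : Prop :=
  ∀ i j, M.metric.inner p (e i) (e j) = if i = j then 1 else 0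

/-- The `m`-intermediate curvature
`C_m(e₁, …, e_m) = ∑_{i = 1}^{m} ∑_{j = i + 1}^{n} R(eᵢ, eⱼ, eᵢ, eⱼ)` of the first `m` vectors of an
orthonormal basis `e₁, …, eₙ` of `T_p M`. -/
def intermediateCurvature (m : ℕ) (p : M.Carrier) (e : Fin n → TangentSpace (𝓡 n) p) : ℝ :=
  ∑ i : Fin n with i.val < m, ∑ j : Fin n with i < j, M.curvatureTensor p (e i) (e j) (e i) (e j)

/-- `C_m ≥ c` on `M`: at every point the minimum of `C_m(e₁, …, e_m)` over all orthonormal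
`e₁, …, e_m` is at least `c`. -/
def IntermediateCurvatureGE (m : ℕ) (c : ℝ) : Prop :=
  ∀ (p : M.Carrier) (e : Fin n → TangentSpace (𝓡 n) p), M.IsOrthonormalFrame p e →
    c ≤ M.intermediateCurvature m p e

/-- The Riemannian distance of `M`: the infimum of the lengths of the `C¹` paths. -/
def dist (x y : M.Carrier) : ℝ≥0∞ :=
  letI : RiemannianBundle (fun x : M.Carrier => TangentSpace (𝓡 n) x) :=
    ⟨M.metric.toRiemannianMetric⟩
  riemannianEDist (𝓡 n) x y

/-- The diameter of `M` for its Riemannian distance. -/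
def diam : ℝ≥0∞ := ⨆ (x : M.Carrier) (y : M.Carrier), M.dist x y

end ClosedRiemannianManifold

/-! ### Fundamental classes in singular homology -/

/-- The singular chain complex `S(X; ℤ)`. -/
def singularChains : TopCat.{0} ⥤ ChainComplex (ModuleCat.{0} ℤ) ℕ :=
  (AlgebraicTopology.singularChainComplexFunctor (ModuleCat.{0} ℤ)).obj (ModuleCat.of ℤ ℤ)

/-- The singular homology `H_k(X; ℤ)`. -/
def singularHomology (k : ℕ) : TopCat.{0} ⥤ ModuleCat.{0} ℤ :=
  (AlgebraicTopology.singularHomologyFunctor (ModuleCat.{0} ℤ) k).obj (ModuleCat.of ℤ ℤ)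

/-- The map `S(X ∖ {x}; ℤ) ⟶ S(X; ℤ)` induced by the inclusion. -/
def puncturedChainsMap (X : TopCat.{0}) (x : X) :
    singularChains.obj (TopCat.of {y : X // y ≠ x}) ⟶ singularChains.obj X :=
  singularChains.map (TopCat.ofHom ⟨Subtype.val, continuous_subtype_val⟩)

/-- The local homology `H_k(X, X ∖ {x}; ℤ)`, the homology of `S(X; ℤ) / S(X ∖ {x}; ℤ)`. -/
def localHomology (k : ℕ) (X : TopCat.{0}) (x : X) : ModuleCat.{0} ℤ :=
  (cokernel (puncturedChainsMap X x)).homology k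

/-- The canonical map `H_k(X; ℤ) ⟶ H_k(X, X ∖ {x}; ℤ)`. -/
def toLocalHomology (k : ℕ) (X : TopCat.{0}) (x : X) :
    (singularHomology k).obj X ⟶ localHomology k X x :=
  HomologicalComplex.homologyMap (cokernel.π (puncturedChainsMap X x)) k

/-- `μ ∈ H_k(X; ℤ)` is a fundamental class of the closed `k`-manifold `X` (for one of its
orientations): it restricts to a generator of `H_k(X, X ∖ {x}; ℤ) ≅ ℤ` at every point `x`. -/
def IsFundamentalClass (k : ℕ) (X : TopCat.{0}) (μ : (singularHomology k).obj X) : Prop :=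
  ∀ x : X, Submodule.span ℤ {toLocalHomology k X x μ} = ⊤

/-! ### Submanifolds -/

/-- A closed connected smooth embedded submanifold `Σ` of dimension `d`, with the induced metric:
a closed Riemannian manifold with a smooth embedding `ι : Σ → M` such that `g_Σ = ι^* g_M`. -/
structure ClosedSubmanifold {n : ℕ} (M : ClosedRiemannianManifold n) (d : ℕ) where
  toManifold : ClosedRiemannianManifold d
  ι : toManifold.Carrier → M.Carrier
  isSmoothEmbedding : IsSmoothEmbedding (𝓡 d) (𝓡 n) ∞ ι
  induced_metric : ∀ (x : toManifold.Carrier) (v w : TangentSpace (𝓡 d) x),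
    toManifold.metric.inner x v w =
      M.metric.inner (ι x) (mfderiv (𝓡 d) (𝓡 n) ι x v) (mfderiv (𝓡 d) (𝓡 n) ι x w)

namespace ClosedSubmanifold

variable {n d : ℕ} {M : ClosedRiemannianManifold n} (S : ClosedSubmanifold M d)

/-- The embedding as a morphism of topological spaces. -/
def inclusion : TopCat.of S.toManifold.Carrier ⟶ TopCat.of M.Carrier :=
  TopCat.ofHom ⟨S.ι, S.isSmoothEmbedding.isEmbedding.continuous⟩

/-- `Σ` is orientable and `[Σ] ≠ 0` in `H_d(M; ℤ)`. As `Σ` is connected, its fundamental class is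
unique up to sign. -/
def HomologicallyNontrivial : Prop :=
  ∃ μ : (singularHomology d).obj (TopCat.of S.toManifold.Carrier),
    IsFundamentalClass d (TopCat.of S.toManifold.Carrier) μ ∧
      (singularHomology d).map S.inclusion μ ≠ 0

/-- The diameter of `Σ` with respect to the induced metric. -/
def diam : ℝ≥0∞ := S.toManifold.diam

end ClosedSubmanifold

/-- The constant `C₀ = (m² - mn + m + n) / (2 (m² - nm + 2n - 2))`. -/
def diameterConstant (n m : ℕ) : ℝ :=
  ((m : ℝ) ^ 2 - m * n + m + n) / (2 * ((m : ℝ) ^ 2 - n * m + 2 * n - 2))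

end IntermediateCurvature

end

open Filter Topology

noncomputable section
namespace IntermediateCurvature
open CategoryTheory CategoryTheory.Limits Manifold Bundle
open scoped ContDiff ENNReal

/-! The examples are products of a sphere `S^{n-m+1}` with a second factor `Y`, and `Σ` is a slice
`S^{n-m+1} × {y₀}`. It suffices to find, for each `θ` in `(0, 1)`, one example whose slice has
diameter exactly `θ π / √(λ C₀)` (`HasSlice`); letting `θ` increase to `1` gives the sequence
(`exists_seq_of_hasSlice`).

Case `m = n - 2`, where `C₀ = 1/2`. Here `C_m` is half the scalar curvature minus one sectional
curvature. On `S³(r) × S^{n-3}(r)` (a point as second factor if `n = 3`) the former is at least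
`3/r²` and the latter at most `1/r²`, so `C_m ≥ 2/r²`, while the slice has diameter `π r`
(`intermediateCurvatureGE_roundProduct`).

Case `m = n - 1`, where `C₀ = n / (2(n-1))`. Here `C_m` is half the scalar curvature. The extremal
model is the singular metric `dτ² + sin^{4/n}(τ) g_flat`, `0 < τ < π`, whose half scalar curvature
is the constant `2(n-1)/n`. With `q = n - 2` it is closed up on `S² × S^q` as `a² (dτ² + β² sin² τ
dφ²) + e^{2η} g_{S^q}`. With `s = cos τ`, `Y = 1 + (1 - s²)/δ` and `κ = q/n` the choice is `β =
Y^{-κ/2}`, `e^η = (1 + Y^{1/4})^{4/n}`. Away from the poles both `β sin τ` and `e^η` behave like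
multiples of `sin^{2/n} τ` as `δ → 0`, and `β = 1` at the poles. The curvature of the `S^q` factor
is nonnegative and is discarded. `curvature_estimate` bounds the rest below up to the poles by `θ (1
+ κ)/a²`, where `1 + κ = 1/C₀`; this gives `exists_weights`.

To compute in charts, the metric on `S²` is written as `Θ(z) g_round` with `z` the height;
`exists_isReparam` integrates the change of variable from `s` to `z` explicitly. In stereographic
charts the product metric is then diagonal, and its curvature at the centre is a polynomial in
second order jets (`curvatureCoeff_diagonal`, `sum_jetCurvature_warped`). The poles of the slice are
at distance `a π`, and any two points are joined through one of the poles by a path no longer than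
that (`diam_conformalSphere`).

For `[Σ] ≠ 0`, projection to the first factor is a retraction, so a nonzero fundamental class of the
sphere is enough. It comes from the reduced homology of spheres, computed by Mayer–Vietoris on
explicit singular chains with barycentric subdivision (`exists_isGen_of_cover`,
`exists_isFundamentalClass_sphere`). -/

/-- Continuous maps `Δⁿ → X`. -/
abbrev Simp (n : ℕ) (X : Type) [TopologicalSpace X] := C(stdSimplex ℝ (Fin (n + 1)), X)

/-- The `i`-th face inclusion `Δⁿ → Δⁿ⁺¹`. -/
def faceMap (n : ℕ) (i : Fin (n + 2)) :
    C(stdSimplex ℝ (Fin (n + 1)), stdSimplex ℝ (Fin (n + 2))) :=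
  ⟨stdSimplex.map i.succAbove, stdSimplex.continuous_map _⟩

/-- Singular chains as finitely supported functions. -/
abbrev Chain (n : ℕ) (X : Type) [TopologicalSpace X] := Simp n X →₀ ℤ

section
variable {X Y Z : Type} [TopologicalSpace X] [TopologicalSpace Y] [TopologicalSpace Z]

/-- The singular boundary. -/
def bdry (n : ℕ) (X : Type) [TopologicalSpace X] : Chain (n + 1) X →ₗ[ℤ] Chain n X :=
  Finsupp.linearCombination ℤ fun s =>
    ∑ i : Fin (n + 2), Finsupp.single (s.comp (faceMap n i)) ((-1 : ℤ) ^ (i : ℕ))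

/-- Pushforward of chains. -/
def push (n : ℕ) (f : C(X, Y)) : Chain n X →ₗ[ℤ] Chain n Y :=
  Finsupp.lmapDomain ℤ ℤ f.comp
end

/-! ### Explicit singular chains and Mathlib's singular chain complex -/

section comparison
open Simplicial
variable (X : TopCat.{0})

/-- The simplex of Mathlib's singular set that corresponds to a continuous map. -/
def toSing (n : ℕ) (s : Simp n X) : (TopCat.toSSet.obj X) _⦋n⦌ :=
  (TopCat.toSSetObjEquiv X (.op ⦋n⦌)).symm s

/-- The basis element of the singular chain complex. -/
def chainBasisElt (n : ℕ) (s : Simp n X) : (singularChains.obj X).X n :=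
  (SSet.ιChainComplex (TopCat.toSSet.obj X) (R := ModuleCat.of ℤ ℤ) (toSing X n s)).hom (1 : ℤ)

/-- With `toChain` as inverse this identifies the explicit chains with Mathlib's, and
`fromChain_bdry` and `fromChain_push` make it a natural isomorphism of complexes. Homology is
computed on the explicit side and transported at the end. -/
def fromChain (n : ℕ) : Chain n X →ₗ[ℤ] (singularChains.obj X).X n :=
  Finsupp.linearCombination ℤ (chainBasisElt X n)

def toChain (n : ℕ) : (singularChains.obj X).X n ⟶ ModuleCat.of ℤ (Chain n X) :=
  Cofan.IsColimit.desc (SSet.isColimitChainComplexXCofan (TopCat.toSSet.obj X) (ModuleCat.of ℤ ℤ) n) 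
   fun s => ModuleCat.ofHom (Finsupp.lsingle (R := ℤ) (TopCat.toSSetObjEquiv X (.op ⦋n⦌) s))

lemma fromChain_single (n : ℕ) (s : Simp n X) (a : ℤ) :
    fromChain X n (Finsupp.single s a) = a • chainBasisElt X n s := by
  have h : Finsupp.single s a = a • Finsupp.single s (1 : ℤ) := by simp
  rw [h, map_zsmul]
  congr 1
  refine (Finsupp.linearCombination_single ..).trans ?_
  exact @one_smul ℤ _ _ (Module.toDistribMulAction).toMulAction _

lemma toChain_basisElt (n : ℕ) (s : Simp n X) :
    (toChain X n).hom (chainBasisElt X n s) = Finsupp.single s 1 := by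
  have := Cofan.IsColimit.fac
    (SSet.isColimitChainComplexXCofan (TopCat.toSSet.obj X) (ModuleCat.of ℤ ℤ) n)
    (fun s => ModuleCat.ofHom (Finsupp.lsingle (R := ℤ) (TopCat.toSSetObjEquiv X (.op ⦋n⦌) s)))
    (toSing X n s)
  exact congr($(this).hom (1 : ℤ))

lemma toChain_fromChain (n : ℕ) (c : Chain n X) : (toChain X n).hom (fromChain X n c) = c := by
  induction c using Finsupp.induction_linear with
  | zero => simp only [map_zero]
  | add f g hf hg => simp only [map_add, hf, hg]
  | single s a =>
    rw [fromChain_single, map_zsmul, toChain_basisElt]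
    simp

lemma fromChain_toChain (n : ℕ) (c : (singularChains.obj X).X n) :
    fromChain X n ((toChain X n).hom c) = c := by
  have : toChain X n ≫ ModuleCat.ofHom (fromChain X n) = 𝟙 _ := by
    apply SSet.chainComplex_hom_ext
    intro s
    erw [Cofan.IsColimit.fac_assoc
      (SSet.isColimitChainComplexXCofan (TopCat.toSSet.obj X) (ModuleCat.of ℤ ℤ) n)]
    ext
    change fromChain X n (Finsupp.single _ 1) = _
    rw [fromChain_single, one_smul]
    rfl
  exact congr($(this).hom c)

lemma fromChain_bdry (n : ℕ) (c : Chain (n + 1) X) :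
    fromChain X n (bdry n X c) =
      ((singularChains.obj X).d (n + 1) n).hom (fromChain X (n + 1) c) := by
  induction c using Finsupp.induction_linear with
  | zero => simp only [map_zero]
  | add f g hf hg => simp only [map_add, hf, hg]
  | single s a =>
    have := SSet.ιChainComplex_d (TopCat.toSSet.obj X) (ModuleCat.of ℤ ℤ) (toSing X (n + 1) s)
    have h2 : ((singularChains.obj X).d (n + 1) n).hom (chainBasisElt X (n + 1) s) =
        ∑ i : Fin (n + 2), (-1 : ℤ) ^ (i : ℕ) • chainBasisElt X n (s.comp (faceMap n i)) := by
      refine (congr($(this).hom (1 : ℤ))).trans ?_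
      rw [ModuleCat.hom_sum, LinearMap.sum_apply]
      rfl
    rw [fromChain_single, map_zsmul, h2, bdry, Finsupp.linearCombination_single, map_zsmul, map_sum]
    simp_rw [fromChain_single]

lemma fromChain_push {X Y : TopCat.{0}} (f : X ⟶ Y) (n : ℕ) (c : Chain n X) :
    fromChain Y n (push n f.hom c) = ((singularChains.map f).f n).hom (fromChain X n c) := by
  induction c using Finsupp.induction_linear with
  | zero => simp only [map_zero]
  | add f g hf hg => simp only [map_add, hf, hg]
  | single s a =>
    have := SSet.ι_chainComplexMap_f _ _ (TopCat.toSSet.map f) (ModuleCat.of ℤ ℤ) (toSing X n s)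
    have h2 : ((singularChains.map f).f n).hom (chainBasisElt X n s) =
      chainBasisElt Y n (f.hom.comp s) := congr($(this).hom (1 : ℤ))
    rw [fromChain_single, map_zsmul, h2, push, Finsupp.lmapDomain_apply, Finsupp.mapDomain_single,
      fromChain_single]

end comparison

/-! ### Functoriality, homotopy invariance and contractible spaces -/

section
variable {X Y Z : Type} [TopologicalSpace X] [TopologicalSpace Y] [TopologicalSpace Z]

lemma bdry_single (n : ℕ) (s : Simp (n + 1) X) (a : ℤ) : bdry n X (Finsupp.single s a) =
    a • ∑ i : Fin (n + 2), Finsupp.single (s.comp (faceMap n i)) ((-1 : ℤ) ^ (i : ℕ)) :=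
  Finsupp.linearCombination_single ..

@[simp] lemma push_single (n : ℕ) (f : C(X, Y)) (s : Simp n X) (a : ℤ) :
    push n f (Finsupp.single s a) = Finsupp.single (f.comp s) a := by
  simp [push]

lemma push_comp (n : ℕ) (g : C(Y, Z)) (f : C(X, Y)) (c : Chain n X) :
    push n (g.comp f) c = push n g (push n f c) := by
  simp only [push, Finsupp.lmapDomain_apply, ← Finsupp.mapDomain_comp]
  rfl

lemma push_id (n : ℕ) (c : Chain n X) : push n (ContinuousMap.id X) c = c := by
  simp only [push, Finsupp.lmapDomain_apply]
  exact Finsupp.mapDomain_id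

lemma bdry_push (n : ℕ) (f : C(X, Y)) (c : Chain (n + 1) X) :
    bdry n Y (push (n + 1) f c) = push n f (bdry n X c) := by
  induction c using Finsupp.induction_linear with
  | zero => simp only [map_zero]
  | add f g hf hg => simp only [map_add, hf, hg]
  | single s a => simp [bdry_single, ContinuousMap.comp_assoc]

lemma fromChain_injective (X : TopCat.{0}) (n : ℕ) : Function.Injective (fromChain X n) :=
  Function.LeftInverse.injective (toChain_fromChain X n)

lemma fromChain_surjective (X : TopCat.{0}) (n : ℕ) : Function.Surjective (fromChain X n) :=
  Function.RightInverse.surjective (fromChain_toChain X n)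

lemma bdry_bdry (n : ℕ) (c : Chain (n + 2) X) : bdry n X (bdry (n + 1) X c) = 0 := by
  apply fromChain_injective (TopCat.of X) n
  rw [fromChain_bdry, fromChain_bdry, map_zero]
  have := (singularChains.obj (TopCat.of X)).d_comp_d (n + 2) (n + 1) n
  exact congr($(this).hom _)

lemma push_injective (n : ℕ) {f : C(X, Y)} (hf : Function.Injective f) :
    Function.Injective (push n f) :=
  Finsupp.mapDomain_injective fun s t h => by
    ext x
    exact hf (congr($h x))

/-- Homotopic maps induce homologous cycles. -/
lemma exists_bdry_of_homotopic {f g : C(X, Y)} (h : f.Homotopic g) (n : ℕ) (c : Chain (n + 1) X)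
    (hc : bdry n X c = 0) : ∃ e, push (n + 1) f c = bdry (n + 1) Y e + push (n + 1) g c := by
  obtain ⟨H⟩ := h
  -- This is the prism operator; its defining identity evaluated on a cycle is the claim.
  have K : _root_.Homotopy (singularChains.map (TopCat.ofHom f))
      (singularChains.map (TopCat.ofHom g)) := TopCat.Homotopy.singularChainComplexFunctorObjMap (C := ModuleCat.{0} ℤ)
    (f := TopCat.ofHom f) (g := TopCat.ofHom g) H (ModuleCat.of ℤ ℤ)
  have e := K.comm (n + 1)
  rw [Homotopy.dNext_succ_chainComplex, Homotopy.prevD_chainComplex] at e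
  obtain ⟨u, hu⟩ := fromChain_surjective (TopCat.of Y) (n + 2)
    ((K.hom (n + 1) (n + 2)).hom (fromChain (TopCat.of X) (n + 1) c))
  refine ⟨u, fromChain_injective (TopCat.of Y) (n + 1) ?_⟩
  rw [map_add, fromChain_bdry, hu]
  erw [fromChain_push (TopCat.ofHom f), fromChain_push (TopCat.ofHom g)]
  have e2 := congr($(e).hom (fromChain (TopCat.of X) (n + 1) c))
  have e3 : ((singularChains.obj (TopCat.of X)).d (n + 1) n).hom
      (fromChain (TopCat.of X) (n + 1) c) = 0 := by
    rw [← fromChain_bdry, hc, map_zero]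
  have e4 : ∀ z, (K.hom n (n + 1)).hom (((singularChains.obj (TopCat.of X)).d (n + 1) n).hom z) +
      ((singularChains.obj (TopCat.of Y)).d (n + 2) (n + 1)).hom
        ((K.hom (n + 1) (n + 2)).hom z) + ((singularChains.map (TopCat.ofHom g)).f (n + 1)).hom z =
      ((singularChains.map (TopCat.ofHom f)).f (n + 1)).hom z := fun z => congr($(e).hom z).symm
  have e5 := e4 (fromChain (TopCat.of X) (n + 1) c)
  rw [e3, map_zero, zero_add] at e5
  exact e5.symm

lemma exists_bdry_of_totallyDisconnected [TotallyDisconnectedSpace X] (n : ℕ) (c : Chain (n + 1) X)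
    (hc : bdry n X c = 0) : ∃ e, bdry (n + 1) X e = c := by
  have := AlgebraicTopology.singularChainComplexFunctor_exactAt_of_totallyDisconnectedSpace (ModuleCat.{0} ℤ) (n + 1)
    (ModuleCat.of ℤ ℤ) (TopCat.of X) (by simp)
  rw [HomologicalComplex.exactAt_iff' _ (n + 2) (n + 1) n (by simp) (by simp), 
    ShortComplex.moduleCat_exact_iff] at this
  obtain ⟨u, hu⟩ := this (fromChain (TopCat.of X) (n + 1) c) (by
    change ((singularChains.obj (TopCat.of X)).d (n + 1) n).hom
      (fromChain (TopCat.of X) (n + 1) c) = 0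
    rw [← fromChain_bdry, hc, map_zero])
  obtain ⟨v, rfl⟩ := fromChain_surjective (TopCat.of X) (n + 2) u
  refine ⟨v, fromChain_injective (TopCat.of X) (n + 1) ?_⟩
  rw [fromChain_bdry]
  exact hu

/-- Contractible spaces have no homology in positive degrees. -/
lemma exists_bdry_of_contractible [ContractibleSpace X] (n : ℕ) (c : Chain (n + 1) X)
    (hc : bdry n X c = 0) : ∃ e, bdry (n + 1) X e = c := by
  obtain ⟨x, hx⟩ := (contractible_iff_id_nullhomotopic X).1 inferInstance
  obtain ⟨e, he⟩ := exists_bdry_of_homotopic hx n c hc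
  rw [push_id] at he
  -- The constant map factors through a point, where cycles of positive degree bound.
  let p : C(X, Unit) := ⟨fun _ => (), by fun_prop⟩
  let j : C(Unit, X) := ⟨fun _ => x, by fun_prop⟩
  obtain ⟨u, hu⟩ := exists_bdry_of_totallyDisconnected n (push (n + 1) p c)
    (by rw [bdry_push, hc, map_zero])
  have hj : ContinuousMap.const X x = j.comp p := rfl
  refine ⟨e + push (n + 2) j u, ?_⟩
  rw [map_add, bdry_push, hu, ← push_comp, ← hj, ← he]
end

/-! ### Tuples -/

section tuples
variable {V W : Type}

/-- Formal combinations of `n`-tuples, an augmented version of affine `(n - 1)`-chains. -/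
abbrev TupleChain (V : Type) (n : ℕ) := (Fin n → V) →₀ ℤ

/-- The boundary of tuples. -/
def tupleBdry (V : Type) (n : ℕ) : TupleChain V (n + 1) →ₗ[ℤ] TupleChain V n :=
  Finsupp.linearCombination ℤ fun w =>
    ∑ i : Fin (n + 1), Finsupp.single (w ∘ i.succAbove) ((-1 : ℤ) ^ (i : ℕ))

/-- The cone with apex `b`. -/
def tupleCone (b : V) (n : ℕ) : TupleChain V n →ₗ[ℤ] TupleChain V (n + 1) :=
  Finsupp.lmapDomain ℤ ℤ (Fin.cons (α := fun _ => V) b)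

@[simp] lemma tupleCone_single (b : V) (n : ℕ) (w : Fin n → V) (a : ℤ) :
    tupleCone b n (Finsupp.single w a) = Finsupp.single (Fin.cons (α := fun _ => V) b w) a := by
  simp [tupleCone]

lemma tupleBdry_single (n : ℕ) (w : Fin (n + 1) → V) (a : ℤ) :
    tupleBdry V n (Finsupp.single w a) =
      a • ∑ i : Fin (n + 1), Finsupp.single (w ∘ i.succAbove) ((-1 : ℤ) ^ (i : ℕ)) :=
  Finsupp.linearCombination_single ..

lemma tupleBdry_cone_zero (b : V) (c : TupleChain V 0) : tupleBdry V 0 (tupleCone b 0 c) = c := by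
  induction c using Finsupp.induction_linear with
  | zero => simp only [map_zero]
  | add f g hf hg => simp only [map_add, hf, hg]
  | single w a =>
    rw [tupleCone_single, tupleBdry_single]
    simp [Subsingleton.elim _ w]

/-- Deleting the apex returns the original tuple; deleting any later entry cones off a face, with
the index shifted by one and so the opposite sign. -/
lemma tupleBdry_cone (b : V) (n : ℕ) (c : TupleChain V (n + 1)) :
    tupleBdry V (n + 1) (tupleCone b (n + 1) c) = c - tupleCone b n (tupleBdry V n c) := by
  induction c using Finsupp.induction_linear with
  | zero => simp only [map_zero, sub_zero]
  | add f g hf hg => simp only [map_add, hf, hg]; abel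
  | single w a =>
    rw [tupleCone_single, tupleBdry_single, tupleBdry_single, Fin.sum_univ_succ, map_zsmul, map_sum,
      smul_add, sub_eq_add_neg]
    congr 1
    · have : (Fin.cons b w : Fin (n + 2) → V) ∘ Fin.succAbove 0 = w := by
        ext i; simp
      rw [this]; simp
    · rw [← smul_neg, ← Finset.sum_neg_distrib]
      congr 1
      refine Finset.sum_congr rfl fun i _ => ?_
      have : (Fin.cons b w : Fin (n + 2) → V) ∘ Fin.succAbove i.succ =
          Fin.cons b (w ∘ i.succAbove) := by
        ext j
        refine Fin.cases ?_ (fun j => ?_) j <;> simp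
      rw [this, tupleCone_single, ← Finsupp.single_neg]
      simp [pow_succ]

/-- Every tuple is the cone over its tail from its first entry, so the cone formula reduces the
claim to one degree lower. -/
lemma tupleBdry_tupleBdry (n : ℕ) (c : TupleChain V (n + 2)) :
    tupleBdry V n (tupleBdry V (n + 1) c) = 0 := by
  induction n with
  | zero =>
    induction c using Finsupp.induction_linear with
    | zero => simp only [map_zero]
    | add f g hf hg => simp only [map_add, hf, hg, add_zero]
    | single w a =>
      rw [← Fin.cons_self_tail w, ← tupleCone_single, tupleBdry_cone, map_sub, tupleBdry_cone_zero,
        sub_self]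
  | succ n ih =>
    induction c using Finsupp.induction_linear with
    | zero => simp only [map_zero]
    | add f g hf hg => simp only [map_add, hf, hg, add_zero]
    | single w a =>
      rw [← Fin.cons_self_tail w, ← tupleCone_single, tupleBdry_cone, map_sub, tupleBdry_cone,
        ih, map_zero, sub_zero, sub_self]

/-- Pushforward of tuples. -/
def tupleMap (f : V → W) (n : ℕ) : TupleChain V n →ₗ[ℤ] TupleChain W n :=
  Finsupp.lmapDomain ℤ ℤ (f ∘ ·)

@[simp] lemma tupleMap_single (f : V → W) (n : ℕ) (w : Fin n → V) (a : ℤ) :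
    tupleMap f n (Finsupp.single w a) = Finsupp.single (f ∘ w) a := by
  simp [tupleMap]

lemma tupleMap_bdry (f : V → W) (n : ℕ) (c : TupleChain V (n + 1)) :
    tupleMap f n (tupleBdry V n c) = tupleBdry W n (tupleMap f (n + 1) c) := by
  induction c using Finsupp.induction_linear with
  | zero => simp only [map_zero]
  | add f g hf hg => simp only [map_add, hf, hg]
  | single w a => simp [tupleBdry_single, Function.comp_assoc]

lemma tupleMap_cone (f : V → W) (b : V) (n : ℕ) (c : TupleChain V n) :
    tupleMap f (n + 1) (tupleCone b n c) = tupleCone (f b) n (tupleMap f n c) := by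
  induction c using Finsupp.induction_linear with
  | zero => simp only [map_zero]
  | add f g hf hg => simp only [map_add, hf, hg]
  | single w a =>
    simp only [tupleCone_single, tupleMap_single]
    congr 1
    ext j
    refine Fin.cases ?_ (fun j => ?_) j <;> simp

variable (β : ∀ n, (Fin (n + 1) → V) → V)

/-- Barycentric subdivision of tuples, with "barycentre" `β`. -/
def tupleSd : ∀ n, TupleChain V n →ₗ[ℤ] TupleChain V n
  | 0 => LinearMap.id
  | n + 1 => Finsupp.linearCombination ℤ fun w =>
      tupleCone (β n w) n (tupleSd n (tupleBdry V n (Finsupp.single w 1)))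

/-- The chain homotopy between barycentric subdivision and the identity. -/
def tupleHtpy : ∀ n, TupleChain V n →ₗ[ℤ] TupleChain V (n + 1)
  | 0 => 0
  | n + 1 => Finsupp.linearCombination ℤ fun w =>
      tupleCone (β n w) (n + 1)
        (Finsupp.single w 1 - tupleHtpy n (tupleBdry V n (Finsupp.single w 1)))

lemma tupleSd_single (n : ℕ) (w : Fin (n + 1) → V) : tupleSd β (n + 1) (Finsupp.single w 1) =
      tupleCone (β n w) n (tupleSd β n (tupleBdry V n (Finsupp.single w 1))) := by
  rw [tupleSd, Finsupp.linearCombination_single, one_smul]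

lemma tupleHtpy_single (n : ℕ) (w : Fin (n + 1) → V) : tupleHtpy β (n + 1) (Finsupp.single w 1) =
      tupleCone (β n w) (n + 1)
        (Finsupp.single w 1 - tupleHtpy β n (tupleBdry V n (Finsupp.single w 1))) := by
  rw [tupleHtpy, Finsupp.linearCombination_single, one_smul]

lemma tuple_induction {n : ℕ} {M : Type} [AddCommGroup M] [Module ℤ M]
    {f g : TupleChain V n →ₗ[ℤ] M} (h : ∀ w, f (Finsupp.single w 1) = g (Finsupp.single w 1)) :
    f = g :=
  Finsupp.lhom_ext' fun w => LinearMap.ext_ring (h w)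

/-- By the cone formula the error term is the cone over the subdivision of a double boundary. -/
lemma tupleBdry_tupleSd (n : ℕ) (c : TupleChain V (n + 1)) :
    tupleBdry V n (tupleSd β (n + 1) c) = tupleSd β n (tupleBdry V n c) := by
  induction n with
  | zero =>
    refine LinearMap.congr_fun (f := tupleBdry V 0 ∘ₗ tupleSd β 1)
      (g := tupleSd β 0 ∘ₗ tupleBdry V 0) (tuple_induction fun w => ?_) c
    simp only [LinearMap.comp_apply]
    rw [tupleSd_single, tupleBdry_cone_zero]
  | succ n ih =>
    refine LinearMap.congr_fun (f := tupleBdry V (n + 1) ∘ₗ tupleSd β (n + 2))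
      (g := tupleSd β (n + 1) ∘ₗ tupleBdry V (n + 1)) (tuple_induction fun w => ?_) c
    simp only [LinearMap.comp_apply]
    rw [tupleSd_single, tupleBdry_cone, ih, tupleBdry_tupleBdry, map_zero, map_zero, sub_zero]

/-- By induction the chain that is coned off, `w - D ∂w`, has boundary `Sd ∂w`, and the cone over
that is `Sd w`. -/
lemma tupleBdry_tupleHtpy (n : ℕ) (c : TupleChain V (n + 1)) :
    tupleBdry V (n + 1) (tupleHtpy β (n + 1) c) =
      c - tupleSd β (n + 1) c - tupleHtpy β n (tupleBdry V n c) := by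
  induction n with
  | zero =>
    refine LinearMap.congr_fun (f := tupleBdry V 1 ∘ₗ tupleHtpy β 1)
      (g := LinearMap.id - tupleSd β 1 - tupleHtpy β 0 ∘ₗ tupleBdry V 0)
      (tuple_induction fun w => ?_) c
    simp only [LinearMap.comp_apply, LinearMap.sub_apply, LinearMap.id_apply]
    rw [tupleHtpy_single, tupleBdry_cone, tupleSd_single]
    simp [tupleHtpy, tupleSd]
  | succ n ih =>
    refine LinearMap.congr_fun (f := tupleBdry V (n + 2) ∘ₗ tupleHtpy β (n + 2))
      (g := LinearMap.id - tupleSd β (n + 2) - tupleHtpy β (n + 1) ∘ₗ tupleBdry V (n + 1))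
      (tuple_induction fun w => ?_) c
    simp only [LinearMap.comp_apply, LinearMap.sub_apply, LinearMap.id_apply]
    rw [tupleHtpy_single, tupleBdry_cone, map_sub, ih, tupleBdry_tupleBdry, tupleSd_single,
      map_zero, sub_zero, sub_sub_cancel]
    abel

variable {β} {β' : ∀ n, (Fin (n + 1) → W) → W}

/-- Naturality needs only compatibility with the chosen centres. It is applied to affine maps, which
preserve barycentres. -/
lemma tupleMap_tupleSd {f : V → W} (hf : ∀ n w, f (β n w) = β' n (f ∘ w)) (n : ℕ)
    (c : TupleChain V n) : tupleMap f n (tupleSd β n c) = tupleSd β' n (tupleMap f n c) := by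
  induction n with
  | zero => rfl
  | succ n ih =>
    refine LinearMap.congr_fun (f := tupleMap f (n + 1) ∘ₗ tupleSd β (n + 1))
      (g := tupleSd β' (n + 1) ∘ₗ tupleMap f (n + 1)) (tuple_induction fun w => ?_) c
    simp only [LinearMap.comp_apply]
    rw [tupleSd_single, tupleMap_cone, ih, tupleMap_bdry, tupleMap_single, tupleSd_single, hf]

lemma tupleMap_tupleHtpy {f : V → W} (hf : ∀ n w, f (β n w) = β' n (f ∘ w)) (n : ℕ)
    (c : TupleChain V n) :
    tupleMap f (n + 1) (tupleHtpy β n c) = tupleHtpy β' n (tupleMap f n c) := by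
  induction n with
  | zero => simp [tupleHtpy]
  | succ n ih =>
    refine LinearMap.congr_fun (f := tupleMap f (n + 2) ∘ₗ tupleHtpy β (n + 1))
      (g := tupleHtpy β' (n + 1) ∘ₗ tupleMap f (n + 1)) (tuple_induction fun w => ?_) c
    simp only [LinearMap.comp_apply]
    rw [tupleHtpy_single, tupleMap_cone, map_sub, ih, tupleMap_bdry, tupleMap_single,
      tupleHtpy_single, hf]
end tuples

/-! ### Affine simplices -/

section affine
variable {I J K : Type} [Fintype I] [Fintype J] [Fintype K]

/-- The affine combination `∑ᵢ tᵢ wᵢ` of points of a standard simplex. -/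
def affComb (w : I → stdSimplex ℝ J) (t : stdSimplex ℝ I) : stdSimplex ℝ J :=
  ⟨fun k => ∑ i, t i * w i k, fun k => Finset.sum_nonneg fun i _ =>
    mul_nonneg (stdSimplex.zero_le t i) (stdSimplex.zero_le (w i) k), by
    rw [Finset.sum_comm]
    simp only [← Finset.mul_sum, stdSimplex.sum_eq_one, mul_one]⟩

lemma affComb_apply (w : I → stdSimplex ℝ J) (t : stdSimplex ℝ I) (k : J) :
    affComb w t k = ∑ i, t i * w i k := rfl

lemma affComb_affComb (w : J → stdSimplex ℝ K) (v : I → stdSimplex ℝ J) (t : stdSimplex ℝ I) :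
    affComb w (affComb v t) = affComb (fun i => affComb w (v i)) t := by
  apply stdSimplex.ext
  ext k
  simp only [affComb_apply, Finset.sum_mul, Finset.mul_sum]
  rw [Finset.sum_comm]
  exact Finset.sum_congr rfl fun i _ => Finset.sum_congr rfl fun j _ => by ring

lemma affComb_vertex [DecidableEq I] (w : I → stdSimplex ℝ J) (i : I) :
    affComb w (stdSimplex.vertex i) = w i := by
  apply stdSimplex.ext
  ext k
  rw [affComb_apply, Finset.sum_eq_single i]
  · simp
  · intro j _ hj; simp [hj]
  · simp

lemma affComb_vertex_self [DecidableEq I] (t : stdSimplex ℝ I) :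
    affComb (fun i => stdSimplex.vertex (S := ℝ) i) t = t := by
  apply stdSimplex.ext
  ext k
  rw [affComb_apply, Finset.sum_eq_single k]
  · simp
  · intro j _ hj; simp [hj.symm]
  · simp

lemma continuous_affComb (w : I → stdSimplex ℝ J) : Continuous (affComb w) := by
  refine Continuous.subtype_mk (continuous_pi fun k => continuous_finsetSum _ fun i _ => ?_) _
  exact ((continuous_apply i).comp continuous_subtype_val).mul continuous_const

lemma affComb_map (w : J → stdSimplex ℝ K) (f : I → J) (t : stdSimplex ℝ I) :
    affComb w (stdSimplex.map f t) = affComb (w ∘ f) t := by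
  classical
  apply stdSimplex.ext
  ext k
  simp only [affComb_apply, stdSimplex.map_coe, FunOnFinite.linearMap_apply_apply, Finset.sum_mul]
  rw [← Finset.sum_fiberwise Finset.univ f]
  refine Finset.sum_congr rfl fun j _ => Finset.sum_congr rfl fun i hi => ?_
  simp at hi
  simp [hi]

/-- Balls of the sup metric are convex. -/
lemma dist_affComb_le (x : stdSimplex ℝ J) (w : I → stdSimplex ℝ J) (t : stdSimplex ℝ I) {R : ℝ}
    (hR : ∀ i, dist x (w i) ≤ R) : dist x (affComb w t) ≤ R := by
  have ht := stdSimplex.sum_eq_one t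
  have hne : Nonempty I := by
    by_contra h
    rw [not_nonempty_iff] at h
    simp at ht
  have hR0 : 0 ≤ R := dist_nonneg.trans (hR hne.some)
  rw [Subtype.dist_eq, dist_pi_le_iff hR0]
  intro k
  have e : x k - affComb w t k = ∑ i, t i * (x k - w i k) := by
    simp only [mul_sub, Finset.sum_sub_distrib, ← Finset.sum_mul, ht, one_mul, affComb_apply]
  change |x k - affComb w t k| ≤ R
  rw [e]
  calc |∑ i, t i * (x k - w i k)| ≤ ∑ i, t i * R := by
        refine (Finset.abs_sum_le_sum_abs _ _).trans (Finset.sum_le_sum fun i _ => ?_)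
        rw [abs_mul, abs_of_nonneg (stdSimplex.zero_le t i)]
        refine mul_le_mul_of_nonneg_left ?_ (stdSimplex.zero_le t i)
        exact (dist_le_pi_dist (x : J → ℝ) (w i) k).trans (hR i)
    _ = R := by rw [← Finset.sum_mul, ht, one_mul]

/-- The barycentre of a tuple of points. -/
def bary (n : ℕ) (w : Fin (n + 1) → stdSimplex ℝ J) : stdSimplex ℝ J :=
  affComb w stdSimplex.barycenter

lemma affComb_bary (w : J → stdSimplex ℝ K) (n : ℕ) (v : Fin (n + 1) → stdSimplex ℝ J) :
    affComb w (bary n v) = bary n (affComb w ∘ v) :=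
  affComb_affComb _ _ _

/-- Of the `n + 1` equal weights `1/(n+1)`, the one at `w i` itself contributes nothing. -/
lemma dist_bary_le (n : ℕ) (w : Fin (n + 1) → stdSimplex ℝ J) {D : ℝ}
    (hD : ∀ i j, dist (w i) (w j) ≤ D) (i : Fin (n + 1)) :
    dist (bary n w) (w i) ≤ n / (n + 1) * D := by
  have hD0 : 0 ≤ D := dist_nonneg.trans (hD i i)
  rw [Subtype.dist_eq, dist_pi_le_iff (by positivity)]
  intro k
  have e : bary n w k - w i k = ∑ j ∈ Finset.univ.erase i, (n + 1 : ℝ)⁻¹ * (w j k - w i k) := by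
    rw [Finset.sum_erase _ (by simp), ← Finset.mul_sum, Finset.sum_sub_distrib, bary, affComb_apply]
    have h : ∀ x, (stdSimplex.barycenter : stdSimplex ℝ (Fin (n + 1))) x = (n + 1 : ℝ)⁻¹ :=
      fun x => (stdSimplex.barycenter_apply x).trans (by simp)
    simp only [h, ← Finset.mul_sum]
    simp
    field_simp
  change |bary n w k - w i k| ≤ _
  rw [e]
  calc |∑ j ∈ Finset.univ.erase i, (n + 1 : ℝ)⁻¹ * (w j k - w i k)|
      ≤ ∑ j ∈ Finset.univ.erase i, (n + 1 : ℝ)⁻¹ * D := by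
        refine (Finset.abs_sum_le_sum_abs _ _).trans (Finset.sum_le_sum fun j _ => ?_)
        rw [abs_mul, abs_of_nonneg (by positivity)]
        refine mul_le_mul_of_nonneg_left ?_ (by positivity)
        exact (dist_le_pi_dist (w j : J → ℝ) (w i) k).trans (hD j i)
    _ = n / (n + 1) * D := by
        rw [Finset.sum_const, Finset.card_erase_of_mem (Finset.mem_univ i)]
        simp
        field_simp

end affine

/-! ### Supports of chains -/

section supported
variable {α β : Type}

lemma mem_supported_of_single {M : Type} [AddCommGroup M] [Module ℤ M] {Q : Set α}
    {S : Submodule ℤ M} (f : (α →₀ ℤ) →ₗ[ℤ] M) (h : ∀ w ∈ Q, f (Finsupp.single w 1) ∈ S)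
    {c : α →₀ ℤ} (hc : c ∈ Finsupp.supported ℤ ℤ Q) : f c ∈ S := by
  rw [Finsupp.supported_eq_span_single] at hc
  suffices Submodule.span ℤ ((fun i => Finsupp.single i (1 : ℤ)) '' Q) ≤ S.comap f from this hc
  rw [Submodule.span_le]
  rintro _ ⟨w, hw, rfl⟩
  exact h w hw
end supported

/-! ### The mesh of the barycentric subdivision -/

section mesh
variable {J : Type} [Fintype J]

/-- `w'` lies in every ball that contains `w`. -/
def InHull {m n : ℕ} (w : Fin m → stdSimplex ℝ J) (w' : Fin n → stdSimplex ℝ J) : Prop :=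
  ∀ (x : stdSimplex ℝ J) (R : ℝ), (∀ i, dist x (w i) ≤ R) → ∀ j, dist x (w' j) ≤ R

lemma tupleBdry_mem_supported {V : Type} (n : ℕ) (w : Fin (n + 1) → V) :
    tupleBdry V n (Finsupp.single w 1) ∈
      Finsupp.supported ℤ ℤ (Set.range fun i : Fin (n + 1) => w ∘ i.succAbove) := by
  rw [tupleBdry_single, one_smul]
  exact Submodule.sum_mem _ fun i _ => Finsupp.single_mem_supported _ _ ⟨i, rfl⟩

/-- The simplices of the barycentric subdivision are smaller by a factor. -/
lemma tupleSd_mem_supported (n : ℕ) (w : Fin n → stdSimplex ℝ J) :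
    tupleSd bary n (Finsupp.single w 1) ∈ Finsupp.supported ℤ ℤ
      {w' | InHull w w' ∧ ∀ D : ℝ, (∀ i j, dist (w i) (w j) ≤ D) →
        ∀ i j, dist (w' i) (w' j) ≤ (n - 1) / n * D} := by
  induction n with
  | zero =>
    exact Finsupp.single_mem_supported _ _ ⟨fun x R _ i => i.elim0, fun _ _ i => i.elim0⟩
  | succ n ih =>
    rw [tupleSd_single]
    refine mem_supported_of_single (tupleCone (bary n w) n ∘ₗ tupleSd bary n) (fun v hv => ?_)
      (tupleBdry_mem_supported n w)
    obtain ⟨k, rfl⟩ := hv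
    refine mem_supported_of_single (tupleCone (bary n w) n) (fun u hu => ?_) (ih (w ∘ k.succAbove))
    obtain ⟨hu1, hu2⟩ := hu
    rw [tupleCone_single]
    refine Finsupp.single_mem_supported _ _ ⟨fun x R hR j => ?_, fun D hD => ?_⟩
    · refine Fin.cases ?_ (fun j => ?_) j
      · exact dist_affComb_le _ _ _ hR
      · exact hu1 x R (fun i => hR _) j
    · have hD0 : 0 ≤ D := dist_nonneg.trans (hD 0 0)
      have hb := dist_bary_le n w hD
      have hbu : ∀ j, dist (bary n w) (u j) ≤ n / (n + 1) * D := hu1 _ _ fun i => hb _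
      push_cast
      rw [add_sub_cancel_right]
      intro i j
      refine Fin.cases ?_ (fun i => ?_) i <;> refine Fin.cases ?_ (fun j => ?_) j
      · simp; positivity
      · exact hbu j
      · rw [dist_comm]; exact hbu i
      -- Two vertices coming from the same subdivided face, which has `n` vertices: the inductive
      -- factor `(n-1)/n` is at most `n/(n+1)`.
      · refine (hu2 D (fun i j => hD _ _) i j).trans ?_
        refine mul_le_mul_of_nonneg_right ?_ hD0
        have : 0 < n := i.pos
        rw [div_le_div_iff₀ (by positivity) (by positivity)]
        nlinarith

lemma tupleSd_iterate_mem_supported (n m : ℕ) (w : Fin n → stdSimplex ℝ J) {D : ℝ}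
    (hD : ∀ i j, dist (w i) (w j) ≤ D) :
    (tupleSd bary n)^[m] (Finsupp.single w 1) ∈ Finsupp.supported ℤ ℤ
      {w' | ∀ i j, dist (w' i) (w' j) ≤ ((n - 1 : ℝ) / n) ^ m * D} := by
  induction m with
  | zero => exact Finsupp.single_mem_supported _ _ (by simpa using hD)
  | succ m ih =>
    rw [Function.iterate_succ_apply']
    refine mem_supported_of_single (tupleSd bary n) (fun u hu => ?_) ih
    refine Finsupp.supported_mono ?_ (tupleSd_mem_supported n u)
    rintro v ⟨-, hv⟩ i j
    refine (hv _ hu i j).trans (le_of_eq ?_)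
    rw [pow_succ]; ring
end mesh

/-! ### Barycentric subdivision of singular chains -/

section subdivision

lemma chain_hom_ext {α : Type} {M : Type} [AddCommGroup M] [Module ℤ M]
    {f g : (α →₀ ℤ) →ₗ[ℤ] M} (h : ∀ w, f (Finsupp.single w 1) = g (Finsupp.single w 1))
    (c : α →₀ ℤ) : f c = g c :=
  LinearMap.congr_fun (Finsupp.lhom_ext' fun w => LinearMap.ext_ring (h w)) c

/-- The affine simplex with given vertices. -/
def affSimp {n N : ℕ} (w : Fin (n + 1) → stdSimplex ℝ (Fin (N + 1))) :
    Simp n (stdSimplex ℝ (Fin (N + 1))) :=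
  ⟨affComb w, continuous_affComb w⟩

/-- The singular chain of a combination of affine simplices. -/
def affChain (n N : ℕ) : TupleChain (stdSimplex ℝ (Fin (N + 1))) (n + 1) →ₗ[ℤ]
    Chain n (stdSimplex ℝ (Fin (N + 1))) :=
  Finsupp.lmapDomain ℤ ℤ affSimp

@[simp] lemma affChain_single {n N : ℕ} (w : Fin (n + 1) → stdSimplex ℝ (Fin (N + 1))) (a : ℤ) :
    affChain n N (Finsupp.single w a) = Finsupp.single (affSimp w) a := by
  simp [affChain]

/-- The tuple of the vertices of the standard simplex. -/
def vertices (n : ℕ) : Fin (n + 1) → stdSimplex ℝ (Fin (n + 1)) :=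
  fun i => stdSimplex.vertex i

lemma affSimp_vertices (n : ℕ) : affSimp (vertices n) = ContinuousMap.id _ :=
  ContinuousMap.ext affComb_vertex_self

lemma affSimp_comp_faceMap {n N : ℕ} (w : Fin (n + 2) → stdSimplex ℝ (Fin (N + 1)))
    (i : Fin (n + 2)) : (affSimp w).comp (faceMap n i) = affSimp (w ∘ i.succAbove) :=
  ContinuousMap.ext fun t => affComb_map w _ t

lemma affSimp_comp_affSimp {n N M : ℕ} (w : Fin (N + 1) → stdSimplex ℝ (Fin (M + 1)))
    (v : Fin (n + 1) → stdSimplex ℝ (Fin (N + 1))) :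
    (affSimp w).comp (affSimp v) = affSimp (affSimp w ∘ v) :=
  ContinuousMap.ext fun t => affComb_affComb w v t

lemma bdry_affChain (n N : ℕ) (c : TupleChain (stdSimplex ℝ (Fin (N + 1))) (n + 2)) :
    bdry n _ (affChain (n + 1) N c) = affChain n N (tupleBdry _ (n + 1) c) := by
  refine chain_hom_ext (f := bdry n _ ∘ₗ affChain (n + 1) N)
    (g := affChain n N ∘ₗ tupleBdry _ (n + 1)) (fun w => ?_) c
  simp [bdry_single, tupleBdry_single, affSimp_comp_faceMap]

lemma push_affSimp {n N M : ℕ} (w : Fin (N + 1) → stdSimplex ℝ (Fin (M + 1)))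
    (c : TupleChain (stdSimplex ℝ (Fin (N + 1))) (n + 1)) :
    push n (affSimp w) (affChain n N c) = affChain n M (tupleMap (affSimp w) (n + 1) c) := by
  refine chain_hom_ext (f := push n (affSimp w) ∘ₗ affChain n N)
    (g := affChain n M ∘ₗ tupleMap (affSimp w) (n + 1)) (fun v => ?_) c
  simp [affSimp_comp_affSimp]

lemma affSimp_comp_vertices {n N : ℕ} (w : Fin (n + 1) → stdSimplex ℝ (Fin (N + 1))) :
    affSimp w ∘ vertices n = w :=
  funext fun i => affComb_vertex w i

variable {X Y : Type} [TopologicalSpace X] [TopologicalSpace Y]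

/-- Barycentric subdivision. -/
def sdChain (n : ℕ) (X : Type) [TopologicalSpace X] : Chain n X →ₗ[ℤ] Chain n X :=
  Finsupp.linearCombination ℤ fun s =>
    push n s (affChain n n (tupleSd bary (n + 1) (Finsupp.single (vertices n) 1)))

/-- The chain homotopy between barycentric subdivision and the identity. -/
def htpyChain (n : ℕ) (X : Type) [TopologicalSpace X] : Chain n X →ₗ[ℤ] Chain (n + 1) X :=
  Finsupp.linearCombination ℤ fun s =>
    push (n + 1) s (affChain (n + 1) n (tupleHtpy bary (n + 1) (Finsupp.single (vertices n) 1)))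

lemma sdChain_single (n : ℕ) (s : Simp n X) : sdChain n X (Finsupp.single s 1) =
    push n s (affChain n n (tupleSd bary (n + 1) (Finsupp.single (vertices n) 1))) :=
  (Finsupp.linearCombination_single ..).trans (one_smul _ _)

lemma htpyChain_single (n : ℕ) (s : Simp n X) : htpyChain n X (Finsupp.single s 1) =
    push (n + 1) s
      (affChain (n + 1) n (tupleHtpy bary (n + 1) (Finsupp.single (vertices n) 1))) :=
  (Finsupp.linearCombination_single ..).trans (one_smul _ _)

lemma sdChain_push (n : ℕ) (f : C(X, Y)) (c : Chain n X) :
    sdChain n Y (push n f c) = push n f (sdChain n X c) := by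
  refine chain_hom_ext (f := sdChain n Y ∘ₗ push n f) (g := push n f ∘ₗ sdChain n X)
    (fun s => ?_) c
  simp [sdChain_single, push_comp]

lemma htpyChain_push (n : ℕ) (f : C(X, Y)) (c : Chain n X) :
    htpyChain n Y (push n f c) = push (n + 1) f (htpyChain n X c) := by
  refine chain_hom_ext (f := htpyChain n Y ∘ₗ push n f) (g := push (n + 1) f ∘ₗ htpyChain n X)
    (fun s => ?_) c
  simp [htpyChain_single, push_comp]

lemma sdChain_affChain (n N : ℕ) (c : TupleChain (stdSimplex ℝ (Fin (N + 1))) (n + 1)) :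
    sdChain n _ (affChain n N c) = affChain n N (tupleSd bary (n + 1) c) := by
  refine chain_hom_ext (f := sdChain n _ ∘ₗ affChain n N)
    (g := affChain n N ∘ₗ tupleSd bary (n + 1)) (fun w => ?_) c
  simp only [LinearMap.comp_apply, affChain_single, sdChain_single]
  rw [push_affSimp, tupleMap_tupleSd (f := affSimp w) (β' := bary) (fun n v => affComb_bary w n v),
    tupleMap_single, affSimp_comp_vertices]

lemma htpyChain_affChain (n N : ℕ) (c : TupleChain (stdSimplex ℝ (Fin (N + 1))) (n + 1)) :
    htpyChain n _ (affChain n N c) = affChain (n + 1) N (tupleHtpy bary (n + 1) c) := by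
  refine chain_hom_ext (f := htpyChain n _ ∘ₗ affChain n N)
    (g := affChain (n + 1) N ∘ₗ tupleHtpy bary (n + 1)) (fun w => ?_) c
  simp only [LinearMap.comp_apply, affChain_single, htpyChain_single]
  rw [push_affSimp, tupleMap_tupleHtpy (f := affSimp w) (β' := bary) (fun n v => affComb_bary w n v),
    tupleMap_single, affSimp_comp_vertices]

/-- Subdivision is defined by pushing forward a chain on the standard simplex; the boundary in the
same form lets the identities for tuples pass to singular chains. -/
lemma bdry_single_eq_push (n : ℕ) (s : Simp (n + 1) X) : bdry n X (Finsupp.single s 1) =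
    push n s (affChain n (n + 1) (tupleBdry _ (n + 1) (Finsupp.single (vertices (n + 1)) 1))) := by
  rw [← bdry_affChain, affChain_single, affSimp_vertices, ← bdry_push, push_single]
  rfl

lemma bdry_sdChain (n : ℕ) (c : Chain (n + 1) X) :
    bdry n X (sdChain (n + 1) X c) = sdChain n X (bdry n X c) := by
  refine chain_hom_ext (f := bdry n X ∘ₗ sdChain (n + 1) X) (g := sdChain n X ∘ₗ bdry n X)
    (fun s => ?_) c
  simp only [LinearMap.comp_apply, sdChain_single]
  rw [bdry_push, bdry_affChain, tupleBdry_tupleSd, bdry_single_eq_push, sdChain_push,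
    sdChain_affChain]

lemma bdry_htpyChain (n : ℕ) (c : Chain (n + 1) X) :
    bdry (n + 1) X (htpyChain (n + 1) X c) =
      c - sdChain (n + 1) X c - htpyChain n X (bdry n X c) := by
  refine chain_hom_ext (f := bdry (n + 1) X ∘ₗ htpyChain (n + 1) X)
    (g := LinearMap.id - sdChain (n + 1) X - htpyChain n X ∘ₗ bdry n X) (fun s => ?_) c
  simp only [LinearMap.comp_apply, LinearMap.sub_apply, LinearMap.id_apply, htpyChain_single]
  rw [bdry_push, bdry_affChain, tupleBdry_tupleHtpy, map_sub, map_sub, map_sub, map_sub,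
    bdry_single_eq_push, htpyChain_push, htpyChain_affChain, sdChain_single, affChain_single,
    affSimp_vertices, push_single]
  rfl

lemma bdry_htpyChain_zero (c : Chain 0 X) :
    bdry 0 X (htpyChain 0 X c) = c - sdChain 0 X c := by
  refine chain_hom_ext (f := bdry 0 X ∘ₗ htpyChain 0 X)
    (g := LinearMap.id - sdChain 0 X) (fun s => ?_) c
  simp only [LinearMap.comp_apply, LinearMap.sub_apply, LinearMap.id_apply, htpyChain_single]
  rw [bdry_push, bdry_affChain, tupleBdry_tupleHtpy, map_sub, map_sub, map_sub, map_sub,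
    sdChain_single, affChain_single, affSimp_vertices, push_single]
  simp [tupleHtpy]

lemma sdChain_iterate_push (n m : ℕ) (f : C(X, Y)) (c : Chain n X) :
    (sdChain n Y ^ m) (push n f c) = push n f ((sdChain n X ^ m) c) := by
  induction m with
  | zero => rfl
  | succ m ih => rw [pow_succ', pow_succ', Module.End.mul_apply, ih, sdChain_push, Module.End.mul_apply]

lemma bdry_sdChain_iterate (n m : ℕ) (c : Chain (n + 1) X) :
    bdry n X ((sdChain (n + 1) X ^ m) c) = (sdChain n X ^ m) (bdry n X c) := by
  induction m with
  | zero => rfl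
  | succ m ih => rw [pow_succ', pow_succ', Module.End.mul_apply, bdry_sdChain, ih, Module.End.mul_apply]

/-- The iterated subdivision of a cycle is homologous to it. -/
lemma exists_bdry_sdChain_iterate (n m : ℕ) (c : Chain (n + 1) X) (hc : bdry n X c = 0) :
    ∃ e, c = (sdChain (n + 1) X ^ m) c + bdry (n + 1) X e := by
  induction m with
  | zero => exact ⟨0, by simp⟩
  | succ m ih =>
    obtain ⟨e, he⟩ := ih
    refine ⟨e + htpyChain (n + 1) X ((sdChain (n + 1) X ^ m) c), ?_⟩
    rw [map_add, bdry_htpyChain, bdry_sdChain_iterate, hc]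
    rw [map_zero, map_zero, sub_zero, pow_succ', Module.End.mul_apply]
    nth_rewrite 1 [he]
    abel

lemma exists_bdry_sdChain_iterate_zero (m : ℕ) (c : Chain 0 X) :
    ∃ e, c = (sdChain 0 X ^ m) c + bdry 0 X e := by
  induction m with
  | zero => exact ⟨0, by simp⟩
  | succ m ih =>
    obtain ⟨e, he⟩ := ih
    refine ⟨e + htpyChain 0 X ((sdChain 0 X ^ m) c), ?_⟩
    rw [map_add, bdry_htpyChain_zero, pow_succ', Module.End.mul_apply]
    nth_rewrite 1 [he]
    abel

end subdivision

/-! ### Chains small with respect to an open cover -/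

section small
variable {X Y : Type} [TopologicalSpace X] [TopologicalSpace Y]

/-- The inclusion of a subset. -/
def incl (A : Set X) : C(A, X) := ⟨Subtype.val, continuous_subtype_val⟩

/-- The inclusion of a smaller subset. -/
def inclOfSubset {A B : Set X} (h : A ⊆ B) : C(A, B) :=
  ⟨Set.inclusion h, continuous_inclusion h⟩

lemma incl_comp_inclOfSubset {A B : Set X} (h : A ⊆ B) :
    (incl B).comp (inclOfSubset h) = incl A := rfl

/-- The simplices with image in `A`. -/
def simpIn (n : ℕ) (A : Set X) : Set (Simp n X) := {s | Set.range s ⊆ A}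

lemma exists_push_incl {n : ℕ} {A : Set X} {c : Chain n X}
    (hc : c ∈ Finsupp.supported ℤ ℤ (simpIn n A)) : ∃ c', push n (incl A) c' = c := by
  refine mem_supported_of_single (S := LinearMap.range (push n (incl A))) LinearMap.id
    (fun s hs => ?_) hc
  refine ⟨Finsupp.single ⟨Set.codRestrict s A fun x => hs ⟨x, rfl⟩, by fun_prop⟩ 1, ?_⟩
  rw [push_single]
  rfl

lemma push_incl_mem (n : ℕ) (A : Set X) (c : Chain n A) :
    push n (incl A) c ∈ Finsupp.supported ℤ ℤ (simpIn n A) := by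
  induction c using Finsupp.induction_linear with
  | zero => rw [map_zero]; exact Submodule.zero_mem _
  | add f g hf hg => rw [map_add]; exact Submodule.add_mem _ hf hg
  | single s a =>
    rw [push_single]
    refine Finsupp.single_mem_supported _ _ ?_
    rintro _ ⟨x, rfl⟩
    exact (s x).2

/-- A chain that lies in `A` and in `B` lies in `A ∩ B`. -/
lemma exists_push_inter {n : ℕ} {A B : Set X} {a : Chain n A} {b : Chain n B}
    (h : push n (incl A) a = push n (incl B) b) : ∃ c : Chain n (A ∩ B : Set X),
      push n (inclOfSubset Set.inter_subset_left) c = a ∧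
      push n (inclOfSubset Set.inter_subset_right) c = b := by
  obtain ⟨c, hc⟩ : ∃ c, push n (incl (A ∩ B)) c = push n (incl A) a := by
    apply exists_push_incl
    have : simpIn n (A ∩ B) = simpIn n A ∩ simpIn n B := by
      ext s; simp [simpIn, Set.subset_inter_iff]
    rw [this, Finsupp.supported_inter]
    exact ⟨push_incl_mem n A a, h ▸ push_incl_mem n B b⟩
  refine ⟨c, push_injective n (f := incl A) Subtype.val_injective ?_,
    push_injective n (f := incl B) Subtype.val_injective ?_⟩
  · rw [← push_comp, incl_comp_inclOfSubset, hc]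
  · rw [← push_comp, incl_comp_inclOfSubset, hc, h]

lemma sdChain_mem_supported (n : ℕ) (A : Set X) {c : Chain n X}
    (hc : c ∈ Finsupp.supported ℤ ℤ (simpIn n A)) :
    sdChain n X c ∈ Finsupp.supported ℤ ℤ (simpIn n A) := by
  obtain ⟨c', rfl⟩ := exists_push_incl hc
  rw [sdChain_push]
  exact push_incl_mem _ _ _

/-- The small chains of a cover by two sets. -/
def smallChains (n : ℕ) (A B : Set X) : Submodule ℤ (Chain n X) :=
  Finsupp.supported ℤ ℤ (simpIn n A) ⊔ Finsupp.supported ℤ ℤ (simpIn n B)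

lemma sdChain_pow_mem_smallChains (n m : ℕ) (A B : Set X) {c : Chain n X}
    (hc : c ∈ smallChains n A B) : (sdChain n X ^ m) c ∈ smallChains n A B := by
  induction m with
  | zero => simpa using hc
  | succ m ih =>
    rw [pow_succ', Module.End.mul_apply]
    obtain ⟨a, ha, b, hb, h⟩ := Submodule.mem_sup.1 ih
    rw [← h, map_add]
    exact Submodule.add_mem_sup (sdChain_mem_supported n A ha) (sdChain_mem_supported n B hb)

lemma sdChain_pow_affChain (n m N : ℕ) (c : TupleChain (stdSimplex ℝ (Fin (N + 1))) (n + 1)) :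
    (sdChain n _ ^ m) (affChain n N c) = affChain n N ((tupleSd bary (n + 1))^[m] c) := by
  induction m with
  | zero => rfl
  | succ m ih =>
    rw [pow_succ', Module.End.mul_apply, ih, sdChain_affChain, Function.iterate_succ_apply']

/-- The `m`-th subdivision of `Δⁿ` has mesh at most `(n/(n+1))^m`, which eventually drops below a
Lebesgue number of the cover pulled back along `s`. -/
lemma exists_sdChain_pow_single_mem {A B : Set X} (hA : IsOpen A) (hB : IsOpen B)
    (hAB : A ∪ B = Set.univ) (n : ℕ) (s : Simp n X) :
    ∃ m, (sdChain n X ^ m) (Finsupp.single s 1) ∈ smallChains n A B := by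
  obtain ⟨δ, hδ, hleb⟩ := lebesgue_number_lemma_of_metric (s := Set.univ)
    (c := fun i : Bool => s ⁻¹' (if i then A else B)) isCompact_univ
    (fun i => by cases i <;> simp only [Bool.false_eq_true, if_false, if_true] <;>
      exact IsOpen.preimage s.continuous (by assumption))
    (fun x _ => by
      have : s x ∈ A ∪ B := hAB ▸ Set.mem_univ _
      rw [Set.mem_iUnion]
      exact this.elim (fun h => ⟨true, by simpa using h⟩) fun h => ⟨false, by simpa using h⟩)
  have hr : (((n + 1 : ℕ) : ℝ) - 1) / (n + 1 : ℕ) < 1 := by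
    rw [div_lt_one (by positivity)]; linarith
  have hr0 : 0 ≤ (((n + 1 : ℕ) : ℝ) - 1) / (n + 1 : ℕ) := by
    refine div_nonneg ?_ (by positivity)
    push_cast; linarith [Nat.cast_nonneg (α := ℝ) n]
  obtain ⟨m, hm⟩ := ((tendsto_pow_atTop_nhds_zero_of_lt_one hr0 hr).eventually
    (gt_mem_nhds hδ)).exists
  refine ⟨m, ?_⟩
  have h1 : Finsupp.single s (1 : ℤ) =
      push n s (affChain n n (Finsupp.single (vertices n) 1)) := by
    rw [affChain_single, affSimp_vertices, push_single]
    rfl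
  have hD : ∀ i j, dist (vertices n i) (vertices n j) ≤ 1 := fun i j =>
    (Metric.dist_le_diam_of_mem (bounded_stdSimplex _) (vertices n i).2 (vertices n j).2).trans
      diam_stdSimplex_le
  rw [h1, sdChain_iterate_push, sdChain_pow_affChain]
  refine mem_supported_of_single (push n s ∘ₗ affChain n n) (fun w hw => ?_)
    (tupleSd_iterate_mem_supported (n + 1) m (vertices n) hD)
  rw [LinearMap.comp_apply, affChain_single, push_single]
  obtain ⟨i, hi⟩ := hleb (w 0) (Set.mem_univ _)
  have hs : Set.range (s.comp (affSimp w)) ⊆ (if i then A else B) := by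
    rintro _ ⟨t, rfl⟩
    refine hi (Metric.mem_ball'.2 (lt_of_le_of_lt (dist_affComb_le (w 0) w t (hw 0)) ?_))
    simpa using hm
  cases i
  · exact Submodule.mem_sup_right (Finsupp.single_mem_supported _ _ (by simpa [simpIn] using hs))
  · exact Submodule.mem_sup_left (Finsupp.single_mem_supported _ _ (by simpa [simpIn] using hs))

/-- Iterated subdivision makes a chain small. -/
lemma exists_sdChain_pow_eq {A B : Set X} (hA : IsOpen A) (hB : IsOpen B)
    (hAB : A ∪ B = Set.univ) (n : ℕ) (c : Chain n X) :
    ∃ m a b, (sdChain n X ^ m) c = push n (incl A) a + push n (incl B) b := by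
  suffices ∃ m, (sdChain n X ^ m) c ∈ smallChains n A B by
    obtain ⟨m, hm⟩ := this
    obtain ⟨a, ha, b, hb, h⟩ := Submodule.mem_sup.1 hm
    obtain ⟨a, rfl⟩ := exists_push_incl ha
    obtain ⟨b, rfl⟩ := exists_push_incl hb
    exact ⟨m, a, b, h.symm⟩
  induction c using Finsupp.induction_linear with
  | zero => exact ⟨0, by simp⟩
  | add f g hf hg =>
    obtain ⟨m, hm⟩ := hf
    obtain ⟨m', hm'⟩ := hg
    -- Further subdivision keeps small chains small, so one exponent serves both summands.
    refine ⟨m + m', ?_⟩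
    rw [map_add]
    refine Submodule.add_mem _ ?_ ?_
    · rw [add_comm, pow_add, Module.End.mul_apply]
      exact sdChain_pow_mem_smallChains _ _ _ _ hm
    · rw [pow_add, Module.End.mul_apply]
      exact sdChain_pow_mem_smallChains _ _ _ _ hm'
  | single s a =>
    obtain ⟨m, hm⟩ := exists_sdChain_pow_single_mem hA hB hAB n s
    refine ⟨m, ?_⟩
    rw [← mul_one a, ← smul_eq_mul, ← Finsupp.smul_single, map_smul]
    exact Submodule.smul_mem _ _ hm
end small

/-! ### Mayer–Vietoris for reduced homology -/

section mayerVietoris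
variable {X Y : Type} [TopologicalSpace X] [TopologicalSpace Y]

/-- The augmentation. -/
def augm (X : Type) [TopologicalSpace X] : Chain 0 X →ₗ[ℤ] ℤ :=
  Finsupp.linearCombination ℤ fun _ => 1

/-- The cycles of the augmented singular complex. -/
def RedCycle : ∀ (n : ℕ) (_ : Chain n X), Prop
  | 0, c => augm X c = 0
  | n + 1, c => bdry n X c = 0

lemma augm_push (f : C(X, Y)) (c : Chain 0 X) : augm Y (push 0 f c) = augm X c := by
  refine chain_hom_ext (f := augm Y ∘ₗ push 0 f) (g := augm X) (fun s => ?_) c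
  simp [augm]

lemma augm_bdry (c : Chain 1 X) : augm X (bdry 0 X c) = 0 := by
  refine chain_hom_ext (f := augm X ∘ₗ bdry 0 X) (g := 0) (fun s => ?_) c
  simp [augm, bdry_single, Fin.sum_univ_two]

lemma RedCycle.push {n : ℕ} {c : Chain n X} (hc : RedCycle n c) (f : C(X, Y)) :
    RedCycle n (push n f c) := by
  cases n with
  | zero => exact (augm_push f c).trans hc
  | succ n => rw [RedCycle, bdry_push, show bdry n X c = 0 from hc, map_zero]

lemma redCycle_of_push {n : ℕ} {c : Chain n X} {f : C(X, Y)} (hf : Function.Injective f)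
    (hc : RedCycle n (push n f c)) : RedCycle n c := by
  cases n with
  | zero => exact (augm_push f c).symm.trans hc
  | succ n =>
    refine push_injective n hf ?_
    rw [map_zero, ← bdry_push]
    exact hc

lemma redCycle_bdry (n : ℕ) (c : Chain (n + 1) X) : RedCycle n (bdry n X c) := by
  cases n with
  | zero => exact augm_bdry c
  | succ n => exact bdry_bdry n c

variable (X) in
/-- Vanishing of reduced homology in degree `n`. -/
def RedAcyclic (n : ℕ) : Prop := ∀ c : Chain n X, RedCycle n c → ∃ e, bdry n X e = c

/-- The cycle `c₀` generates the reduced homology, which is infinite cyclic. -/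
structure IsGen (n : ℕ) (c₀ : Chain n X) : Prop where
  cycle : RedCycle n c₀
  span : ∀ c, RedCycle n c → ∃ (j : ℤ) (e : Chain (n + 1) X), c = j • c₀ + bdry n X e
  free : ∀ (j : ℤ) (e : Chain (n + 1) X), j • c₀ = bdry n X e → j = 0

lemma exists_bdry_sdChain_pow (n m : ℕ) {c : Chain n X} (hc : RedCycle n c) :
    ∃ e, c = (sdChain n X ^ m) c + bdry n X e := by
  cases n with
  | zero => exact exists_bdry_sdChain_iterate_zero m c
  | succ n => exact exists_bdry_sdChain_iterate n m c hc

/-- The Mayer–Vietoris isomorphism for a cover by two acyclic open sets. -/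
theorem exists_isGen_of_cover {A B : Set X} (hA : IsOpen A) (hB : IsOpen B)
    (hAB : A ∪ B = Set.univ) {k : ℕ} (hA0 : RedAcyclic A k) (hA1 : RedAcyclic A (k + 1))
    (hB0 : RedAcyclic B k) (hB1 : RedAcyclic B (k + 1)) {c₀ : Chain k (A ∩ B : Set X)}
    (hc₀ : IsGen k c₀) : ∃ x₀ : Chain (k + 1) X, IsGen (k + 1) x₀ := by
  set jA : C((A ∩ B : Set X), A) := inclOfSubset Set.inter_subset_left
  set jB : C((A ∩ B : Set X), B) := inclOfSubset Set.inter_subset_right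
  have hj : ∀ n (c : Chain n (A ∩ B : Set X)),
      push n (incl A) (push n jA c) = push n (incl B) (push n jB c) := fun n c => by
    rw [← push_comp, ← push_comp]; rfl
  have hjB : Function.Injective jB := Set.inclusion_injective Set.inter_subset_right
  -- `a₀` and `b₀` fill `c₀` inside `A` and inside `B`; glued along `c₀` they form the generator.
  obtain ⟨a₀, ha₀⟩ := hA0 _ (hc₀.cycle.push jA)
  obtain ⟨b₀, hb₀⟩ := hB0 _ (hc₀.cycle.push jB)
  refine ⟨push (k + 1) (incl B) b₀ - push (k + 1) (incl A) a₀, ?_, fun c hc => ?_,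
    fun j y hy => ?_⟩
  · rw [RedCycle, map_sub, bdry_push, bdry_push, ha₀, hb₀, hj, sub_self]
  · obtain ⟨m, a, b, hab⟩ := exists_sdChain_pow_eq hA hB hAB _ c
    obtain ⟨e₀, he₀⟩ := exists_bdry_sdChain_pow (k + 1) m hc
    have h1 : push k (incl A) (-bdry k A a) = push k (incl B) (bdry k B b) := by
      have h := bdry_sdChain_iterate k m c
      rw [show bdry k X c = 0 from hc, map_zero, hab, map_add, bdry_push, bdry_push] at h
      rw [map_neg, neg_eq_iff_add_eq_zero, h]
    -- The connecting map: the boundaries of the two pieces cancel, so each lies in `A ∩ B`.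
    obtain ⟨c₁, hc₁A, hc₁B⟩ := exists_push_inter h1
    have hc₁ : RedCycle k c₁ := redCycle_of_push hjB (hc₁B ▸ redCycle_bdry k b)
    obtain ⟨j, e, rfl⟩ := hc₀.span c₁ hc₁
    rw [map_add, map_smul, ← bdry_push] at hc₁A hc₁B
    -- Once `j` copies of the filling and the correction `e` are removed, the piece in `B` is a
    -- cycle, hence bounds; likewise in `A`.
    obtain ⟨fB, hfB⟩ := hB1 (b - j • b₀ - push (k + 1) jB e) (by
      rw [RedCycle, map_sub, map_sub, map_smul, hb₀, ← hc₁B]; abel)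
    obtain ⟨fA, hfA⟩ := hA1 (a + j • a₀ + push (k + 1) jA e) (by
      rw [RedCycle, map_add, map_add, map_smul, ha₀, ← neg_neg (bdry k A a), ← hc₁A]; abel)
    refine ⟨j, e₀ + push (k + 2) (incl A) fA + push (k + 2) (incl B) fB, ?_⟩
    rw [map_add, map_add, bdry_push, bdry_push, hfA, hfB]
    nth_rewrite 1 [he₀]
    rw [hab]
    simp only [map_add, map_sub, map_smul, hj, smul_sub]
    abel
  · obtain ⟨m, a, b, hab⟩ := exists_sdChain_pow_eq hA hB hAB _ y
    have h := congrArg (bdry (k + 1) X) hab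
    rw [bdry_sdChain_iterate, ← hy, map_add, bdry_push, bdry_push, map_smul, map_sub,
      sdChain_iterate_push, sdChain_iterate_push, smul_sub] at h
    -- The left side lies in `A` and the right side in `B`, so both come from a chain of `A ∩ B`.
    -- Its boundary is `j` times the subdivided `c₀`, which is homologous to `j • c₀`.
    have h1 : push (k + 1) (incl A) (j • (sdChain (k + 1) A ^ m) a₀ + bdry (k + 1) A a) =
        push (k + 1) (incl B) (j • (sdChain (k + 1) B ^ m) b₀ - bdry (k + 1) B b) := by
      simp only [map_add, map_sub, map_smul]
      rw [eq_sub_iff_add_eq, add_assoc, ← h]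
      abel
    obtain ⟨e, -, heB⟩ := exists_push_inter h1
    have h2 : bdry k _ e = j • (sdChain k _ ^ m) c₀ := by
      refine push_injective k hjB ?_
      rw [← bdry_push, heB, map_sub, map_smul, bdry_bdry, sub_zero, bdry_sdChain_iterate, hb₀,
        sdChain_iterate_push, map_smul]
    obtain ⟨f, hf⟩ := exists_bdry_sdChain_pow k m hc₀.cycle
    refine hc₀.free j (e + j • f) ?_
    rw [map_add, map_smul, h2, ← smul_add, ← hf]
end mayerVietoris

/-! ### Passage to Mathlib's homology and local homology -/

section toMathlib
open HomologicalComplex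

lemma exists_homologyπ_eq (K : ChainComplex (ModuleCat.{0} ℤ) ℕ) (i : ℕ) (h : K.homology i) :
    ∃ w : K.cycles i, (K.homologyπ i).hom w = h :=
  (ModuleCat.epi_iff_surjective (K.homologyπ i)).1 inferInstance h

lemma iCycles_injective (K : ChainComplex (ModuleCat.{0} ℤ) ℕ) (i : ℕ) :
    Function.Injective (K.iCycles i).hom :=
  (ModuleCat.mono_iff_injective (K.iCycles i)).1 inferInstance

lemma exists_iCycles_eq (K : ChainComplex (ModuleCat.{0} ℤ) ℕ) (i : ℕ) (z : K.X (i + 1))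
    (hz : (K.d (i + 1) i).hom z = 0) : ∃ w : K.cycles (i + 1), (K.iCycles (i + 1)).hom w = z := by
  let φ : ModuleCat.of ℤ ℤ ⟶ K.X (i + 1) := ModuleCat.ofHom (LinearMap.toSpanSingleton ℤ _ z)
  have hφ : φ ≫ K.d (i + 1) i = 0 := by
    ext
    have h1 : φ.hom (1 : ℤ) = z := LinearMap.toSpanSingleton_apply_one ℤ _ z
    exact (congrArg (K.d (i + 1) i).hom h1).trans hz
  refine ⟨(K.liftCycles φ i (by simp) hφ).hom (1 : ℤ), ?_⟩
  have := congr($(K.liftCycles_i φ i (by simp) hφ).hom (1 : ℤ))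
  refine this.trans ?_
  exact LinearMap.toSpanSingleton_apply_one ℤ _ z

lemma iCycles_d (K : ChainComplex (ModuleCat.{0} ℤ) ℕ) (i : ℕ) (w : K.cycles (i + 1)) :
    (K.d (i + 1) i).hom ((K.iCycles (i + 1)).hom w) = 0 :=
  congr($(K.iCycles_d (i + 1) i).hom w)

lemma homologyπ_eq_zero_iff (K : ChainComplex (ModuleCat.{0} ℤ) ℕ) (i : ℕ) (w : K.cycles i) :
    (K.homologyπ i).hom w = 0 ↔ ∃ e, (K.d (i + 1) i).hom e = (K.iCycles i).hom w := by
  have key : ∀ e, (K.iCycles i).hom ((K.toCycles (i + 1) i).hom e) = (K.d (i + 1) i).hom e :=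
    fun e => congr($(K.toCycles_i (i + 1) i).hom e)
  have hex := ShortComplex.exact_of_g_is_cokernel
    (ShortComplex.mk (K.toCycles (i + 1) i) (K.homologyπ i)
      (K.toCycles_comp_homologyπ (i + 1) i)) (K.homologyIsCokernel (i + 1) i (by simp))
  rw [ShortComplex.moduleCat_exact_iff] at hex
  constructor
  · intro h
    obtain ⟨e, he⟩ := hex w h
    refine ⟨e, ?_⟩
    rw [← key, ← he]
  · rintro ⟨e, he⟩
    have : w = (K.toCycles (i + 1) i).hom e := by
      apply iCycles_injective
      rw [key, he]
    rw [this]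
    exact congr($(K.toCycles_comp_homologyπ (i + 1) i).hom e)

/-- A generating cycle gives a generator of Mathlib's singular homology. -/
lemma exists_generator (X : TopCat.{0}) (k : ℕ) {c₀ : Chain (k + 1) X} (hc₀ : IsGen (k + 1) c₀) :
    ∃ μ : (singularHomology (k + 1)).obj X, Submodule.span ℤ {μ} = ⊤ ∧ μ ≠ 0 := by
  let K := singularChains.obj X
  change ∃ μ : K.homology (k + 1), Submodule.span ℤ {μ} = ⊤ ∧ μ ≠ 0
  have hd : (K.d (k + 1) k).hom (fromChain X (k + 1) c₀) = 0 := by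
    rw [← fromChain_bdry, show bdry k X c₀ = 0 from hc₀.cycle, map_zero]
  obtain ⟨w₀, hw₀⟩ := exists_iCycles_eq K k _ hd
  refine ⟨(K.homologyπ (k + 1)).hom w₀, ?_, ?_⟩
  · rw [eq_top_iff]
    rintro h -
    obtain ⟨w, rfl⟩ := exists_homologyπ_eq K _ h
    obtain ⟨c, hc⟩ := fromChain_surjective X (k + 1) ((K.iCycles (k + 1)).hom w)
    obtain ⟨j, e, rfl⟩ := hc₀.span c (fromChain_injective X k (by
      rw [fromChain_bdry, hc, map_zero]; exact iCycles_d K k w))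
    have h0 : (K.homologyπ (k + 1)).hom (w - j • w₀) = 0 := by
      rw [homologyπ_eq_zero_iff]
      refine ⟨fromChain X (k + 2) e, ?_⟩
      rw [← fromChain_bdry, map_sub, map_zsmul, hw₀, ← hc, map_add, map_zsmul]
      simp
    rw [map_sub, map_zsmul, sub_eq_zero] at h0
    rw [h0]
    exact zsmul_mem (Submodule.mem_span_singleton_self _) j
  · intro h
    rw [homologyπ_eq_zero_iff] at h
    obtain ⟨e, he⟩ := h
    obtain ⟨u, rfl⟩ := fromChain_surjective X (k + 2) e
    rw [hw₀, ← fromChain_bdry] at he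
    have := hc₀.free 1 u (by rw [one_smul]; exact (fromChain_injective X _ he).symm)
    exact one_ne_zero this

/-- If the complement of a point is acyclic, then `H_k(X) → H_k(X, X ∖ x)` is surjective. -/
lemma toLocalHomology_surjective (X : TopCat.{0}) (x : X) (k : ℕ)
    (h : RedAcyclic {y : X // y ≠ x} (k + 1)) :
    Function.Surjective (toLocalHomology (k + 2) X x).hom := by
  have hmono : Mono (puncturedChainsMap X x) := by
    have : Mono (TopCat.ofHom (⟨Subtype.val, continuous_subtype_val⟩ : C({y : X // y ≠ x}, X))) :=
      (TopCat.mono_iff_injective _).2 Subtype.val_injective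
    unfold puncturedChainsMap singularChains
    infer_instance
  let S : ShortComplex (ChainComplex (ModuleCat.{0} ℤ) ℕ) :=
    ShortComplex.mk (puncturedChainsMap X x) (cokernel.π (puncturedChainsMap X x))
      (cokernel.condition _)
  have hS : S.ShortExact :=
    { exact := ShortComplex.exact_cokernel _
      mono_f := hmono
      epi_g := inferInstanceAs (Epi (cokernel.π _)) }
  -- By the long exact sequence it suffices that the connecting map into `H_{k+1}(X ∖ {x})`
  -- vanishes, and this target is zero.
  have hex := hS.homology_exact₃ (k + 2) (k + 1) (by simp)
  rw [ShortComplex.moduleCat_exact_iff] at hex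
  intro z
  refine hex z ?_
  let Y := TopCat.of {y : X // y ≠ x}
  obtain ⟨w, hw⟩ := exists_homologyπ_eq (singularChains.obj Y) _ ((hS.δ (k + 2) (k + 1) (by simp)).hom z)
  refine hw.symm.trans ?_
  rw [homologyπ_eq_zero_iff]
  obtain ⟨c, hc⟩ := fromChain_surjective Y (k + 1) 
    ((HomologicalComplex.iCycles (singularChains.obj Y) (k + 1)).hom w)
  obtain ⟨e, he⟩ := h c (fromChain_injective Y k (by
      rw [fromChain_bdry, hc, map_zero]; exact iCycles_d _ k w))
  refine ⟨fromChain Y (k + 2) e, ?_⟩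
  rw [← hc, ← he]
  exact (fromChain_bdry Y (k + 1) e).symm
end toMathlib

/-! ### Homotopy equivalences and degree zero -/

section lowdim
variable {X Y : Type} [TopologicalSpace X] [TopologicalSpace Y]

/-- A homotopy equivalence preserves generators in positive degree. -/
lemma IsGen.of_homotopyEquiv {n : ℕ} {c₀ : Chain (n + 1) X} (h : IsGen (n + 1) c₀)
    (f : C(X, Y)) (g : C(Y, X)) (hfg : (f.comp g).Homotopic (.id Y))
    (hgf : (g.comp f).Homotopic (.id X)) : IsGen (n + 1) (push (n + 1) f c₀) where
  cycle := h.cycle.push f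
  span c hc := by
    obtain ⟨j, e, he⟩ := h.span _ (RedCycle.push hc g)
    obtain ⟨u, hu⟩ := exists_bdry_of_homotopic hfg n c hc
    rw [push_comp, he, push_id] at hu
    refine ⟨j, push (n + 2) f e - u, ?_⟩
    rw [map_sub, bdry_push, ← sub_eq_iff_eq_add'.2 hu]
    simp only [map_add, map_smul]
    abel
  free j e he := by
    obtain ⟨u, hu⟩ := exists_bdry_of_homotopic hgf n c₀ h.cycle
    rw [push_comp, push_id] at hu
    refine h.free j (push (n + 2) g e - j • u) ?_
    rw [map_sub, bdry_push, ← he, map_smul, map_smul, hu]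
    simp

lemma IsGen.of_homeomorph {n : ℕ} {c₀ : Chain n X} (h : IsGen n c₀) (f : X ≃ₜ Y) :
    IsGen n (push n (f : C(X, Y)) c₀) := by
  have hfg : ∀ m (c : Chain m Y), push m (f : C(X, Y)) (push m (f.symm : C(Y, X)) c) = c :=
    fun m c => by
      rw [← push_comp]
      convert push_id m c
      ext; simp
  have hgf : ∀ m (c : Chain m X), push m (f.symm : C(Y, X)) (push m (f : C(X, Y)) c) = c :=
    fun m c => by
      rw [← push_comp]
      convert push_id m c
      ext; simp
  refine ⟨h.cycle.push _, fun c hc => ?_, fun j e he => ?_⟩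
  · obtain ⟨j, e, he⟩ := h.span _ (RedCycle.push hc (f.symm : C(Y, X)))
    refine ⟨j, push (n + 1) (f : C(X, Y)) e, ?_⟩
    rw [bdry_push, ← map_smul, ← map_add, ← he, hfg]
  · refine h.free j (push (n + 1) (f.symm : C(Y, X)) e) ?_
    rw [bdry_push, ← he, map_smul, hgf]

/-- The `0`-chain of a point. -/
def ptChain (x : X) : Chain 0 X := Finsupp.single (ContinuousMap.const _ x) 1

lemma exists_bdry_of_path {x y : X} (p : Path x y) :
    ∃ e, bdry 0 X e = ptChain y - ptChain x := by
  refine ⟨Finsupp.single (p.toContinuousMap.comp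
    (stdSimplexHomeomorphUnitInterval : C(stdSimplex ℝ (Fin 2), unitInterval))) 1, ?_⟩
  have hv : ∀ t : stdSimplex ℝ (Fin 1), t = stdSimplex.vertex 0 := fun t =>
    Subsingleton.elim _ _
  have h0 : ∀ t, faceMap 0 0 t = stdSimplex.vertex 1 := fun t => by
    rw [hv t]; exact stdSimplex.map_vertex _ _
  have h1 : ∀ t, faceMap 0 1 t = stdSimplex.vertex 0 := fun t => by
    rw [hv t]; exact stdSimplex.map_vertex _ _
  have e0 : (p.toContinuousMap.comp
      (stdSimplexHomeomorphUnitInterval : C(stdSimplex ℝ (Fin 2), unitInterval))).comp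
      (faceMap 0 0) = ContinuousMap.const _ y := by
    ext t
    simp only [ContinuousMap.comp_apply, h0]
    exact p.target
  have e1 : (p.toContinuousMap.comp
      (stdSimplexHomeomorphUnitInterval : C(stdSimplex ℝ (Fin 2), unitInterval))).comp
      (faceMap 0 1) = ContinuousMap.const _ x := by
    ext t
    simp only [ContinuousMap.comp_apply, h1]
    exact p.source
  rw [bdry_single, one_smul, Fin.sum_univ_two, e0, e1]
  simp only [Fin.val_zero, pow_zero, Fin.val_one, pow_one, ptChain, sub_eq_add_neg,
    ← Finsupp.single_neg]

lemma single_eq_smul_ptChain (s : Simp 0 X) (a : ℤ) : 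
    Finsupp.single s a = a • ptChain (s default) := by
  rw [ptChain, Finsupp.smul_single, smul_eq_mul, mul_one]
  congr
  ext t
  rw [Subsingleton.elim t default]
  rfl

lemma redAcyclic_zero_of_pathConnected [PathConnectedSpace X] : RedAcyclic X 0 := by
  obtain ⟨x₀⟩ := (inferInstance : Nonempty X)
  have key : ∀ c : Chain 0 X, ∃ e, c = augm X c • ptChain x₀ + bdry 0 X e := by
    intro c
    induction c using Finsupp.induction_linear with
    | zero => exact ⟨0, by simp⟩
    | add f g hf hg =>
      obtain ⟨e, he⟩ := hf
      obtain ⟨e', he'⟩ := hg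
      refine ⟨e + e', ?_⟩
      nth_rewrite 1 [he, he']
      rw [map_add, map_add, add_smul]
      abel
    | single s a =>
      obtain ⟨e, he⟩ := exists_bdry_of_path (PathConnectedSpace.somePath x₀ (s default))
      refine ⟨a • e, ?_⟩
      rw [map_smul, he, single_eq_smul_ptChain]
      rw [show augm X (a • ptChain (s default)) = a by simp [augm, ptChain]]
      module
  intro c hc
  obtain ⟨e, he⟩ := key c
  rw [show augm X c = 0 from hc, zero_smul, zero_add] at he
  exact ⟨e, he.symm⟩

lemma redAcyclic_of_contractible [ContractibleSpace X] (n : ℕ) : RedAcyclic X n := by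
  cases n with
  | zero => exact redAcyclic_zero_of_pathConnected
  | succ n => exact fun c hc => exists_bdry_of_contractible n c hc

/-- The reduced `H₀` of a space with two path components. -/
lemma isGen_zero (P : Set X) (hP : IsClopen P) (p q : X) (hp : p ∈ P) (hq : q ∉ P)
    (hjp : ∀ x ∈ P, Joined p x) (hjq : ∀ x ∉ P, Joined q x) :
    IsGen 0 (ptChain p - ptChain q) := by
  classical
  refine ⟨?_, fun c hc => ?_, fun j e he => ?_⟩
  · simp [RedCycle, augm, ptChain]
  · have key : ∀ c : Chain 0 X, ∃ (j : ℤ) (e : Chain 1 X),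
        c = j • ptChain p + (augm X c - j) • ptChain q + bdry 0 X e := by
      intro c
      induction c using Finsupp.induction_linear with
      | zero => exact ⟨0, 0, by simp⟩
      | add f g hf hg =>
        obtain ⟨i, e, he⟩ := hf
        obtain ⟨i', e', he'⟩ := hg
        refine ⟨i + i', e + e', ?_⟩
        nth_rewrite 1 [he, he']
        rw [map_add, map_add]
        module
      | single s a =>
        by_cases hs : s default ∈ P
        · obtain ⟨e, he⟩ := exists_bdry_of_path (hjp _ hs).somePath
          refine ⟨a, a • e, ?_⟩
          rw [map_smul, he, single_eq_smul_ptChain]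
          rw [show augm X (a • ptChain (s default)) = a by simp [augm, ptChain]]
          module
        · obtain ⟨e, he⟩ := exists_bdry_of_path (hjq _ hs).somePath
          refine ⟨0, a • e, ?_⟩
          rw [map_smul, he, single_eq_smul_ptChain]
          rw [show augm X (a • ptChain (s default)) = a by simp [augm, ptChain]]
          module
    obtain ⟨j, e, he⟩ := key c
    refine ⟨j, e, ?_⟩
    rw [show augm X c = 0 from hc] at he
    rw [he]
    module
  -- `χ` counts the points in `P`. It kills boundaries because the image of a connected `1`-simplex
  -- does not leave a clopen set.
  · let χ : Chain 0 X →ₗ[ℤ] ℤ :=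
      Finsupp.linearCombination ℤ fun s => if s default ∈ P then 1 else 0
    have hχ : ∀ e, χ (bdry 0 X e) = 0 := by
      refine chain_hom_ext (f := χ ∘ₗ bdry 0 X) (g := 0) fun s => ?_
      have hs : s (faceMap 0 0 default) ∈ P ↔ s (faceMap 0 1 default) ∈ P := by
        have h := (hP.preimage s.continuous)
        rcases isClopen_iff.1 h with h | h
        · have h' : ∀ t, s t ∉ P := fun t ht => by
            have : t ∈ s ⁻¹' P := ht
            rw [h] at this; exact this
          simp [h']
        · have h' : ∀ t, s t ∈ P := fun t => by
            have : t ∈ s ⁻¹' P := h ▸ Set.mem_univ t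
            exact this
          simp [h']
      simp [χ, bdry_single, Fin.sum_univ_two, hs]
    have h := congrArg χ he
    rw [hχ] at h
    simpa [χ, ptChain, hp, hq] using h
end lowdim

/-! ### The homology of spheres -/

section sphere

/-- The unit sphere `S^d ⊆ ℝ^{d+1}`. -/
abbrev Sph (d : ℕ) := Metric.sphere (0 : EuclideanSpace ℝ (Fin (d + 1))) 1

open scoped EuclideanSpace

lemma stereographic'_neg (d : ℕ) (v : Sph d) : stereographic' d v (-v) = 0 := by
  simp [stereographic', stereographic_apply_neg]

/-- A sphere minus a point is a Euclidean space. -/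
def sphComplHomeo (d : ℕ) (v : Sph d) : ({v}ᶜ : Set (Sph d)) ≃ₜ EuclideanSpace ℝ (Fin d) :=
  ((Homeomorph.setCongr (stereographic'_source v).symm).trans
    (stereographic' d v).toHomeomorphSourceTarget).trans
    ((Homeomorph.setCongr (stereographic'_target v)).trans (Homeomorph.Set.univ _))

instance (d : ℕ) (v : Sph d) : ContractibleSpace ({v}ᶜ : Set (Sph d)) :=
  (sphComplHomeo d v).contractibleSpace

/-- A sphere minus two antipodal points is a punctured Euclidean space. -/
def sphComplTwoHomeo (d : ℕ) (v : Sph d) :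
    ({v}ᶜ ∩ {-v}ᶜ : Set (Sph d)) ≃ₜ ({0}ᶜ : Set (EuclideanSpace ℝ (Fin d))) :=
  let e := (stereographic' d v).restrOpen {-v}ᶜ isOpen_compl_singleton
  ((Homeomorph.setCongr (by simp [e])).trans e.toHomeomorphSourceTarget).trans
    (Homeomorph.setCongr (by
      ext y
      by_cases hv : v = -v
      · exact absurd hv (ne_neg_of_mem_unit_sphere ℝ v)
      have h1 : -v ∈ (stereographic' d v).source := by
        rw [stereographic'_source]; exact fun h => hv h.symm
      have h2 : y ∈ (stereographic' d v).target := by rw [stereographic'_target]; trivial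
      have h3 : (stereographic' d v).symm y = -v ↔ y = 0 := by
        rw [← stereographic'_neg d v, eq_comm (a := y)]
        constructor
        · intro h; rw [← h, (stereographic' d v).right_inv h2]
        · intro h; rw [← h, (stereographic' d v).left_inv h1]
      simp [e, h3]))

/-- Radial projection. -/
def radialProj (d : ℕ) : C(({0}ᶜ : Set (EuclideanSpace ℝ (Fin (d + 1)))), Sph d) where
  toFun x := ⟨‖x.1‖⁻¹ • x.1, by
    have : ‖x.1‖ ≠ 0 := norm_ne_zero_iff.2 x.2
    simp [norm_smul, this]⟩
  continuous_toFun := by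
    have h : Continuous fun x : ({0}ᶜ : Set (EuclideanSpace ℝ (Fin (d + 1)))) => ‖x.1‖⁻¹ :=
      continuous_subtype_val.norm.inv₀ fun x => norm_ne_zero_iff.2 x.2
    exact (h.smul continuous_subtype_val).subtype_mk _

/-- The inclusion of the sphere. -/
def sphIncl (d : ℕ) : C(Sph d, ({0}ᶜ : Set (EuclideanSpace ℝ (Fin (d + 1))))) where
  toFun x := ⟨x.1, by
    intro h
    have h1 := norm_eq_of_mem_sphere x
    rw [show (x : EuclideanSpace ℝ (Fin (d + 1))) = 0 from h] at h1
    simp at h1⟩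
  continuous_toFun := by fun_prop

lemma radialProj_comp (d : ℕ) : (radialProj d).comp (sphIncl d) = .id _ := by
  ext x
  simp [radialProj, sphIncl]

lemma sphIncl_comp_homotopic (d : ℕ) :
    ((sphIncl d).comp (radialProj d)).Homotopic (.id _) := by
  -- The homotopy interpolates linearly between the scaling factors `1/‖x‖` and `1`; positivity
  -- keeps it away from the origin.
  have hpos : ∀ (t : unitInterval) (x : ({0}ᶜ : Set (EuclideanSpace ℝ (Fin (d + 1))))),
      0 < (1 - (t : ℝ)) * ‖x.1‖⁻¹ + t := fun t x => by
    have hx : 0 < ‖x.1‖⁻¹ := inv_pos.2 (norm_pos_iff.2 x.2)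
    rcases eq_or_lt_of_le t.2.1 with h | h
    · rw [← h]; simpa using hx
    · have := mul_nonneg (sub_nonneg.2 t.2.2) hx.le
      linarith
  refine ⟨⟨⟨fun p => ⟨((1 - (p.1 : ℝ)) * ‖p.2.1‖⁻¹ + p.1) • p.2.1, ?_⟩, ?_⟩, ?_, ?_⟩⟩
  · exact smul_ne_zero (hpos p.1 p.2).ne' p.2.2
  · have h : Continuous fun p : unitInterval × ({0}ᶜ : Set (EuclideanSpace ℝ (Fin (d + 1)))) =>
        ‖p.2.1‖⁻¹ :=
      (continuous_subtype_val.comp continuous_snd).norm.inv₀ fun p => norm_ne_zero_iff.2 p.2.2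
    have h' : Continuous fun p : unitInterval × ({0}ᶜ : Set (EuclideanSpace ℝ (Fin (d + 1)))) =>
        (p.1 : ℝ) := continuous_subtype_val.comp continuous_fst
    exact ((((continuous_const.sub h').mul h).add h').smul
      (continuous_subtype_val.comp continuous_snd)).subtype_mk _
  · intro x
    ext
    simp [sphIncl, radialProj]
  · intro x
    ext
    simp

lemma joined_of_convex {E : Type} [NormedAddCommGroup E] [NormedSpace ℝ E] {C W : Set E}
    (hC : Convex ℝ C) (hCW : C ⊆ W) {x y : W} (hx : x.1 ∈ C) (hy : y.1 ∈ C) : Joined x y :=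
  (((hC.isPathConnected ⟨_, hx⟩).joinedIn _ hx _ hy).mono hCW).joined_subtype

/-- The two half-lines are the path components. This starts the induction on the dimension and is
the reason for working with reduced homology. -/
lemma isGen_punctured_line :
    ∃ c₀ : Chain 0 ({0}ᶜ : Set (EuclideanSpace ℝ (Fin 1))), IsGen 0 c₀ := by
  let u : EuclideanSpace ℝ (Fin 1) := EuclideanSpace.single 0 1
  have hu : u ≠ 0 := fun h => by simpa [u] using congrArg (fun v => v 0) h
  have hne : ∀ x : ({0}ᶜ : Set (EuclideanSpace ℝ (Fin 1))), x.1 0 ≠ 0 := fun x h => x.2 (by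
    ext i; rw [Subsingleton.elim i 0]; exact h)
  have hcont : Continuous fun x : ({0}ᶜ : Set (EuclideanSpace ℝ (Fin 1))) => x.1 0 := by fun_prop
  have hpos : Convex ℝ {x : EuclideanSpace ℝ (Fin 1) | 0 < x 0} :=
    (convex_Ioi (0 : ℝ)).linear_preimage (EuclideanSpace.proj (𝕜 := ℝ) (0 : Fin 1)).toLinearMap
  have hneg : Convex ℝ {x : EuclideanSpace ℝ (Fin 1) | x 0 < 0} :=
    (convex_Iio (0 : ℝ)).linear_preimage (EuclideanSpace.proj (𝕜 := ℝ) (0 : Fin 1)).toLinearMap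
  have hposs : {x : EuclideanSpace ℝ (Fin 1) | 0 < x 0} ⊆ {0}ᶜ := fun x hx h => by
    rw [Set.mem_singleton_iff.1 h] at hx; simp at hx
  have hnegs : {x : EuclideanSpace ℝ (Fin 1) | x 0 < 0} ⊆ {0}ᶜ := fun x hx h => by
    rw [Set.mem_singleton_iff.1 h] at hx; simp at hx
  refine ⟨_, isGen_zero ((fun x => x.1 0) ⁻¹' Set.Ioi 0) ⟨?_, isOpen_Ioi.preimage hcont⟩ ⟨u, hu⟩
    ⟨-u, neg_ne_zero.2 hu⟩ (by simp [u]) (by simp [u]) (fun x hx => ?_) fun x hx => ?_⟩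
  · have : (fun x : ({0}ᶜ : Set (EuclideanSpace ℝ (Fin 1))) => x.1 0) ⁻¹' Set.Ioi 0 =
        (fun x => x.1 0) ⁻¹' Set.Ici 0 := by
      ext x
      simp only [Set.mem_preimage, Set.mem_Ioi, Set.mem_Ici]
      exact ⟨le_of_lt, fun h => lt_of_le_of_ne h (hne x).symm⟩
    rw [this]
    exact isClosed_Ici.preimage hcont
  · exact joined_of_convex hpos hposs (by simp [u]) hx
  · exact joined_of_convex hneg hnegs (by simp [u])
      (lt_of_le_of_ne (not_lt.1 hx) (hne x))

/-- The complements of two antipodal points are contractible and cover the sphere; their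
intersection is a punctured Euclidean space. -/
lemma exists_isGen_sphere_of_punctured {k : ℕ}
    (h : ∃ c₀ : Chain k ({0}ᶜ : Set (EuclideanSpace ℝ (Fin (k + 1)))), IsGen k c₀) :
    ∃ c₀ : Chain (k + 1) (Sph (k + 1)), IsGen (k + 1) c₀ := by
  obtain ⟨c, hc⟩ := h
  obtain ⟨v⟩ : Nonempty (Sph (k + 1)) :=
    (NormedSpace.sphere_nonempty.2 zero_le_one).to_subtype
  refine exists_isGen_of_cover (A := {v}ᶜ) (B := {-v}ᶜ) isOpen_compl_singleton
    isOpen_compl_singleton ?_ (redAcyclic_of_contractible _) (redAcyclic_of_contractible _)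
    (redAcyclic_of_contractible _) (redAcyclic_of_contractible _)
    (hc.of_homeomorph (sphComplTwoHomeo (k + 1) v).symm)
  rw [← Set.compl_inter, Set.compl_univ_iff]
  ext x
  simp only [Set.mem_inter_iff, Set.mem_singleton_iff, Set.mem_empty_iff_false, iff_false]
  rintro ⟨rfl, h⟩
  exact ne_neg_of_mem_unit_sphere ℝ x h

/-- The homology of spheres. -/
theorem exists_isGen_sphere (k : ℕ) : ∃ c₀ : Chain (k + 1) (Sph (k + 1)), IsGen (k + 1) c₀ := by
  induction k with
  | zero => exact exists_isGen_sphere_of_punctured isGen_punctured_line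
  | succ k ih =>
    obtain ⟨c, hc⟩ := ih
    refine exists_isGen_sphere_of_punctured ⟨_, hc.of_homotopyEquiv (sphIncl _) (radialProj _)
      (sphIncl_comp_homotopic _) ?_⟩
    rw [radialProj_comp]

/-- Spheres of dimension at least two have a nonzero fundamental class. -/
theorem exists_isFundamentalClass_sphere (k : ℕ) :
    ∃ μ : (singularHomology (k + 2)).obj (TopCat.of (Sph (k + 2))),
      IsFundamentalClass (k + 2) (TopCat.of (Sph (k + 2))) μ ∧ μ ≠ 0 := by
  obtain ⟨c, hc⟩ := exists_isGen_sphere (k + 1)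
  obtain ⟨μ, hμ, hμ0⟩ := exists_generator (TopCat.of (Sph (k + 2))) (k + 1) hc
  refine ⟨μ, fun x => ?_, hμ0⟩
  -- The sphere minus a point is contractible, and a surjection carries a generator to a generator.
  -- Dimension at least two keeps the connecting map in positive degrees, where reduced and ordinary
  -- cycles agree.
  have hsurj := toLocalHomology_surjective (TopCat.of (Sph (k + 2))) x k
    (redAcyclic_of_contractible (X := ({(x : Sph (k + 2))}ᶜ : Set (Sph (k + 2)))) (k + 1))
  rw [eq_top_iff]
  rintro z -
  obtain ⟨y, rfl⟩ := hsurj z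
  have hy : y ∈ Submodule.span ℤ {μ} := hμ ▸ Submodule.mem_top
  obtain ⟨a, rfl⟩ := Submodule.mem_span_singleton.1 hy
  exact (LinearMap.map_smul (toLocalHomology (k + 2) (TopCat.of (Sph (k + 2))) x).hom a μ) ▸
    Submodule.smul_mem _ a (Submodule.mem_span_singleton_self _)

/-- A retract carries nonzero homology classes to nonzero homology classes. -/
lemma singularHomology_map_ne_zero {X Y : TopCat.{0}} (i : X ⟶ Y) (r : Y ⟶ X) (h : i ≫ r = 𝟙 X)
    (k : ℕ) {μ : (singularHomology k).obj X} (hμ : μ ≠ 0) :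
    (singularHomology k).map i μ ≠ 0 := by
  intro h0
  apply hμ
  have h1 := congr($((singularHomology k).map_comp i r).hom μ)
  rw [h, CategoryTheory.Functor.map_id] at h1
  change μ = (singularHomology k).map r ((singularHomology k).map i μ) at h1
  rw [h1, h0, map_zero]

end sphere

/-! ### Riemannian metrics pulled back from Euclidean spaces -/

section pullBilin
variable {E V : Type} [NormedAddCommGroup E] [NormedSpace ℝ E] [NormedAddCommGroup V]
  [InnerProductSpace ℝ V]

/-- The bilinear form `a⟨D·, D·⟩`. -/
def pullBilin (a : ℝ) (D : E →L[ℝ] V) : E →L[ℝ] E →L[ℝ] ℝ :=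
  ((ContinuousLinearMap.compL ℝ E V ℝ).flip D).comp ((innerSL ℝ (E := V)).comp (a • D))

lemma pullBilin_apply (a : ℝ) (D : E →L[ℝ] V) (v w : E) :
    pullBilin a D v w = a * inner ℝ (D v) (D w) := by
  simp [pullBilin]

set_option synthInstance.maxHeartbeats 400000 in
lemma contDiff_pullBilin :
    ContDiff ℝ ∞ fun p : ℝ × (E →L[ℝ] V) => pullBilin p.1 p.2 := by
  unfold pullBilin
  have h : ContDiff ℝ ∞ fun p : ℝ × (E →L[ℝ] V) =>
      (ContinuousLinearMap.compL ℝ E V ℝ).flip p.2 :=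
    (ContinuousLinearMap.contDiff _).comp contDiff_snd
  exact h.clm_comp
    (contDiff_const.clm_comp (contDiff_fst.smul contDiff_snd))
end pullBilin

section pullForm
variable {n : ℕ} {N : Type} [TopologicalSpace N] [ChartedSpace (EuclideanSpace ℝ (Fin n)) N]
  {V : Type} [NormedAddCommGroup V] [InnerProductSpace ℝ V]

/-- The derivative of a map to a vector space. -/
def diffAt (f : N → V) (x : N) : TangentSpace (𝓡 n) x →L[ℝ] V := mfderiv (𝓡 n) 𝓘(ℝ, V) f x

/-- The bilinear form `a(x)⟨df, df⟩` on the tangent space at `x`. -/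
def pullForm (f : N → V) (a : N → ℝ) (x : N) :
    TangentSpace (𝓡 n) x →L[ℝ] TangentSpace (𝓡 n) x →L[ℝ] ℝ :=
  pullBilin (E := EuclideanSpace ℝ (Fin n)) (a x) (diffAt f x)

lemma pullForm_apply (f : N → V) (a : N → ℝ) (x : N) (v w : TangentSpace (𝓡 n) x) :
    pullForm f a x v w = a x * inner ℝ (diffAt f x v) (diffAt f x w) :=
  pullBilin_apply (E := EuclideanSpace ℝ (Fin n)) _ _ _ _

set_option synthInstance.maxHeartbeats 400000 in
-- In the trivialization at `x₀` the form is `pullBilin` of the coordinate expression of `df`. So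
-- smoothness of the derivative and `contDiff_pullBilin` suffice.
lemma contMDiff_pullForm [IsManifold (𝓡 n) ∞ N] {f : N → V} {a : N → ℝ}
    (hf : ContMDiff (𝓡 n) 𝓘(ℝ, V) ∞ f) (ha : ContMDiff (𝓡 n) 𝓘(ℝ, ℝ) ∞ a) :
    ContMDiff (𝓡 n) ((𝓡 n).prod 𝓘(ℝ, EuclideanSpace ℝ (Fin n) →L[ℝ]
      EuclideanSpace ℝ (Fin n) →L[ℝ] ℝ)) ∞
      (fun x => TotalSpace.mk' (EuclideanSpace ℝ (Fin n) →L[ℝ] EuclideanSpace ℝ (Fin n) →L[ℝ] ℝ)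
        x (pullForm f a x : TangentSpace (𝓡 n) x →L[ℝ] TangentSpace (𝓡 n) x →L[ℝ] ℝ)) := by
  intro x₀
  rw [contMDiffAt_section]
  have h1 : ContMDiffAt (𝓡 n) 𝓘(ℝ, EuclideanSpace ℝ (Fin n) →L[ℝ] V) ∞
      (inTangentCoordinates (𝓡 n) 𝓘(ℝ, V) id f (fun x => mfderiv (𝓡 n) 𝓘(ℝ, V) f x) x₀) x₀ :=
    ContMDiffAt.mfderiv_const (hf x₀) (by simp)
  have h2 := (contDiff_pullBilin (E := EuclideanSpace ℝ (Fin n))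
    (V := V)).contMDiff.contMDiffAt.comp x₀ ((ha x₀).prodMk_space h1)
  refine h2.congr_of_eventuallyEq ?_
  filter_upwards [(trivializationAt (EuclideanSpace ℝ (Fin n)) (TangentSpace (𝓡 n)) x₀).open_baseSet.mem_nhds
    (FiberBundle.mem_baseSet_trivializationAt' x₀)] with x hx
  refine ContinuousLinearMap.ext fun v => ContinuousLinearMap.ext fun w => ?_
  rw [Function.comp_apply, pullBilin_apply, hom_trivializationAt_apply]
  simp only [ContinuousLinearMap.inCoordinates, inTangentCoordinates, 
    TangentBundle.continuousLinearMapAt_model_space]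
  simp only [ContinuousLinearMap.comp_apply]
  rw [Trivialization.continuousLinearMapAt_apply, Trivialization.linearMapAt_apply]
  rw [if_pos (by simpa using hx), hom_trivializationAt_apply]
  simp [ContinuousLinearMap.inCoordinates, pullForm_apply]
  exact Or.inl rfl

variable {W : Type} [NormedAddCommGroup W] [InnerProductSpace ℝ W]

/-- The metric `a⟨df, df⟩ + b⟨dg, dg⟩`. -/
def pullMetric [IsManifold (𝓡 n) ∞ N] (f : N → V) (a : N → ℝ) (g : N → W) (b : N → ℝ)
    (hf : ContMDiff (𝓡 n) 𝓘(ℝ, V) ∞ f) (ha : ContMDiff (𝓡 n) 𝓘(ℝ, ℝ) ∞ a)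
    (hg : ContMDiff (𝓡 n) 𝓘(ℝ, W) ∞ g) (hb : ContMDiff (𝓡 n) 𝓘(ℝ, ℝ) ∞ b)
    (ha0 : ∀ x, 0 < a x) (hb0 : ∀ x, 0 < b x)
    (hinj : ∀ x (v : TangentSpace (𝓡 n) x), diffAt f x v = 0 → diffAt g x v = 0 → v = 0) :
    ContMDiffRiemannianMetric (𝓡 n) ∞ (EuclideanSpace ℝ (Fin n))
      (fun x : N => TangentSpace (𝓡 n) x) where
  inner x := pullForm f a x + pullForm g b x
  symm x v w := by
    simp only [add_apply, pullForm_apply]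
    rw [real_inner_comm, real_inner_comm (diffAt g x v)]
  pos x v hv := by
    simp only [add_apply, pullForm_apply, real_inner_self_eq_norm_sq]
    have h1 := mul_nonneg (ha0 x).le (sq_nonneg ‖diffAt f x v‖)
    have h2 := mul_nonneg (hb0 x).le (sq_nonneg ‖diffAt g x v‖)
    by_contra hcon
    have e1 : a x * ‖diffAt f x v‖ ^ 2 = 0 := by linarith
    have e2 : b x * ‖diffAt g x v‖ ^ 2 = 0 := by linarith
    refine hv (hinj x v ?_ ?_)
    · simpa [(ha0 x).ne'] using e1
    · simpa [(hb0 x).ne'] using e2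
  isVonNBounded x := by
    have key : ∀ v : TangentSpace (𝓡 n) x, pullForm f a x v v + pullForm g b x v v < 1 →
        a x * ‖diffAt f x v‖ ^ 2 + b x * ‖diffAt g x v‖ ^ 2 < 1 := fun v hv => by
      simpa only [pullForm_apply, real_inner_self_eq_norm_sq] using hv
    -- The joint differential `(df, dg)` is injective on a finite-dimensional space, hence bounded
    -- below, and this bounds the unit ball of the metric.
    let T : EuclideanSpace ℝ (Fin n) →L[ℝ] V × W := ContinuousLinearMap.prod
      (diffAt f x : EuclideanSpace ℝ (Fin n) →L[ℝ] V) (diffAt g x)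
    obtain ⟨K, hK, hT⟩ := T.toLinearMap.exists_antilipschitzWith
      (LinearMap.ker_eq_bot'.2 fun v hv => hinj x v (Prod.ext_iff.1 hv).1 (Prod.ext_iff.1 hv).2)
    refine (NormedSpace.isVonNBounded_iff' (𝕜 := ℝ) (E := EuclideanSpace ℝ (Fin n))).2 
      ⟨K * max (Real.sqrt (a x)⁻¹) (Real.sqrt (b x)⁻¹), fun v hv => ?_⟩
    have hv' : a x * ‖diffAt f x v‖ ^ 2 + b x * ‖diffAt g x v‖ ^ 2 < 1 := key v hv
    have h1 := mul_nonneg (ha0 x).le (sq_nonneg ‖diffAt f x v‖)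
    have h2 := mul_nonneg (hb0 x).le (sq_nonneg ‖diffAt g x v‖)
    have h3 := hT.le_mul_norm (map_zero _) v
    refine h3.trans (mul_le_mul_of_nonneg_left (max_le_max ?_ ?_) K.2)
    · refine Real.le_sqrt_of_sq_le ?_
      rw [← one_div, le_div_iff₀ (ha0 x), mul_comm]
      change a x * ‖diffAt f x v‖ ^ 2 ≤ 1
      linarith
    · refine Real.le_sqrt_of_sq_le ?_
      rw [← one_div, le_div_iff₀ (hb0 x), mul_comm]
      change b x * ‖diffAt g x v‖ ^ 2 ≤ 1
      linarith
  contMDiff := (contMDiff_pullForm hf ha).add_section (contMDiff_pullForm hg hb)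

lemma pullMetric_inner [IsManifold (𝓡 n) ∞ N] {f : N → V} {a : N → ℝ} {g : N → W} {b : N → ℝ}
    (hf : ContMDiff (𝓡 n) 𝓘(ℝ, V) ∞ f) (ha : ContMDiff (𝓡 n) 𝓘(ℝ, ℝ) ∞ a)
    (hg : ContMDiff (𝓡 n) 𝓘(ℝ, W) ∞ g) (hb : ContMDiff (𝓡 n) 𝓘(ℝ, ℝ) ∞ b)
    (ha0 : ∀ x, 0 < a x) (hb0 : ∀ x, 0 < b x)
    (hinj : ∀ x (v : TangentSpace (𝓡 n) x), diffAt f x v = 0 → diffAt g x v = 0 → v = 0)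
    (x : N) (v w : TangentSpace (𝓡 n) x) :
    (pullMetric f a g b hf ha hg hb ha0 hb0 hinj).inner x v w =
      a x * inner ℝ (diffAt f x v) (diffAt f x w) + b x * inner ℝ (diffAt g x v) (diffAt g x w) := by
  rw [← pullForm_apply, ← pullForm_apply]
  rfl

/-- The components of a pulled back metric in a chart whose target is the whole space. -/
lemma inner_mfderiv_extChartAt_symm [IsManifold (𝓡 n) ∞ N] {f : N → V}
    (hf : ContMDiff (𝓡 n) 𝓘(ℝ, V) ∞ f) (p : N)
    (hp : (chartAt (EuclideanSpace ℝ (Fin n)) p).target = Set.univ)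
    (y u : EuclideanSpace ℝ (Fin n)) :
    diffAt f ((extChartAt (𝓡 n) p).symm y)
      (mfderiv (𝓡 n) (𝓡 n) (extChartAt (𝓡 n) p).symm y u) =
    fderiv ℝ (f ∘ (chartAt (EuclideanSpace ℝ (Fin n)) p).symm) y u := by
  have h1 : MDifferentiableAt (𝓡 n) (𝓡 n) (extChartAt (𝓡 n) p).symm y := by
    have h := contMDiffOn_extChartAt_symm (I := 𝓡 n) (n := ∞) p
    have ht : (extChartAt (𝓡 n) p).target = Set.univ := by
      simp [hp]
    rw [ht, contMDiffOn_univ] at h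
    exact (h y).mdifferentiableAt (by simp)
  have h2 : MDifferentiableAt (𝓡 n) 𝓘(ℝ, V) f ((extChartAt (𝓡 n) p).symm y) :=
    (hf _).mdifferentiableAt (by simp)
  rw [← mfderiv_eq_fderiv]
  exact (congr($(mfderiv_comp y h2 h1) u)).symm

lemma diffAt_eq_fderiv {f : N → V} (hf : ContMDiff (𝓡 n) 𝓘(ℝ, V) ∞ f) (p : N)
    (v : TangentSpace (𝓡 n) p) :
    diffAt f p v = fderiv ℝ (f ∘ (chartAt (EuclideanSpace ℝ (Fin n)) p).symm)
      (chartAt (EuclideanSpace ℝ (Fin n)) p p) v := by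
  have h2 : MDifferentiableAt (𝓡 n) 𝓘(ℝ, V) f p := (hf _).mdifferentiableAt (by simp)
  unfold diffAt
  rw [h2.mfderiv]
  simp [writtenInExtChartAt]
  rfl
end pullForm

/-! ### Inverse stereographic projection -/

section stereo
variable {E F : Type} [NormedAddCommGroup E] [InnerProductSpace ℝ E] [NormedAddCommGroup F]
  [InnerProductSpace ℝ F]

/-- The inverse stereographic projection. -/
def invStereo (T : E →ₗᵢ[ℝ] F) (v : F) (y : E) : F :=
  v + (‖y‖ ^ 2 + 4)⁻¹ • ((4 : ℝ) • T y - (8 : ℝ) • v)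

lemma hasFDerivAt_invStereo (T : E →ₗᵢ[ℝ] F) (v : F) (y : E) :
    HasFDerivAt (invStereo T v) ((‖y‖ ^ 2 + 4)⁻¹ • ((4 : ℝ) • T.toContinuousLinearMap) +
      ((-((‖y‖ ^ 2 + 4) ^ 2)⁻¹) • ((2 : ℝ) • innerSL ℝ y)).smulRight
        ((4 : ℝ) • T y - (8 : ℝ) • v)) y := by
  have h0 : ‖y‖ ^ 2 + 4 ≠ 0 := by positivity
  have h1 : HasFDerivAt (fun y : E => ‖y‖ ^ 2 + 4) ((2 : ℝ) • innerSL ℝ y) y :=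
    (((hasStrictFDerivAt_norm_sq y).hasFDerivAt).add_const 4).congr_fderiv (by
      rw [two_smul, two_smul])
  have h2 : HasFDerivAt (fun y : E => (‖y‖ ^ 2 + 4)⁻¹)
      ((-((‖y‖ ^ 2 + 4) ^ 2)⁻¹) • ((2 : ℝ) • innerSL ℝ y)) y :=
    (hasDerivAt_inv h0).comp_hasFDerivAt y h1
  have h3 : HasFDerivAt (fun y : E => (4 : ℝ) • T y - (8 : ℝ) • v)
      ((4 : ℝ) • T.toContinuousLinearMap) y :=
    (T.toContinuousLinearMap.hasFDerivAt.const_smul (4 : ℝ)).sub_const _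
  exact (h2.smul h3).const_add v

/-- Since `T` is isometric with image orthogonal to the pole `v`, the terms other than a multiple of
`⟨u, w⟩` cancel. The conformal factor is `1` at the origin. -/
lemma inner_fderiv_invStereo (T : E →ₗᵢ[ℝ] F) {v : F} (hv : ‖v‖ = 1)
    (hT : ∀ y, inner ℝ (T y) v = 0) (y u w : E) :
    inner ℝ (fderiv ℝ (invStereo T v) y u) (fderiv ℝ (invStereo T v) y w) =
      16 / (‖y‖ ^ 2 + 4) ^ 2 * inner ℝ u w := by
  have hT' : ∀ y, inner ℝ v (T y) = 0 := fun y => by rw [real_inner_comm, hT]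
  have hvv : inner ℝ v v = (1 : ℝ) := by rw [real_inner_self_eq_norm_sq, hv]; norm_num
  have h0 : ‖y‖ ^ 2 + 4 ≠ 0 := by positivity
  rw [(hasFDerivAt_invStereo T v y).fderiv]
  simp only [add_apply, smul_apply, ContinuousLinearMap.smulRight_apply,
    LinearIsometry.coe_toContinuousLinearMap, innerSL_apply_apply, inner_add_left, inner_add_right,
    inner_sub_left, inner_sub_right, real_inner_smul_left, real_inner_smul_right, hT, hT', hvv,
    LinearIsometry.inner_map_map, smul_eq_mul]
  rw [real_inner_comm y u, real_inner_self_eq_norm_sq]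
  field_simp
  ring

lemma contDiff_invStereo (T : E →ₗᵢ[ℝ] F) (v : F) : ContDiff ℝ ∞ (invStereo T v) := by
  have h0 : ∀ y : E, ‖y‖ ^ 2 + 4 ≠ 0 := fun y => by positivity
  unfold invStereo
  exact contDiff_const.add ((((contDiff_norm_sq ℝ).add contDiff_const).inv h0).smul
    ((contDiff_const.smul T.toContinuousLinearMap.contDiff).sub contDiff_const))
end stereo

/-! ### Stereographic charts of spheres -/

section round
open scoped EuclideanSpace

lemma chartAt_sph (d : ℕ) (p : Sph d) :
    chartAt (EuclideanSpace ℝ (Fin d)) p = stereographic' d (-p) := rfl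

/-- The preferred chart at `p` projects from `-p`, and `T` identifies its model space with the
orthogonal complement of `p`. The vector `s` represents the part of `e` tangent to the sphere at
`p`; for `e` the north pole it is the gradient of the height. -/
lemma exists_chartAt_symm_eq (d : ℕ) (p : Sph d) :
    ∃ T : EuclideanSpace ℝ (Fin d) →ₗᵢ[ℝ] EuclideanSpace ℝ (Fin (d + 1)),
      (∀ y, inner ℝ (T y) p.1 = 0) ∧
      (∀ e : EuclideanSpace ℝ (Fin (d + 1)), ∃ s, (∀ y, inner ℝ (T y) e = inner ℝ s y) ∧
        ‖s‖ ^ 2 = ‖e‖ ^ 2 - inner ℝ p.1 e ^ 2) ∧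
      ∀ y, (((chartAt (EuclideanSpace ℝ (Fin d)) p).symm y : Sph d) :
        EuclideanSpace ℝ (Fin (d + 1))) = invStereo T (-p.1) y := by
  let U := (OrthonormalBasis.fromOrthogonalSpanSingleton (𝕜 := ℝ) d
    (ne_zero_of_mem_unit_sphere (-p))).repr
  have hp : ‖p.1‖ = 1 := norm_eq_of_mem_sphere p
  refine ⟨(Submodule.subtypeₗᵢ _).comp U.symm.toLinearIsometry, fun y => ?_, fun e => ?_,
    fun y => ?_⟩
  · have h := Submodule.mem_orthogonal_singleton_iff_inner_left.1 (U.symm y).2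
    change inner ℝ (U.symm y : EuclideanSpace ℝ (Fin (d + 1))) p.1 = 0
    simpa using h
  · have he : e - (inner ℝ p.1 e : ℝ) • p.1 ∈ (ℝ ∙ ((-p : Sph d) : EuclideanSpace ℝ (Fin (d + 1))))ᗮ := by
      rw [Submodule.mem_orthogonal_singleton_iff_inner_right]
      simp [inner_sub_right, inner_smul_right, hp]
    refine ⟨U ⟨_, he⟩, fun y => ?_, ?_⟩
    · have h := Submodule.mem_orthogonal_singleton_iff_inner_left.1 (U.symm y).2
      have h' : inner ℝ (U.symm y : EuclideanSpace ℝ (Fin (d + 1))) p.1 = 0 := by simpa using h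
      rw [← U.symm.inner_map_map, U.symm_apply_apply, Submodule.coe_inner]
      change inner ℝ (U.symm y : EuclideanSpace ℝ (Fin (d + 1))) e =
        inner ℝ (e - (inner ℝ p.1 e : ℝ) • p.1) (U.symm y : EuclideanSpace ℝ (Fin (d + 1)))
      rw [inner_sub_left, real_inner_smul_left,
        real_inner_comm (U.symm y : EuclideanSpace ℝ (Fin (d + 1))) p.1, h', real_inner_comm e]
      ring
    · rw [LinearIsometryEquiv.norm_map, Submodule.coe_norm, ← real_inner_self_eq_norm_sq]
      simp only [inner_sub_left, inner_sub_right, real_inner_smul_left, real_inner_smul_right,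
        real_inner_self_eq_norm_sq, hp, real_inner_comm p.1 e, norm_smul]
      simp only [Real.norm_eq_abs, mul_one, sq_abs]
      ring
  · rw [chartAt_sph]
    rw [stereographic'_symm_apply]
    have hn : ‖((U.symm y : (ℝ ∙ ((-p : Sph d) : EuclideanSpace ℝ (Fin (d + 1))))ᗮ) :
      EuclideanSpace ℝ (Fin (d + 1)))‖ = ‖y‖ := by
      rw [← Submodule.coe_norm, LinearIsometryEquiv.norm_map]
    simp only [invStereo]
    change (‖(U.symm y : EuclideanSpace ℝ (Fin (d + 1)))‖ ^ 2 + 4)⁻¹ • (4 : ℝ) • 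
      (U.symm y : EuclideanSpace ℝ (Fin (d + 1))) +
      (‖(U.symm y : EuclideanSpace ℝ (Fin (d + 1)))‖ ^ 2 + 4)⁻¹ •
       (‖(U.symm y : EuclideanSpace ℝ (Fin (d + 1)))‖ ^ 2 - 4) • (-p.1) =
      -p.1 + (‖y‖ ^ 2 + 4)⁻¹ • ((4 : ℝ) • (U.symm y : EuclideanSpace ℝ (Fin (d + 1))) - (8 : ℝ) • (-p.1))
    rw [hn]
    have h0 : ‖y‖ ^ 2 + 4 ≠ 0 := by positivity
    match_scalars <;> field_simp; ring

/-- Manifolds whose preferred charts look like stereographic projections. -/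
structure IsRound (q : ℕ) {Y : Type} [TopologicalSpace Y]
    [ChartedSpace (EuclideanSpace ℝ (Fin q)) Y] (j : Y → EuclideanSpace ℝ (Fin (q + 1))) : Prop where
  contMDiff : ContMDiff (𝓡 q) 𝓘(ℝ, EuclideanSpace ℝ (Fin (q + 1))) ∞ j
  target_chartAt : ∀ p : Y, (chartAt (EuclideanSpace ℝ (Fin q)) p).target = Set.univ
  chartAt_self : ∀ p : Y, chartAt (EuclideanSpace ℝ (Fin q)) p p = 0
  contDiff : ∀ p : Y, ContDiff ℝ ∞ (j ∘ (chartAt (EuclideanSpace ℝ (Fin q)) p).symm)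
  conformal : ∀ (p : Y) (y u w : EuclideanSpace ℝ (Fin q)),
    inner ℝ (fderiv ℝ (j ∘ (chartAt (EuclideanSpace ℝ (Fin q)) p).symm) y u)
      (fderiv ℝ (j ∘ (chartAt (EuclideanSpace ℝ (Fin q)) p).symm) y w) =
      16 / (‖y‖ ^ 2 + 4) ^ 2 * inner ℝ u w

lemma isRound_sph (d : ℕ) : IsRound d (Subtype.val : Sph d → EuclideanSpace ℝ (Fin (d + 1))) where
  contMDiff := contMDiff_coe_sphere
  target_chartAt p := by rw [chartAt_sph, stereographic'_target]
  chartAt_self p := by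
    rw [chartAt_sph]
    simpa using stereographic'_neg d (-p)
  contDiff p := by
    obtain ⟨T, -, -, h⟩ := exists_chartAt_symm_eq d p
    rw [show Subtype.val ∘ (chartAt (EuclideanSpace ℝ (Fin d)) p).symm = _ from funext h]
    exact contDiff_invStereo T _
  conformal p y u w := by
    obtain ⟨T, h1, -, h⟩ := exists_chartAt_symm_eq d p
    rw [show Subtype.val ∘ (chartAt (EuclideanSpace ℝ (Fin d)) p).symm = _ from funext h]
    refine inner_fderiv_invStereo T ?_ (fun y => ?_) y u w
    · rw [norm_neg]; exact norm_eq_of_mem_sphere p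
    · rw [inner_neg_right, h1, neg_zero]

/-- The second factor for `n = 3`, `m = 1`, where the sphere `S⁰` would be disconnected. -/
lemma isRound_point : IsRound 0 (fun _ : EuclideanSpace ℝ (Fin 0) =>
    (0 : EuclideanSpace ℝ (Fin (0 + 1)))) where
  contMDiff := contMDiff_const
  target_chartAt _ := rfl
  chartAt_self p := Subsingleton.elim _ _
  contDiff p := contDiff_const
  conformal p y u w := by
    rw [Subsingleton.elim u 0, Subsingleton.elim w 0]
    simp

/-- The height function on a sphere in a preferred chart. -/
lemma exists_height_chartAt_symm (d : ℕ) (e : EuclideanSpace ℝ (Fin (d + 1))) (he : ‖e‖ = 1)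
    (p : Sph d) : ∃ s : EuclideanSpace ℝ (Fin d), ‖s‖ ^ 2 = 1 - inner ℝ p.1 e ^ 2 ∧
      ∀ y, inner ℝ ((chartAt (EuclideanSpace ℝ (Fin d)) p).symm y).1 e =
        (4 * inner ℝ s y + (4 - ‖y‖ ^ 2) * inner ℝ p.1 e) / (‖y‖ ^ 2 + 4) := by
  obtain ⟨T, -, h2, h⟩ := exists_chartAt_symm_eq d p
  obtain ⟨s, hs, hs'⟩ := h2 e
  refine ⟨s, by rw [hs', he]; ring, fun y => ?_⟩
  have h0 : ‖y‖ ^ 2 + 4 ≠ 0 := by positivity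
  rw [h y, invStereo]
  simp only [inner_add_left, inner_sub_left, real_inner_smul_left, inner_neg_left, hs]
  field_simp
  ring
end round

/-! ### Products charted on a single Euclidean space -/

section prod
variable {d q : ℕ} {X Y : Type} [TopologicalSpace X] [TopologicalSpace Y]

variable (X Y) in
/-- The product `X × Y`, to be charted on `ℝ^{d+q}`. -/
def ProdSpace := X × Y

instance : TopologicalSpace (ProdSpace X Y) := inferInstanceAs (TopologicalSpace (X × Y))
instance [T2Space X] [T2Space Y] : T2Space (ProdSpace X Y) := inferInstanceAs (T2Space (X × Y))
instance [CompactSpace X] [CompactSpace Y] : CompactSpace (ProdSpace X Y) :=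
  inferInstanceAs (CompactSpace (X × Y))
instance [ConnectedSpace X] [ConnectedSpace Y] : ConnectedSpace (ProdSpace X Y) :=
  inferInstanceAs (ConnectedSpace (X × Y))

/-- The splitting of `ℝ^{d+q}`. -/
abbrev splitE (d q : ℕ) : EuclideanSpace ℝ (Fin (d + q)) ≃L[ℝ]
    EuclideanSpace ℝ (Fin d) × EuclideanSpace ℝ (Fin q) := EuclideanSpace.finAddEquivProd

variable [ChartedSpace (EuclideanSpace ℝ (Fin d)) X] [ChartedSpace (EuclideanSpace ℝ (Fin q)) Y]

/-- The product of the preferred charts. -/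
def prodChart (p : ProdSpace X Y) :
    OpenPartialHomeomorph (ProdSpace X Y) (EuclideanSpace ℝ (Fin (d + q))) :=
  ((chartAt (EuclideanSpace ℝ (Fin d)) p.1).prod (chartAt (EuclideanSpace ℝ (Fin q)) p.2)).trans
    (splitE d q).symm.toHomeomorph.toOpenPartialHomeomorph

instance : ChartedSpace (EuclideanSpace ℝ (Fin (d + q))) (ProdSpace X Y) where
  atlas := Set.range prodChart
  chartAt := prodChart
  mem_chart_source p := by
    simp only [prodChart, OpenPartialHomeomorph.trans_source, OpenPartialHomeomorph.prod_source]
    exact ⟨⟨mem_chart_source _ p.1, mem_chart_source _ p.2⟩, trivial⟩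
  chart_mem_atlas p := ⟨p, rfl⟩

lemma chartAt_prod_apply (p x : ProdSpace X Y) :
    chartAt (EuclideanSpace ℝ (Fin (d + q))) p x = (splitE d q).symm
      (chartAt (EuclideanSpace ℝ (Fin d)) p.1 x.1, chartAt (EuclideanSpace ℝ (Fin q)) p.2 x.2) := rfl

lemma mem_chartAt_prod_source {p x : ProdSpace X Y} :
    x ∈ (chartAt (EuclideanSpace ℝ (Fin (d + q))) p).source ↔
      x.1 ∈ (chartAt (EuclideanSpace ℝ (Fin d)) p.1).source ∧
      x.2 ∈ (chartAt (EuclideanSpace ℝ (Fin q)) p.2).source := by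
  change x ∈ (prodChart p).source ↔ _
  simp only [prodChart, OpenPartialHomeomorph.trans_source, OpenPartialHomeomorph.prod_source]
  exact ⟨fun h => h.1, fun h => ⟨h, trivial⟩⟩

lemma mem_chartAt_prod_target {p : ProdSpace X Y} {y : EuclideanSpace ℝ (Fin (d + q))} :
    y ∈ (chartAt (EuclideanSpace ℝ (Fin (d + q))) p).target ↔
      (splitE d q y).1 ∈ (chartAt (EuclideanSpace ℝ (Fin d)) p.1).target ∧
      (splitE d q y).2 ∈ (chartAt (EuclideanSpace ℝ (Fin q)) p.2).target := by
  change y ∈ (prodChart p).target ↔ _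
  simp only [prodChart, OpenPartialHomeomorph.trans_target, OpenPartialHomeomorph.prod_target]
  exact ⟨fun h => h.2, fun h => ⟨trivial, h⟩⟩

lemma contDiffOn_chartAt_comp_symm {n : ℕ} {Z : Type} [TopologicalSpace Z]
    [ChartedSpace (EuclideanSpace ℝ (Fin n)) Z] [IsManifold (𝓡 n) ∞ Z] (p p' : Z) :
    ContDiffOn ℝ ∞ (chartAt (EuclideanSpace ℝ (Fin n)) p' ∘
      (chartAt (EuclideanSpace ℝ (Fin n)) p).symm)
      {y | y ∈ (chartAt (EuclideanSpace ℝ (Fin n)) p).target ∧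
        (chartAt (EuclideanSpace ℝ (Fin n)) p).symm y ∈
          (chartAt (EuclideanSpace ℝ (Fin n)) p').source} := by
  have h := contDiffOn_ext_coord_change (I := 𝓡 n) (n := ∞) p' p
  simp only [mfld_simps] at h
  exact h

instance [IsManifold (𝓡 d) ∞ X] [IsManifold (𝓡 q) ∞ Y] :
    IsManifold (𝓡 (d + q)) ∞ (ProdSpace X Y) := by
  refine isManifold_of_contDiffOn _ _ _ ?_
  rintro _ _ ⟨p, rfl⟩ ⟨p', rfl⟩
  have h1 := contDiffOn_chartAt_comp_symm (n := d) p.1 p'.1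
  have h2 := contDiffOn_chartAt_comp_symm (n := q) p.2 p'.2
  have h3 : ContDiffOn ℝ ∞ (fun y : EuclideanSpace ℝ (Fin (d + q)) => (splitE d q).symm
      (chartAt (EuclideanSpace ℝ (Fin d)) p'.1 ((chartAt (EuclideanSpace ℝ (Fin d)) p.1).symm
        (splitE d q y).1),
       chartAt (EuclideanSpace ℝ (Fin q)) p'.2 ((chartAt (EuclideanSpace ℝ (Fin q)) p.2).symm
        (splitE d q y).2)))
      {y | y ∈ (prodChart (d := d) (q := q) p).target ∧
        (prodChart (d := d) (q := q) p).symm y ∈ (prodChart (d := d) (q := q) p').source} := by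
    refine (splitE d q).symm.contDiff.comp_contDiffOn (ContDiffOn.prodMk ?_ ?_)
    · refine h1.comp ((contDiff_fst.comp (splitE d q).contDiff).contDiffOn) fun y hy => ?_
      exact ⟨((mem_chartAt_prod_target (d := d) (q := q)).1 hy.1).1, ((mem_chartAt_prod_source (d := d) (q := q)).1 hy.2).1⟩
    · refine h2.comp ((contDiff_snd.comp (splitE d q).contDiff).contDiffOn) fun y hy => ?_
      exact ⟨((mem_chartAt_prod_target (d := d) (q := q)).1 hy.1).2, ((mem_chartAt_prod_source (d := d) (q := q)).1 hy.2).2⟩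
  simp only [mfld_simps]
  exact h3

variable [IsManifold (𝓡 d) ∞ X] [IsManifold (𝓡 q) ∞ Y]

lemma contMDiff_prod_fst : ContMDiff (𝓡 (d + q)) (𝓡 d) ∞ (fun p : ProdSpace X Y => p.1) := by
  rw [contMDiff_iff]
  refine ⟨continuous_fst (X := X) (Y := Y), fun p x => ?_⟩
  simp only [mfld_simps]
  refine (contDiffOn_chartAt_comp_symm p.1 x).comp
    ((contDiff_fst.comp (splitE d q).contDiff).contDiffOn) fun y hy => ?_
  exact ⟨((mem_chartAt_prod_target (d := d) (q := q)).1 hy.1).1, hy.2⟩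

lemma contMDiff_prod_snd : ContMDiff (𝓡 (d + q)) (𝓡 q) ∞ (fun p : ProdSpace X Y => p.2) := by
  rw [contMDiff_iff]
  refine ⟨continuous_snd (X := X) (Y := Y), fun p x => ?_⟩
  simp only [mfld_simps]
  refine (contDiffOn_chartAt_comp_symm p.2 x).comp
    ((contDiff_snd.comp (splitE d q).contDiff).contDiffOn) fun y hy => ?_
  exact ⟨((mem_chartAt_prod_target (d := d) (q := q)).1 hy.1).2, hy.2⟩

/-- The inclusion of a factor. -/
def prodIncl (y₀ : Y) (x : X) : ProdSpace X Y := (x, y₀)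

/-- A chart centred at `y₀` turns the slice into the linear inclusion `y ↦ (y, 0)`, which is the
normal form of an immersion. -/
lemma isSmoothEmbedding_prodIncl (y₀ : Y)
    (hy₀ : chartAt (EuclideanSpace ℝ (Fin q)) y₀ y₀ = 0) :
    IsSmoothEmbedding (𝓡 d) (𝓡 (d + q)) ∞ (prodIncl y₀ : X → ProdSpace X Y) where
  isImmersion := by
    refine ⟨EuclideanSpace ℝ (Fin q), inferInstance, inferInstance, fun x => ?_⟩
    refine IsImmersionAtOfComplement.mk_of_charts (splitE d q).symm
      (chartAt (EuclideanSpace ℝ (Fin d)) x)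
      (chartAt (EuclideanSpace ℝ (Fin (d + q))) (prodIncl y₀ x)) (mem_chart_source _ x)
      (mem_chart_source _ _) (IsManifold.chart_mem_maximalAtlas x)
      (IsManifold.chart_mem_maximalAtlas _) (fun z hz => ?_) fun y hy => ?_
    · exact mem_chartAt_prod_source.2 ⟨hz, mem_chart_source _ y₀⟩
    · simp only [mfld_simps] at hy ⊢
      rw [chartAt_prod_apply]
      simp only [prodIncl, hy₀]
      rw [(chartAt (EuclideanSpace ℝ (Fin d)) x).right_inv hy]
  isEmbedding := isEmbedding_prodMkLeft (X := X) y₀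

lemma splitE_fst (y : EuclideanSpace ℝ (Fin (d + q))) (i : Fin d) :
    (splitE d q y).1 i = y (Fin.castAdd q i) := rfl

lemma splitE_snd (y : EuclideanSpace ℝ (Fin (d + q))) (i : Fin q) :
    (splitE d q y).2 i = y (Fin.natAdd d i) := rfl

lemma splitE_castAdd (i : Fin d) :
    splitE d q (EuclideanSpace.single (Fin.castAdd q i) 1) = (EuclideanSpace.single i 1, 0) := by
  have hne : ∀ j, Fin.natAdd d j ≠ Fin.castAdd q i := fun j h => by
    have := congrArg Fin.val h
    simp only [Fin.val_natAdd, Fin.val_castAdd] at this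
    omega
  refine Prod.ext (PiLp.ext fun j => ?_) (PiLp.ext fun j => ?_)
  · rw [splitE_fst]; simp [PiLp.single_apply]
  · rw [splitE_snd]; simp [hne]

lemma splitE_natAdd (i : Fin q) :
    splitE d q (EuclideanSpace.single (Fin.natAdd d i) 1) = (0, EuclideanSpace.single i 1) := by
  have hne : ∀ j, Fin.castAdd q j ≠ Fin.natAdd d i := fun j h => by
    have := congrArg Fin.val h
    simp only [Fin.val_natAdd, Fin.val_castAdd] at this
    omega
  refine Prod.ext (PiLp.ext fun j => ?_) (PiLp.ext fun j => ?_)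
  · rw [splitE_fst]; simp [hne]
  · rw [splitE_snd]; simp [PiLp.single_apply]
end prod

/-! ### Conformal metrics on spheres, warped products and their slices -/

section warped
open scoped EuclideanSpace

lemma connectedSpace_sph (k : ℕ) : ConnectedSpace (Sph (k + 1)) :=
  isConnected_iff_connectedSpace.1 (isConnected_sphere (by
    rw [← Module.finrank_eq_rank, finrank_euclideanSpace_fin]; norm_cast; omega) 0 zero_le_one)

/-- The north pole. -/
def northPole (d : ℕ) : EuclideanSpace ℝ (Fin (d + 1)) := EuclideanSpace.single 0 1

lemma norm_northPole (d : ℕ) : ‖northPole d‖ = 1 := by simp [northPole]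

/-- The height function on the sphere. -/
def height {d : ℕ} (p : Sph d) : ℝ := inner ℝ p.1 (northPole d)

lemma height_mem {d : ℕ} (p : Sph d) : height p ∈ Set.Icc (-1 : ℝ) 1 := by
  have h := abs_real_inner_le_norm p.1 (northPole d)
  rw [norm_northPole, norm_eq_of_mem_sphere p, mul_one] at h
  exact abs_le.1 h

lemma contMDiff_height (d : ℕ) : ContMDiff (𝓡 d) 𝓘(ℝ, ℝ) ∞ (height (d := d)) := by
  have h : ContDiff ℝ ∞ fun x : EuclideanSpace ℝ (Fin (d + 1)) => inner ℝ x (northPole d) :=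
    contDiff_id.inner ℝ contDiff_const
  exact h.contMDiff.comp contMDiff_coe_sphere

/-- A smooth positive function on a neighbourhood of `[-1, 1]`. -/
structure IsWeight (Θ : ℝ → ℝ) : Prop where
  contDiffAt : ∀ z ∈ Set.Icc (-1 : ℝ) 1, ContDiffAt ℝ ∞ Θ z
  pos : ∀ z ∈ Set.Icc (-1 : ℝ) 1, 0 < Θ z

lemma IsWeight.contMDiff_comp {Θ : ℝ → ℝ} (hΘ : IsWeight Θ) (d : ℕ) :
    ContMDiff (𝓡 d) 𝓘(ℝ, ℝ) ∞ fun p : Sph d => Θ (height p) := fun p =>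
  (hΘ.contDiffAt _ (height_mem p)).contMDiffAt.comp p (contMDiff_height d p)

variable {d q : ℕ} {Y : Type} [TopologicalSpace Y] [ChartedSpace (EuclideanSpace ℝ (Fin q)) Y]
  {j : Y → EuclideanSpace ℝ (Fin (q + 1))}

lemma IsRound.eq_zero (hj : IsRound q j) (p : Y) (y u : EuclideanSpace ℝ (Fin q))
    (h : fderiv ℝ (j ∘ (chartAt (EuclideanSpace ℝ (Fin q)) p).symm) y u = 0) : u = 0 := by
  have h1 := hj.conformal p y u u
  rw [h, inner_zero_left, eq_comm, mul_eq_zero] at h1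
  rcases h1 with h1 | h1
  · exact absurd h1 (by positivity)
  · exact inner_self_eq_zero.1 h1

lemma fderiv_fst_chartAt_symm {X : Type} [TopologicalSpace X]
    [ChartedSpace (EuclideanSpace ℝ (Fin d)) X] {i : X → EuclideanSpace ℝ (Fin (d + 1))}
    (hi : IsRound d i) (p : ProdSpace X Y) (y u : EuclideanSpace ℝ (Fin (d + q))) :
    fderiv ℝ ((fun p : ProdSpace X Y => i p.1) ∘
      (chartAt (EuclideanSpace ℝ (Fin (d + q))) p).symm) y u =
    fderiv ℝ (i ∘ (chartAt (EuclideanSpace ℝ (Fin d)) p.1).symm) (splitE d q y).1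
      (splitE d q u).1 := by
  have h1 : HasFDerivAt (i ∘ (chartAt (EuclideanSpace ℝ (Fin d)) p.1).symm) _ (splitE d q y).1 :=
    ((hi.contDiff p.1).differentiable (by simp) _).hasFDerivAt
  have h2 : HasFDerivAt (fun y => (splitE d q y).1)
      ((ContinuousLinearMap.fst ℝ _ _).comp (splitE d q).toContinuousLinearMap) y :=
    ((ContinuousLinearMap.fst ℝ _ _).comp (splitE d q).toContinuousLinearMap).hasFDerivAt
  exact congr($((h1.comp y h2).fderiv) u)

lemma fderiv_snd_chartAt_symm {X : Type} [TopologicalSpace X]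
    [ChartedSpace (EuclideanSpace ℝ (Fin d)) X]
    (hj : IsRound q j) (p : ProdSpace X Y) (y u : EuclideanSpace ℝ (Fin (d + q))) :
    fderiv ℝ ((fun p : ProdSpace X Y => j p.2) ∘
      (chartAt (EuclideanSpace ℝ (Fin (d + q))) p).symm) y u =
    fderiv ℝ (j ∘ (chartAt (EuclideanSpace ℝ (Fin q)) p.2).symm) (splitE d q y).2
      (splitE d q u).2 := by
  have h1 : HasFDerivAt (j ∘ (chartAt (EuclideanSpace ℝ (Fin q)) p.2).symm) _ (splitE d q y).2 :=
    ((hj.contDiff p.2).differentiable (by simp) _).hasFDerivAt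
  have h2 : HasFDerivAt (fun y => (splitE d q y).2)
      ((ContinuousLinearMap.snd ℝ _ _).comp (splitE d q).toContinuousLinearMap) y :=
    ((ContinuousLinearMap.snd ℝ _ _).comp (splitE d q).toContinuousLinearMap).hasFDerivAt
  exact congr($((h1.comp y h2).fderiv) u)

instance (d : ℕ) : IsManifold (𝓡 d) ∞ (Sph d) := IsManifold.of_le (n := ω) le_top

lemma eq_zero_of_diffAt_val_eq_zero (p : Sph d) (v : TangentSpace (𝓡 d) p)
    (hv : diffAt (Subtype.val : Sph d → EuclideanSpace ℝ (Fin (d + 1))) p v = 0) : v = 0 := by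
  rw [diffAt_eq_fderiv (isRound_sph d).contMDiff] at hv
  exact (isRound_sph d).eq_zero _ _ _ hv

/-- The metric `Θ(z) g_round` on a sphere, where `z` is the height. -/
def conformalMetric (d : ℕ) {Θ : ℝ → ℝ} (hΘ : IsWeight Θ) :
    ContMDiffRiemannianMetric (𝓡 d) ∞ (EuclideanSpace ℝ (Fin d))
      (fun x : Sph d => TangentSpace (𝓡 d) x) :=
  pullMetric (Subtype.val : Sph d → EuclideanSpace ℝ (Fin (d + 1)))
    (fun p => Θ (height p)) (fun _ => (0 : ℝ)) (fun _ => 1) (isRound_sph d).contMDiff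
    (hΘ.contMDiff_comp d) contMDiff_const contMDiff_const (fun p => hΘ.pos _ (height_mem p))
    (fun _ => one_pos) fun p v hv _ => eq_zero_of_diffAt_val_eq_zero p v hv

lemma conformalMetric_inner {Θ : ℝ → ℝ} (hΘ : IsWeight Θ) (p : Sph d)
    (v w : TangentSpace (𝓡 d) p) : (conformalMetric d hΘ).inner p v w =
      Θ (height p) * inner ℝ (diffAt (Subtype.val : Sph d → EuclideanSpace ℝ (Fin (d + 1))) p v)
        (diffAt (Subtype.val : Sph d → EuclideanSpace ℝ (Fin (d + 1))) p w) := by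
  have h : diffAt (fun _ : Sph d => (0 : ℝ)) p v = 0 := by
    simp only [diffAt]
    rw [mfderiv_const]
    rfl
  rw [conformalMetric, pullMetric_inner, h, inner_zero_left, mul_zero, add_zero]

/-- The sphere with the metric `Θ(z) g_round`. -/
def conformalSphere (d : ℕ) [ConnectedSpace (Sph d)] {Θ : ℝ → ℝ} (hΘ : IsWeight Θ) :
    ClosedRiemannianManifold d where
  Carrier := Sph d
  metric := conformalMetric d hΘ

/-- The embedding of the first factor in Euclidean space. -/
def embFst (p : ProdSpace (Sph d) Y) : EuclideanSpace ℝ (Fin (d + 1)) := p.1.1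

/-- The height of the first factor. -/
def heightFst (p : ProdSpace (Sph d) Y) : ℝ := height p.1

/-- The map of the second factor to Euclidean space. -/
def embSnd (j : Y → EuclideanSpace ℝ (Fin (q + 1))) (p : ProdSpace (Sph d) Y) :
    EuclideanSpace ℝ (Fin (q + 1)) := j p.2

lemma fderiv_embFst (p : ProdSpace (Sph d) Y) (y u : EuclideanSpace ℝ (Fin (d + q))) :
    fderiv ℝ (embFst ∘ (chartAt (EuclideanSpace ℝ (Fin (d + q))) p).symm) y u =
    fderiv ℝ (Subtype.val ∘ (chartAt (EuclideanSpace ℝ (Fin d)) p.1).symm) (splitE d q y).1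
      (splitE d q u).1 := fderiv_fst_chartAt_symm (isRound_sph d) p y u

lemma fderiv_embSnd (hj : IsRound q j) (p : ProdSpace (Sph d) Y)
    (y u : EuclideanSpace ℝ (Fin (d + q))) :
    fderiv ℝ (embSnd j ∘ (chartAt (EuclideanSpace ℝ (Fin (d + q))) p).symm) y u =
    fderiv ℝ (j ∘ (chartAt (EuclideanSpace ℝ (Fin q)) p.2).symm) (splitE d q y).2
      (splitE d q u).2 := fderiv_snd_chartAt_symm hj p y u

lemma chartAt_prod_target (hj : IsRound q j) (p : ProdSpace (Sph d) Y) :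
    (chartAt (EuclideanSpace ℝ (Fin (d + q))) p).target = Set.univ := by
  ext y
  simp [mem_chartAt_prod_target, (isRound_sph d).target_chartAt, hj.target_chartAt]

variable [IsManifold (𝓡 q) ∞ Y]

lemma contMDiff_embFst : ContMDiff (𝓡 (d + q)) 𝓘(ℝ, EuclideanSpace ℝ (Fin (d + 1))) ∞
    (embFst : ProdSpace (Sph d) Y → _) := (isRound_sph d).contMDiff.comp contMDiff_prod_fst

lemma contMDiff_embSnd (hj : IsRound q j) :
    ContMDiff (𝓡 (d + q)) 𝓘(ℝ, EuclideanSpace ℝ (Fin (q + 1))) ∞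
    (embSnd j : ProdSpace (Sph d) Y → _) := hj.contMDiff.comp contMDiff_prod_snd

lemma IsWeight.contMDiff_heightFst {Θ : ℝ → ℝ} (hΘ : IsWeight Θ) :
    ContMDiff (𝓡 (d + q)) 𝓘(ℝ, ℝ) ∞ (fun p : ProdSpace (Sph d) Y => Θ (heightFst p)) :=
  (hΘ.contMDiff_comp d).comp contMDiff_prod_fst

lemma diffAt_embFst (p : ProdSpace (Sph d) Y) (v : TangentSpace (𝓡 (d + q)) p) :
    diffAt embFst p v = fderiv ℝ (Subtype.val ∘ (chartAt (EuclideanSpace ℝ (Fin d)) p.1).symm)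
      (splitE d q (chartAt (EuclideanSpace ℝ (Fin (d + q))) p p)).1 (splitE d q v).1 :=
  (diffAt_eq_fderiv contMDiff_embFst p v).trans (fderiv_embFst p _ v)

lemma diffAt_embSnd (hj : IsRound q j) (p : ProdSpace (Sph d) Y)
    (v : TangentSpace (𝓡 (d + q)) p) :
    diffAt (embSnd j) p v = fderiv ℝ (j ∘ (chartAt (EuclideanSpace ℝ (Fin q)) p.2).symm)
      (splitE d q (chartAt (EuclideanSpace ℝ (Fin (d + q))) p p)).2 (splitE d q v).2 :=
  (diffAt_eq_fderiv (contMDiff_embSnd hj) p v).trans (fderiv_embSnd hj p _ v)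

lemma eq_zero_of_diffAt_eq_zero (hj : IsRound q j) (p : ProdSpace (Sph d) Y)
    (v : TangentSpace (𝓡 (d + q)) p) (hv : diffAt embFst p v = 0)
    (hv' : diffAt (embSnd j) p v = 0) : v = 0 := by
  rw [diffAt_embFst] at hv
  rw [diffAt_embSnd hj] at hv'
  exact (splitE d q).map_eq_zero_iff.1
    (Prod.ext ((isRound_sph d).eq_zero _ _ _ hv) (hj.eq_zero _ _ _ hv'))

variable (d) in
/-- The warped product metric `Θ(z) g_round + Ξ(z) g_round` on the product of a sphere with a round
space. -/
def warpedMetric (hj : IsRound q j) {Θ Ξ : ℝ → ℝ} (hΘ : IsWeight Θ) (hΞ : IsWeight Ξ) :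
    ContMDiffRiemannianMetric (𝓡 (d + q)) ∞ (EuclideanSpace ℝ (Fin (d + q)))
      (fun x : ProdSpace (Sph d) Y => TangentSpace (𝓡 (d + q)) x) :=
  pullMetric embFst (fun p => Θ (heightFst p)) (embSnd j) (fun p => Ξ (heightFst p))
    contMDiff_embFst hΘ.contMDiff_heightFst (contMDiff_embSnd hj) hΞ.contMDiff_heightFst
    (fun p => hΘ.pos _ (height_mem p.1))
    (fun p => hΞ.pos _ (height_mem p.1)) (eq_zero_of_diffAt_eq_zero hj)

section
variable (hj : IsRound q j) {Θ Ξ : ℝ → ℝ} (hΘ : IsWeight Θ) (hΞ : IsWeight Ξ)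

lemma warpedMetric_inner (p : ProdSpace (Sph d) Y) (v w : TangentSpace (𝓡 (d + q)) p) :
    (warpedMetric d hj hΘ hΞ).inner p v w =
      Θ (heightFst p) * inner ℝ (diffAt embFst p v) (diffAt embFst p w) +
      Ξ (heightFst p) * inner ℝ (diffAt (embSnd j) p v) (diffAt (embSnd j) p w) :=
  pullMetric_inner _ _ _ _ _ _ _ p v w

/-- On a slice the map to the second Euclidean space is constant, so only the first summand of the
metric survives. -/
lemma warpedMetric_inner_prodIncl (y₀ : Y) (x : Sph d) (v w : TangentSpace (𝓡 d) x) :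
    (conformalMetric d hΘ).inner x v w = (warpedMetric d hj hΘ hΞ).inner (prodIncl y₀ x)
      (mfderiv (𝓡 d) (𝓡 (d + q)) (prodIncl y₀ : Sph d → ProdSpace (Sph d) Y) x v)
      (mfderiv (𝓡 d) (𝓡 (d + q)) (prodIncl y₀ : Sph d → ProdSpace (Sph d) Y) x w) := by
  have hι : MDifferentiableAt (𝓡 d) (𝓡 (d + q)) (prodIncl y₀ : Sph d → ProdSpace (Sph d) Y) x :=
    ((isSmoothEmbedding_prodIncl y₀ (hj.chartAt_self y₀)).isImmersion.contMDiff x).mdifferentiableAt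
      (by simp)
  have h1 : ∀ v, diffAt embFst (prodIncl y₀ x)
      (mfderiv (𝓡 d) (𝓡 (d + q)) (prodIncl y₀ : Sph d → ProdSpace (Sph d) Y) x v) =
      diffAt (Subtype.val : Sph d → EuclideanSpace ℝ (Fin (d + 1))) x v := fun v =>
    (congr($(mfderiv_comp x ((contMDiff_embFst (prodIncl y₀ x)).mdifferentiableAt (by simp)) hι)
      v)).symm
  have h2 : ∀ v, diffAt (embSnd j) (prodIncl y₀ x)
      (mfderiv (𝓡 d) (𝓡 (d + q)) (prodIncl y₀ : Sph d → ProdSpace (Sph d) Y) x v) = 0 := fun v => by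
    refine (congr($(mfderiv_comp x ((contMDiff_embSnd hj (prodIncl y₀ x)).mdifferentiableAt
      (by simp)) hι) v)).symm.trans ?_
    change mfderiv (𝓡 d) _ (fun _ : Sph d => j y₀) x v = 0
    rw [mfderiv_const]
    rfl
  rw [conformalMetric_inner, warpedMetric_inner, h1, h1, h2, h2, inner_zero_left, mul_zero,
    add_zero]
  rfl

variable (d) in
/-- The product of a sphere with a round space, with a warped product metric. -/
def warpedProduct [ConnectedSpace (Sph d)] [T2Space Y] [CompactSpace Y] [ConnectedSpace Y]
    (hj : IsRound q j) {Θ Ξ : ℝ → ℝ} (hΘ : IsWeight Θ) (hΞ : IsWeight Ξ) :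
    ClosedRiemannianManifold (d + q) where
  Carrier := ProdSpace (Sph d) Y
  metric := warpedMetric d hj hΘ hΞ

/-- The slice `S^d × {y₀}`. -/
def warpedSlice [ConnectedSpace (Sph d)] [T2Space Y] [CompactSpace Y] [ConnectedSpace Y]
    (y₀ : Y) : ClosedSubmanifold (warpedProduct d hj hΘ hΞ) d where
  toManifold := conformalSphere d hΘ
  ι := (prodIncl y₀ : Sph d → ProdSpace (Sph d) Y)
  isSmoothEmbedding := isSmoothEmbedding_prodIncl y₀ (hj.chartAt_self y₀)
  induced_metric := warpedMetric_inner_prodIncl hj hΘ hΞ y₀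

/-- The coefficients of the warped product metric in a preferred chart. -/
def warpedCoeff (d q : ℕ) (z : EuclideanSpace ℝ (Fin d) → ℝ) (Θ Ξ : ℝ → ℝ) (i : Fin (d + q))
    (y : EuclideanSpace ℝ (Fin (d + q))) : ℝ :=
  Fin.addCases (motive := fun _ => ℝ)
    (fun _ => Θ (z (splitE d q y).1) * (16 / (‖(splitE d q y).1‖ ^ 2 + 4) ^ 2))
    (fun _ => Ξ (z (splitE d q y).1) * (16 / (‖(splitE d q y).2‖ ^ 2 + 4) ^ 2)) i

/-- The height in a preferred chart. -/
def chartHeight {d : ℕ} (p : Sph d) (y : EuclideanSpace ℝ (Fin d)) : ℝ :=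
  height ((chartAt (EuclideanSpace ℝ (Fin d)) p).symm y)

lemma sum_warpedCoeff (z : EuclideanSpace ℝ (Fin d) → ℝ) (y u v : EuclideanSpace ℝ (Fin (d + q))) :
    ∑ i, warpedCoeff d q z Θ Ξ i y * (u i * v i) =
      Θ (z (splitE d q y).1) * (16 / (‖(splitE d q y).1‖ ^ 2 + 4) ^ 2 *
        inner ℝ (splitE d q u).1 (splitE d q v).1) +
      Ξ (z (splitE d q y).1) * (16 / (‖(splitE d q y).2‖ ^ 2 + 4) ^ 2 *
        inner ℝ (splitE d q u).2 (splitE d q v).2) := by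
  have hi : ∀ (k : ℕ) (a b : EuclideanSpace ℝ (Fin k)), inner ℝ a b = ∑ i, a i * b i :=
    fun k a b => by simp [PiLp.inner_apply, mul_comm]
  rw [Fin.sum_univ_add, hi, hi]
  simp only [warpedCoeff, Fin.addCases_left, Fin.addCases_right, ← Finset.mul_sum, mul_assoc,
    splitE_fst, splitE_snd]

/-- Both factors are conformal to flat space in stereographic charts, so the product metric is
diagonal there. -/
lemma warpedMetric_inner_extChartAt (p : ProdSpace (Sph d) Y)
    (y u v : EuclideanSpace ℝ (Fin (d + q))) :
    (warpedMetric d hj hΘ hΞ).inner ((extChartAt (𝓡 (d + q)) p).symm y)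
      (mfderiv (𝓡 (d + q)) (𝓡 (d + q)) (extChartAt (𝓡 (d + q)) p).symm y u)
      (mfderiv (𝓡 (d + q)) (𝓡 (d + q)) (extChartAt (𝓡 (d + q)) p).symm y v) =
      ∑ i, warpedCoeff d q (chartHeight p.1) Θ Ξ i y * (u i * v i) := by
  have ht := chartAt_prod_target (d := d) hj p
  rw [warpedMetric_inner, inner_mfderiv_extChartAt_symm contMDiff_embFst p ht,
    inner_mfderiv_extChartAt_symm contMDiff_embFst p ht,
    inner_mfderiv_extChartAt_symm (contMDiff_embSnd hj) p ht,
    inner_mfderiv_extChartAt_symm (contMDiff_embSnd hj) p ht, fderiv_embFst, fderiv_embFst,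
    fderiv_embSnd hj, fderiv_embSnd hj, (isRound_sph d).conformal, hj.conformal, sum_warpedCoeff]
  rfl

/-- Tangent vectors at `p` are their components in the chart centred at `p`; in this form
orthonormality of a frame is an identity of matrices. -/
lemma warpedMetric_inner_chartAt (p : ProdSpace (Sph d) Y)
    (u v : TangentSpace (𝓡 (d + q)) p) :
    (warpedMetric d hj hΘ hΞ).inner p u v =
      ∑ i, warpedCoeff d q (chartHeight p.1) Θ Ξ i 0 *
        ((show EuclideanSpace ℝ (Fin (d + q)) from u) i *
          (show EuclideanSpace ℝ (Fin (d + q)) from v) i) := by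
  have h0 : chartAt (EuclideanSpace ℝ (Fin (d + q))) p p = 0 := by
    rw [chartAt_prod_apply, (isRound_sph d).chartAt_self, hj.chartAt_self]
    exact map_zero _
  have hz : chartHeight p.1 (splitE d q 0).1 = heightFst p := by
    rw [map_zero, chartHeight, heightFst, Prod.fst_zero, ← (isRound_sph d).chartAt_self p.1,
      (chartAt (EuclideanSpace ℝ (Fin d)) p.1).left_inv (mem_chart_source _ _)]
  rw [warpedMetric_inner, diffAt_embFst, diffAt_embFst, diffAt_embSnd hj, diffAt_embSnd hj, h0,
    (isRound_sph d).conformal, hj.conformal, sum_warpedCoeff, hz]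

variable [ConnectedSpace (Sph d)] [T2Space Y] [CompactSpace Y] [ConnectedSpace Y]

lemma warpedProduct_metricCoeff (p : ProdSpace (Sph d) Y) (y : EuclideanSpace ℝ (Fin (d + q))) :
    (warpedProduct d hj hΘ hΞ).metricCoeff p y =
      Matrix.diagonal fun i => warpedCoeff d q (chartHeight p.1) Θ Ξ i y := by
  ext i k
  refine (warpedMetric_inner_extChartAt hj hΘ hΞ p y _ _).trans ?_
  rcases eq_or_ne i k with rfl | h
  · simp [PiLp.single_apply]
  · simp [PiLp.single_apply, h, h.symm]
end
end warped

/-! ### Second order jets at the origin -/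

section jets
variable {n : ℕ}

lemma partialDeriv_congr {f g : EuclideanSpace ℝ (Fin n) → ℝ} {y : EuclideanSpace ℝ (Fin n)}
    (h : f =ᶠ[𝓝 y] g) (i : Fin n) : partialDeriv i f y = partialDeriv i g y := by
  rw [partialDeriv, partialDeriv, h.fderiv_eq]

lemma partialDeriv_mul {f g : EuclideanSpace ℝ (Fin n) → ℝ} {y : EuclideanSpace ℝ (Fin n)}
    (hf : DifferentiableAt ℝ f y) (hg : DifferentiableAt ℝ g y) (i : Fin n) :
    partialDeriv i (fun z => f z * g z) y =
      partialDeriv i f y * g y + f y * partialDeriv i g y := by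
  rw [partialDeriv, fderiv_fun_mul hf hg]
  simp [partialDeriv]
  ring

lemma partialDeriv_add {f g : EuclideanSpace ℝ (Fin n) → ℝ} {y : EuclideanSpace ℝ (Fin n)}
    (hf : DifferentiableAt ℝ f y) (hg : DifferentiableAt ℝ g y) (i : Fin n) :
    partialDeriv i (fun z => f z + g z) y = partialDeriv i f y + partialDeriv i g y := by
  rw [partialDeriv, fderiv_fun_add hf hg]
  rfl

lemma partialDeriv_sub {f g : EuclideanSpace ℝ (Fin n) → ℝ} {y : EuclideanSpace ℝ (Fin n)}
    (hf : DifferentiableAt ℝ f y) (hg : DifferentiableAt ℝ g y) (i : Fin n) :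
    partialDeriv i (fun z => f z - g z) y = partialDeriv i f y - partialDeriv i g y := by
  rw [partialDeriv, fderiv_fun_sub hf hg]
  rfl

lemma partialDeriv_const (c : ℝ) (y : EuclideanSpace ℝ (Fin n)) (i : Fin n) :
    partialDeriv i (fun _ => c) y = 0 := by
  simp [partialDeriv]

lemma partialDeriv_comp {Θ : ℝ → ℝ} {f : EuclideanSpace ℝ (Fin n) → ℝ}
    {y : EuclideanSpace ℝ (Fin n)} (hΘ : DifferentiableAt ℝ Θ (f y))
    (hf : DifferentiableAt ℝ f y) (i : Fin n) :
    partialDeriv i (fun z => Θ (f z)) y = deriv Θ (f y) * partialDeriv i f y := by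
  have h := (hΘ.hasDerivAt.comp_hasFDerivAt y hf.hasFDerivAt).fderiv
  rw [partialDeriv]
  exact congr($h (EuclideanSpace.single i 1))

lemma contDiffAt_partialDeriv {f : EuclideanSpace ℝ (Fin n) → ℝ} {y : EuclideanSpace ℝ (Fin n)}
    (hf : ContDiffAt ℝ 2 f y) (i : Fin n) : ContDiffAt ℝ 1 (partialDeriv i f) y :=
  (hf.fderiv_right (m := 1) (by norm_num)).clm_apply contDiffAt_const

/-- The second order Taylor expansion of a function at the origin. -/
structure HasJet (f : EuclideanSpace ℝ (Fin n) → ℝ) (f0 : ℝ) (f1 : Fin n → ℝ)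
    (f2 : Fin n → Fin n → ℝ) : Prop where
  contDiffAt : ContDiffAt ℝ 2 f 0
  zero : f 0 = f0
  one : ∀ i, partialDeriv i f 0 = f1 i
  two : ∀ i j, partialDeriv i (partialDeriv j f) 0 = f2 i j

lemma HasJet.differentiableAt {f : EuclideanSpace ℝ (Fin n) → ℝ} {f0 f1 f2}
    (h : HasJet f f0 f1 f2) : DifferentiableAt ℝ f 0 := h.contDiffAt.differentiableAt (by simp)

lemma HasJet.eventually {f : EuclideanSpace ℝ (Fin n) → ℝ} {f0 f1 f2}
    (h : HasJet f f0 f1 f2) : ∀ᶠ y in 𝓝 0, DifferentiableAt ℝ f y :=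
  ((h.contDiffAt.eventually (by simp)).mono fun y hy => hy.differentiableAt (by simp))

lemma HasJet.differentiableAt_partialDeriv {f : EuclideanSpace ℝ (Fin n) → ℝ} {f0 f1 f2}
    (h : HasJet f f0 f1 f2) (i : Fin n) : DifferentiableAt ℝ (partialDeriv i f) 0 :=
  (contDiffAt_partialDeriv h.contDiffAt i).differentiableAt (by simp)

lemma hasJet_const (c : ℝ) : HasJet (fun _ : EuclideanSpace ℝ (Fin n) => c) c 0 0 where
  contDiffAt := contDiffAt_const
  zero := rfl
  one i := partialDeriv_const _ _ _
  two i j := by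
    rw [show partialDeriv j (fun _ => c) = fun _ => 0 from funext fun y => partialDeriv_const _ _ _]
    exact partialDeriv_const _ _ _

lemma HasJet.congr {f : EuclideanSpace ℝ (Fin n) → ℝ} {f0 f0' f1 f1' f2 f2'}
    (h : HasJet f f0 f1 f2) (h0 : f0 = f0') (h1 : ∀ i, f1 i = f1' i)
    (h2 : ∀ i j, f2 i j = f2' i j) : HasJet f f0' f1' f2' :=
  ⟨h.contDiffAt, h.zero.trans h0, fun i => (h.one i).trans (h1 i),
    fun i j => (h.two i j).trans (h2 i j)⟩

lemma HasJet.add {f g : EuclideanSpace ℝ (Fin n) → ℝ} {f0 f1 f2 g0 g1 g2}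
    (hf : HasJet f f0 f1 f2) (hg : HasJet g g0 g1 g2) :
    HasJet (fun y => f y + g y) (f0 + g0) (fun i => f1 i + g1 i)
      (fun i j => f2 i j + g2 i j) where
  contDiffAt := hf.contDiffAt.add hg.contDiffAt
  zero := by rw [hf.zero, hg.zero]
  one i := by rw [partialDeriv_add hf.differentiableAt hg.differentiableAt, hf.one, hg.one]
  two i j := by
    have h : partialDeriv j (fun y => f y + g y) =ᶠ[𝓝 0]
        fun y => partialDeriv j f y + partialDeriv j g y := by
      filter_upwards [hf.eventually, hg.eventually] with y h1 h2
      exact partialDeriv_add h1 h2 j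
    rw [partialDeriv_congr h, partialDeriv_add (hf.differentiableAt_partialDeriv j)
      (hg.differentiableAt_partialDeriv j), hf.two, hg.two]

lemma HasJet.mul {f g : EuclideanSpace ℝ (Fin n) → ℝ} {f0 f1 f2 g0 g1 g2}
    (hf : HasJet f f0 f1 f2) (hg : HasJet g g0 g1 g2) :
    HasJet (fun y => f y * g y) (f0 * g0) (fun i => f1 i * g0 + f0 * g1 i)
      (fun i j => f2 i j * g0 + f1 j * g1 i + f1 i * g1 j + f0 * g2 i j) where
  contDiffAt := hf.contDiffAt.mul hg.contDiffAt
  zero := by rw [hf.zero, hg.zero]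
  one i := by
    rw [partialDeriv_mul hf.differentiableAt hg.differentiableAt, hf.one, hg.one, hf.zero, hg.zero]
  two i j := by
    have h : partialDeriv j (fun y => f y * g y) =ᶠ[𝓝 0]
        fun y => partialDeriv j f y * g y + f y * partialDeriv j g y := by
      filter_upwards [hf.eventually, hg.eventually] with y h1 h2
      exact partialDeriv_mul h1 h2 j
    have hfj := hf.differentiableAt_partialDeriv j
    have hgj := hg.differentiableAt_partialDeriv j
    rw [partialDeriv_congr h, partialDeriv_add (hfj.fun_mul hg.differentiableAt)
      (hf.differentiableAt.fun_mul hgj), partialDeriv_mul hfj hg.differentiableAt,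
      partialDeriv_mul hf.differentiableAt hgj, hf.two, hg.two, hf.one, hf.one, hg.one, hg.one,
      hf.zero, hg.zero]
    ring

lemma HasJet.comp {f : EuclideanSpace ℝ (Fin n) → ℝ} {f0 f1 f2} (hf : HasJet f f0 f1 f2)
    {Θ : ℝ → ℝ} (hΘ : ContDiffAt ℝ 2 Θ f0) :
    HasJet (fun y => Θ (f y)) (Θ f0) (fun i => deriv Θ f0 * f1 i)
      (fun i j => deriv (deriv Θ) f0 * f1 i * f1 j + deriv Θ f0 * f2 i j) where
  contDiffAt := by
    have h := hf.zero ▸ hΘ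
    exact h.comp 0 hf.contDiffAt
  zero := by rw [hf.zero]
  one i := by
    rw [partialDeriv_comp (hf.zero.symm ▸ hΘ.differentiableAt (by simp)) hf.differentiableAt,
      hf.zero, hf.one]
  two i j := by
    have hev : ∀ᶠ y in 𝓝 0, DifferentiableAt ℝ Θ (f y) := by
      have h1 : ∀ᶠ x in 𝓝 (f 0), DifferentiableAt ℝ Θ x := by
        rw [hf.zero]
        exact (hΘ.eventually (by simp)).mono fun x hx => hx.differentiableAt (by simp)
      exact hf.differentiableAt.continuousAt.eventually h1
    have h : partialDeriv j (fun y => Θ (f y)) =ᶠ[𝓝 0]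
        fun y => deriv Θ (f y) * partialDeriv j f y := by
      filter_upwards [hf.eventually, hev] with y h1 h2
      exact partialDeriv_comp h2 h1 j
    have hd : DifferentiableAt ℝ (deriv Θ) (f 0) := by
      rw [hf.zero]
      have h2 : ContDiffAt ℝ 1 (fun x => fderiv ℝ Θ x 1) f0 :=
        (hΘ.fderiv_right (m := 1) (by norm_num)).clm_apply contDiffAt_const
      exact h2.differentiableAt (by simp)
    rw [partialDeriv_congr h, partialDeriv_mul (hd.fun_comp' 0 hf.differentiableAt)
      (hf.differentiableAt_partialDeriv j), partialDeriv_comp hd hf.differentiableAt, hf.zero,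
      hf.one, hf.one, hf.two]

lemma hasJet_clm (T : EuclideanSpace ℝ (Fin n) →L[ℝ] ℝ) :
    HasJet T 0 (fun i => T (EuclideanSpace.single i 1)) 0 where
  contDiffAt := T.contDiff.contDiffAt
  zero := map_zero T
  one i := by rw [partialDeriv, T.fderiv]
  two i j := by
    rw [show partialDeriv j T = fun _ => T (EuclideanSpace.single j 1) from
      funext fun y => by rw [partialDeriv, T.fderiv]]
    exact partialDeriv_const _ _ _
end jets

/-! ### Curvature of a diagonal metric from its jet -/

section curvature
variable {n : ℕ}

/-- The derivatives `∂ᵢ gⱼₖ` of a diagonal metric. -/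
def metricD1 (D1 : Fin n → Fin n → ℝ) (i j k : Fin n) : ℝ := if j = k then D1 j i else 0

/-- The derivatives `∂ᵢ ∂ᵢ' gⱼₖ` of a diagonal metric. -/
def metricD2 (D2 : Fin n → Fin n → Fin n → ℝ) (i i' j k : Fin n) : ℝ :=
  if j = k then D2 j i i' else 0

/-- The Christoffel symbols of the first kind. -/
def lowChristoffel (D1 : Fin n → Fin n → ℝ) (a i j : Fin n) : ℝ :=
  1 / 2 * (metricD1 D1 i j a + metricD1 D1 j i a - metricD1 D1 a i j)

/-- The curvature tensor of a diagonal metric in terms of its second order Taylor expansion. -/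
def jetCurvature (W : Fin n → ℝ) (D1 : Fin n → Fin n → ℝ) (D2 : Fin n → Fin n → Fin n → ℝ)
    (i j k l : Fin n) : ℝ :=
  1 / 2 * (metricD2 D2 i j l k + metricD2 D2 i l j k - metricD2 D2 i k j l) -
    1 / 2 * (metricD2 D2 j i l k + metricD2 D2 j l i k - metricD2 D2 j k i l) +
    ∑ b, (W b)⁻¹ * (lowChristoffel D1 b i l * lowChristoffel D1 b j k -
      lowChristoffel D1 b j l * lowChristoffel D1 b i k)

lemma hasJet_diagonal {w : Fin n → EuclideanSpace ℝ (Fin n) → ℝ} {W : Fin n → ℝ}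
    {D1 : Fin n → Fin n → ℝ} {D2 : Fin n → Fin n → Fin n → ℝ}
    (hw : ∀ m, HasJet (w m) (W m) (D1 m) (D2 m)) (j k : Fin n) :
    HasJet (fun y => Matrix.diagonal (fun m => w m y) j k) (if j = k then W j else 0)
      (fun i => metricD1 D1 i j k) (fun i i' => metricD2 D2 i i' j k) := by
  rcases eq_or_ne j k with rfl | h
  · simpa [metricD1, metricD2] using hw j
  · simp only [Matrix.diagonal_apply, metricD1, metricD2, h, if_false]
    exact hasJet_const 0

lemma diagonal_inv_apply (v : Fin n → ℝ) (hv : ∀ m, v m ≠ 0) (a l : Fin n) :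
    (Matrix.diagonal v)⁻¹ a l = if a = l then (v a)⁻¹ else 0 := by
  have h : (Matrix.diagonal v)⁻¹ = Matrix.diagonal fun m => (v m)⁻¹ := by
    apply Matrix.inv_eq_right_inv
    rw [Matrix.diagonal_mul_diagonal, ← Matrix.diagonal_one]
    congr
    funext m
    exact mul_inv_cancel₀ (hv m)
  rw [h, Matrix.diagonal_apply]

/-- Near the origin the coefficients stay nonzero, so the inverse metric is diagonal and each
Christoffel symbol reduces to a single term. Its value and first derivatives are all that the
curvature uses. -/
lemma hasDeriv_christoffel {w : Fin n → EuclideanSpace ℝ (Fin n) → ℝ} {W : Fin n → ℝ}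
    {D1 : Fin n → Fin n → ℝ} {D2 : Fin n → Fin n → Fin n → ℝ}
    (hw : ∀ m, HasJet (w m) (W m) (D1 m) (D2 m)) (hW : ∀ m, W m ≠ 0) (a j l : Fin n) :
    christoffel (fun y => Matrix.diagonal fun m => w m y) a j l 0 =
      (W a)⁻¹ * lowChristoffel D1 a j l ∧
    ∀ i, partialDeriv i (christoffel (fun y => Matrix.diagonal fun m => w m y) a j l) 0 =
      (W a)⁻¹ * (1 / 2 * (metricD2 D2 i j l a + metricD2 D2 i l j a - metricD2 D2 i a j l)) -
        (W a)⁻¹ * (W a)⁻¹ * D1 a i * lowChristoffel D1 a j l := by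
  have hne : ∀ᶠ y in 𝓝 0, ∀ m, w m y ≠ 0 := by
    rw [eventually_all]
    intro m
    refine (hw m).differentiableAt.continuousAt.eventually_ne ?_
    rw [(hw m).zero]
    exact hW m
  have hG := hasJet_diagonal hw
  have hev : christoffel (fun y => Matrix.diagonal fun m => w m y) a j l =ᶠ[𝓝 0] fun y =>
      (w a y)⁻¹ * (1 / 2 * (partialDeriv j (fun z => Matrix.diagonal (fun m => w m z) l a) y +
        partialDeriv l (fun z => Matrix.diagonal (fun m => w m z) j a) y -
        partialDeriv a (fun z => Matrix.diagonal (fun m => w m z) j l) y)) := by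
    filter_upwards [hne] with y hy
    simp only [christoffel]
    simp_rw [diagonal_inv_apply _ hy]
    simp only [ite_mul, zero_mul, Finset.sum_ite_eq, Finset.mem_univ, if_true]
    ring
  refine ⟨?_, fun i => ?_⟩
  · refine hev.self_of_nhds.trans ?_
    beta_reduce
    rw [(hG l a).one, (hG j a).one, (hG j l).one, (hw a).zero, lowChristoffel]
  · have h1 := (hG l a).differentiableAt_partialDeriv j
    have h2 := (hG j a).differentiableAt_partialDeriv l
    have h3 := (hG j l).differentiableAt_partialDeriv a
    have h4 : DifferentiableAt ℝ (fun y => (w a y)⁻¹) 0 :=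
      (hw a).differentiableAt.inv ((hw a).zero ▸ hW a)
    have h5 : partialDeriv i (fun y => (w a y)⁻¹) 0 = -((W a)⁻¹ * (W a)⁻¹ * D1 a i) := by
      rw [partialDeriv_comp (Θ := fun x => x⁻¹) (differentiableAt_inv ((hw a).zero ▸ hW a))
        (hw a).differentiableAt, deriv_inv, (hw a).zero, (hw a).one, pow_two, mul_inv]
      ring
    rw [partialDeriv_congr hev, partialDeriv_mul h4
      ((differentiableAt_const _).fun_mul ((h1.fun_add h2).fun_sub h3)), h5,
      partialDeriv_mul (differentiableAt_const _) ((h1.fun_add h2).fun_sub h3), partialDeriv_const,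
      partialDeriv_sub (h1.fun_add h2) h3, partialDeriv_add h1 h2, (hG l a).two, (hG j a).two,
      (hG j l).two, (hG l a).one, (hG j a).one, (hG j l).one, (hw a).zero, lowChristoffel]
    ring

/-- Compatibility of the Levi-Civita connection with the metric, in coordinates. It absorbs the
derivatives of the inverse metric in `curvatureCoeff_diagonal`. -/
lemma lowChristoffel_add (D1 : Fin n → Fin n → ℝ) (a i b : Fin n) :
    lowChristoffel D1 a i b = metricD1 D1 i b a - lowChristoffel D1 b i a := by
  have hc : ∀ i j k, metricD1 D1 i j k = metricD1 D1 i k j := fun i j k => by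
    unfold metricD1
    split_ifs with h1 h2 h2
    · rw [h1]
    · exact absurd h1.symm h2
    · exact absurd h2.symm h1
    · rfl
  simp only [lowChristoffel]
  rw [hc i b a, hc b i a, hc a i b]
  ring

/-- The terms from differentiating the inverse metric combine, by metric compatibility, with the
quadratic terms to give the usual formula in lowered Christoffel symbols. -/
theorem curvatureCoeff_diagonal {w : Fin n → EuclideanSpace ℝ (Fin n) → ℝ} {W : Fin n → ℝ}
    {D1 : Fin n → Fin n → ℝ} {D2 : Fin n → Fin n → Fin n → ℝ}
    (hw : ∀ m, HasJet (w m) (W m) (D1 m) (D2 m)) (hW : ∀ m, W m ≠ 0) (i j k l : Fin n) :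
    curvatureCoeff (fun y => Matrix.diagonal fun m => w m y) i j k l 0 =
      jetCurvature W D1 D2 i j k l := by
  have hΓ := fun a j l => (hasDeriv_christoffel hw hW a j l).1
  have hdΓ := fun a j l => (hasDeriv_christoffel hw hW a j l).2
  simp only [curvatureCoeff, Matrix.diagonal_apply, ite_mul, zero_mul, Finset.sum_ite_eq,
    Finset.mem_univ, if_true]
  simp only [hdΓ, hΓ, (hw k).zero]
  have hs : ∑ b, ((W b)⁻¹ * lowChristoffel D1 b j l * ((W k)⁻¹ * lowChristoffel D1 k i b) -
      (W b)⁻¹ * lowChristoffel D1 b i l * ((W k)⁻¹ * lowChristoffel D1 k j b)) =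
      (W k)⁻¹ * ((W k)⁻¹ * (lowChristoffel D1 k j l * D1 k i - lowChristoffel D1 k i l * D1 k j) +
      ∑ b, (W b)⁻¹ * (lowChristoffel D1 b i l * lowChristoffel D1 b j k -
        lowChristoffel D1 b j l * lowChristoffel D1 b i k)) := by
    have h1 : (W k)⁻¹ * (lowChristoffel D1 k j l * D1 k i - lowChristoffel D1 k i l * D1 k j) =
        ∑ b, (W b)⁻¹ * (lowChristoffel D1 b j l * metricD1 D1 i b k -
          lowChristoffel D1 b i l * metricD1 D1 j b k) := by
      rw [Finset.sum_eq_single k]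
      · simp [metricD1]
      · intro b _ hb
        simp [metricD1, hb]
      · simp
    rw [h1, ← Finset.sum_add_distrib, Finset.mul_sum]
    refine Finset.sum_congr rfl fun b _ => ?_
    rw [lowChristoffel_add D1 k i b, lowChristoffel_add D1 k j b]
    ring
  rw [hs, jetCurvature]
  have := hW k
  field_simp
  ring
end curvature

/-! ### Orthonormal frames, traces and partial sums of sectional curvatures -/

section frames
variable {n : ℕ}

/-- Orthonormality is `E W Eᵀ = 1`. A one-sided inverse of a square matrix is two-sided, so `W Eᵀ E
= 1`. -/
lemma sum_mul_of_orthonormal {W : Fin n → ℝ} (hW : ∀ a, W a ≠ 0) {e : Fin n → Fin n → ℝ}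
    (he : ∀ i j, ∑ a, W a * (e i a * e j a) = if i = j then 1 else 0) (a c : Fin n) :
    ∑ i, e i a * e i c = if a = c then (W a)⁻¹ else 0 := by
  have h1 : Matrix.of e * (Matrix.diagonal W * (Matrix.of e).transpose) = 1 := by
    ext i j
    rw [Matrix.mul_apply, Matrix.one_apply, ← he i j]
    refine Finset.sum_congr rfl fun a _ => ?_
    rw [Matrix.diagonal_mul]
    simp only [Matrix.of_apply, Matrix.transpose_apply]
    ring
  have h2 := congrArg (fun M => M a c) (mul_eq_one_comm.1 h1)
  beta_reduce at h2
  rw [Matrix.mul_apply, Matrix.one_apply] at h2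
  simp only [Matrix.diagonal_mul, Matrix.of_apply, Matrix.transpose_apply, mul_assoc,
    ← Finset.mul_sum] at h2
  rw [← mul_right_inj' (hW a), h2]
  split_ifs <;> simp [hW a]

/-- The value of a `4`-tensor on `(x, y, x, y)`. -/
def tensorValue (T : Fin n → Fin n → Fin n → Fin n → ℝ) (x y : Fin n → ℝ) : ℝ :=
  ∑ i, ∑ j, ∑ k, ∑ l, x i * y j * x k * y l * T i j k l

lemma tensorValue_comm {T : Fin n → Fin n → Fin n → Fin n → ℝ}
    (hT : ∀ i j k l, T i j k l = T j i l k) (x y : Fin n → ℝ) :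
    tensorValue T x y = tensorValue T y x := by
  unfold tensorValue
  rw [Finset.sum_comm]
  refine Finset.sum_congr rfl fun j _ => Finset.sum_congr rfl fun i _ => ?_
  rw [Finset.sum_comm]
  refine Finset.sum_congr rfl fun l _ => Finset.sum_congr rfl fun k _ => ?_
  rw [hT]
  ring

lemma tensorValue_self {T : Fin n → Fin n → Fin n → Fin n → ℝ}
    (hT : ∀ i j k l, T i j k l = -T j i k l) (x : Fin n → ℝ) : tensorValue T x x = 0 := by
  have h : tensorValue T x x = -tensorValue T x x := by
    conv_lhs => unfold tensorValue
    rw [Finset.sum_comm, tensorValue]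
    simp only [← Finset.sum_neg_distrib]
    refine Finset.sum_congr rfl fun j _ => Finset.sum_congr rfl fun i _ =>
      Finset.sum_congr rfl fun k _ => Finset.sum_congr rfl fun l _ => ?_
    rw [hT i j]
    ring
  linarith

/-- The full double sum over a frame is a metric trace, independent of the frame. -/
lemma sum_tensorValue {W : Fin n → ℝ} (hW : ∀ a, W a ≠ 0) {e : Fin n → Fin n → ℝ}
    (he : ∀ i j, ∑ a, W a * (e i a * e j a) = if i = j then 1 else 0)
    (T : Fin n → Fin n → Fin n → Fin n → ℝ) :
    ∑ i, ∑ j, tensorValue T (e i) (e j) = ∑ a, ∑ b, (W a)⁻¹ * (W b)⁻¹ * T a b a b := by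
  have h := sum_mul_of_orthonormal hW he
  have h1 : ∑ i, ∑ j, tensorValue T (e i) (e j) =
      ∑ a, ∑ b, ∑ c, ∑ d, (∑ i, e i a * e i c) * (∑ j, e j b * e j d) * T a b c d := by
    simp only [tensorValue]
    -- The six sums are exchanged at once by a bijection of the product index type.
    have hc : ∀ F : Fin n → Fin n → Fin n → Fin n → Fin n → Fin n → ℝ,
        ∑ i, ∑ j, ∑ a, ∑ b, ∑ c, ∑ d, F i j a b c d =
        ∑ a, ∑ b, ∑ c, ∑ d, ∑ i, ∑ j, F i j a b c d := fun F => by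
      simp only [← Fintype.sum_prod_type']
      refine Fintype.sum_equiv
        ⟨fun p => ⟨p.2.2.1, p.2.2.2.1, p.2.2.2.2.1, p.2.2.2.2.2, p.1, p.2.1⟩,
          fun p => ⟨p.2.2.2.2.1, p.2.2.2.2.2, p.1, p.2.1, p.2.2.1, p.2.2.2.1⟩,
          fun p => rfl, fun p => rfl⟩ _ _ fun p => rfl
    rw [hc]
    refine Finset.sum_congr rfl fun a _ => Finset.sum_congr rfl fun b _ =>
      Finset.sum_congr rfl fun c _ => Finset.sum_congr rfl fun d _ => ?_
    rw [Finset.sum_mul_sum, Finset.sum_mul]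
    refine Finset.sum_congr rfl fun i _ => ?_
    rw [Finset.sum_mul]
    exact Finset.sum_congr rfl fun j _ => by ring
  rw [h1]
  simp only [h, ite_mul, mul_ite, zero_mul, mul_zero, Finset.sum_ite_eq, Finset.mem_univ, if_true]

lemma two_mul_sum_lt {K : Fin n → Fin n → ℝ} (hK : ∀ i j, K i j = K j i) (h0 : ∀ i, K i i = 0) :
    2 * ∑ i, ∑ j with i < j, K i j = ∑ i, ∑ j, K i j := by
  have h1 : ∀ i j, K i j = (if i < j then K i j else 0) + (if j < i then K i j else 0) := by
    intro i j
    rcases lt_trichotomy i j with h | rfl | h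
    · simp [h, h.not_gt]
    · simp [h0]
    · simp [h, h.not_gt]
  have h2 : ∑ i, ∑ j, (if j < i then K i j else 0) = ∑ i, ∑ j, if i < j then K i j else 0 := by
    rw [Finset.sum_comm]
    simp only [hK]
  simp only [Finset.sum_filter]
  rw [Finset.sum_congr rfl fun i _ => Finset.sum_congr rfl fun j _ => h1 i j]
  simp only [Finset.sum_add_distrib]
  rw [h2, two_mul]

/-- The last index has no successor, so the omitted row is empty. For curvatures this makes
`C_{n-1}` half the scalar curvature. -/
lemma sum_lt_eq_of_succ {m : ℕ} (hm : n = m + 1) (K : Fin n → Fin n → ℝ) :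
    ∑ i : Fin n with i.val < m, ∑ j with i < j, K i j = ∑ i, ∑ j with i < j, K i j := by
  rw [Finset.sum_filter]
  refine Finset.sum_congr rfl fun i _ => ?_
  split_ifs with h
  · rfl
  · rw [Finset.sum_eq_zero]
    intro j hj
    have := (Finset.mem_filter.1 hj).2
    omega

/-- Only the pair of the last two indices is missing. -/
lemma sum_lt_ge_of_succ_succ {m : ℕ} (hm : n = m + 2) {K : Fin n → Fin n → ℝ} {b : ℝ}
    (hb : ∀ i j, i < j → K i j ≤ b) :
    ∑ i, ∑ j with i < j, K i j - b ≤ ∑ i : Fin n with i.val < m, ∑ j with i < j, K i j := by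
  subst hm
  rw [Finset.sum_filter, Fin.sum_univ_castSucc, Fin.sum_univ_castSucc, Fin.sum_univ_castSucc
    (f := fun i : Fin (m + 2) => if i.val < m then _ else _), Fin.sum_univ_castSucc
    (f := fun i : Fin (m + 1) => if (Fin.castSucc i).val < m then _ else _)]
  have h1 : (Finset.univ.filter fun j : Fin (m + 2) => Fin.last (m + 1) < j) = ∅ := by
    ext j
    simp [Fin.le_last]
  have h2 : (Finset.univ.filter fun j : Fin (m + 2) => (Fin.last m).castSucc < j) =
      {Fin.last (m + 1)} := by
    ext j
    simp only [Finset.mem_filter, Finset.mem_univ, true_and, Finset.mem_singleton, Fin.lt_def,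
      Fin.ext_iff, Fin.val_castSucc, Fin.val_last]
    omega
  simp only [h1, h2, Finset.sum_empty, Finset.sum_singleton, Fin.val_castSucc, Fin.val_last,
    Fin.is_lt, if_true, lt_irrefl, if_false]
  have := hb (Fin.last m).castSucc (Fin.last (m + 1)) (Fin.castSucc_lt_last _)
  simp
  linarith

lemma jetCurvature_swap (W : Fin n → ℝ) (D1 : Fin n → Fin n → ℝ)
    (D2 : Fin n → Fin n → Fin n → ℝ) (i j k l : Fin n) :
    jetCurvature W D1 D2 i j k l = -jetCurvature W D1 D2 j i k l := by
  have h : ∑ b, (W b)⁻¹ * (lowChristoffel D1 b i l * lowChristoffel D1 b j k -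
      lowChristoffel D1 b j l * lowChristoffel D1 b i k) =
      -∑ b, (W b)⁻¹ * (lowChristoffel D1 b j l * lowChristoffel D1 b i k -
      lowChristoffel D1 b i l * lowChristoffel D1 b j k) := by
    rw [← Finset.sum_neg_distrib]
    exact Finset.sum_congr rfl fun b _ => by ring
  rw [jetCurvature, jetCurvature, h]
  ring

lemma jetCurvature_swap_swap (W : Fin n → ℝ) (D1 : Fin n → Fin n → ℝ)
    {D2 : Fin n → Fin n → Fin n → ℝ} (hD : ∀ m i j, D2 m i j = D2 m j i) (i j k l : Fin n) :
    jetCurvature W D1 D2 i j k l = jetCurvature W D1 D2 j i l k := by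
  have h : ∑ b, (W b)⁻¹ * (lowChristoffel D1 b i l * lowChristoffel D1 b j k -
      lowChristoffel D1 b j l * lowChristoffel D1 b i k) =
      ∑ b, (W b)⁻¹ * (lowChristoffel D1 b j k * lowChristoffel D1 b i l -
      lowChristoffel D1 b i k * lowChristoffel D1 b j l) :=
    Finset.sum_congr rfl fun b _ => by ring
  have h1 : metricD2 D2 i j l k = metricD2 D2 j i l k := by simp only [metricD2, hD l i j]
  have h2 : metricD2 D2 j i k l = metricD2 D2 i j k l := by simp only [metricD2, hD k i j]
  rw [jetCurvature, jetCurvature, h, h1, h2]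
  ring

lemma jetCurvature_self (W : Fin n → ℝ) (D1 : Fin n → Fin n → ℝ)
    (D2 : Fin n → Fin n → Fin n → ℝ) (a : Fin n) : jetCurvature W D1 D2 a a a a = 0 := by
  have := jetCurvature_swap W D1 D2 a a a a
  linarith

/-- Sectional curvature components of a diagonal metric. -/
lemma jetCurvature_pair (W : Fin n → ℝ) (D1 : Fin n → Fin n → ℝ)
    (D2 : Fin n → Fin n → Fin n → ℝ) {a b : Fin n} (hab : a ≠ b) :
    jetCurvature W D1 D2 a b a b = -(1 / 2) * (D2 b a a + D2 a b b) +
      1 / 4 * ((W b)⁻¹ * D1 b a ^ 2 + (W a)⁻¹ * D1 a b ^ 2) +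
      1 / 2 * ((W b)⁻¹ * (D1 b b * D1 a b) + (W a)⁻¹ * (D1 a a * D1 b a)) -
      1 / 4 * ∑ c, (W c)⁻¹ * (D1 a c * D1 b c) := by
  have h : ∑ c, (W c)⁻¹ * (lowChristoffel D1 c a b * lowChristoffel D1 c b a -
      lowChristoffel D1 c b b * lowChristoffel D1 c a a) =
      ∑ c, ((if c = b then 1 / 4 * ((W c)⁻¹ * D1 b a ^ 2) +
          1 / 2 * ((W c)⁻¹ * (D1 b c * D1 a c)) else 0) +
        (if c = a then 1 / 4 * ((W c)⁻¹ * D1 a b ^ 2) +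
          1 / 2 * ((W c)⁻¹ * (D1 a c * D1 b c)) else 0) -
        1 / 4 * ((W c)⁻¹ * (D1 a c * D1 b c))) := by
    refine Finset.sum_congr rfl fun c _ => ?_
    simp only [lowChristoffel, metricD1]
    by_cases h1 : c = b
    · subst h1
      simp [hab, hab.symm]
      ring
    · by_cases h2 : c = a
      · subst h2
        simp [hab, hab.symm]
        ring
      · simp [hab, hab.symm, h1, h2, Ne.symm h1, Ne.symm h2]
        ring
  rw [jetCurvature, h, Finset.sum_sub_distrib, Finset.sum_add_distrib, Finset.sum_ite_eq',
    Finset.sum_ite_eq', ← Finset.mul_sum]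
  simp [metricD2, hab, hab.symm]
  ring
end frames

/-! ### Jets and scalar curvature of warped products -/

section warpedJets

lemma hasJet_norm_sq {n : ℕ} {F : Type*} [NormedAddCommGroup F] [InnerProductSpace ℝ F]
    (T : EuclideanSpace ℝ (Fin n) →L[ℝ] F) :
    HasJet (fun y => ‖T y‖ ^ 2) 0 0 (fun i j =>
      2 * inner ℝ (T (EuclideanSpace.single i 1)) (T (EuclideanSpace.single j 1))) := by
  have hd : ∀ j, partialDeriv j (fun y => ‖T y‖ ^ 2) =
      fun y => ((2 : ℝ) • (innerSL ℝ (T (EuclideanSpace.single j 1))).comp T) y := fun j => by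
    funext y
    rw [partialDeriv, (T.hasFDerivAt.norm_sq).fderiv]
    simp [real_inner_comm]
  refine ⟨(T.contDiff.norm_sq ℝ).contDiffAt, by simp, fun i => ?_, fun i j => ?_⟩
  · rw [hd]
    exact map_zero _
  · rw [hd]
    refine ((hasJet_clm _).one i).trans ?_
    simp [real_inner_comm]

variable {d q : ℕ}

/-- The components of a vector of the first factor. -/
def extendZero (q : ℕ) (s : EuclideanSpace ℝ (Fin d)) (i : Fin (d + q)) : ℝ :=
  inner ℝ s (splitE d q (EuclideanSpace.single i 1)).1

/-- The identity matrix of the first factor. -/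
def fstDelta (d q : ℕ) (i j : Fin (d + q)) : ℝ :=
  inner ℝ (splitE d q (EuclideanSpace.single i 1)).1 (splitE d q (EuclideanSpace.single j 1)).1

/-- The identity matrix of the second factor. -/
def sndDelta (d q : ℕ) (i j : Fin (d + q)) : ℝ :=
  inner ℝ (splitE d q (EuclideanSpace.single i 1)).2 (splitE d q (EuclideanSpace.single j 1)).2

@[simp] lemma extendZero_castAdd (s : EuclideanSpace ℝ (Fin d)) (i : Fin d) :
    extendZero q s (Fin.castAdd q i) = s i := by
  rw [extendZero, splitE_castAdd]
  simp [EuclideanSpace.inner_single_right]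

@[simp] lemma extendZero_natAdd (s : EuclideanSpace ℝ (Fin d)) (i : Fin q) :
    extendZero q s (Fin.natAdd d i) = 0 := by
  rw [extendZero, splitE_natAdd]
  simp

@[simp] lemma fstDelta_castAdd (i j : Fin d) :
    fstDelta d q (Fin.castAdd q i) (Fin.castAdd q j) = if i = j then 1 else 0 := by
  rw [fstDelta, splitE_castAdd, splitE_castAdd]
  simp [EuclideanSpace.inner_single_right, PiLp.single_apply, eq_comm]

@[simp] lemma fstDelta_natAdd_left (i : Fin q) (j : Fin (d + q)) :
    fstDelta d q (Fin.natAdd d i) j = 0 := by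
  rw [fstDelta, splitE_natAdd]
  simp

@[simp] lemma fstDelta_natAdd_right (i : Fin (d + q)) (j : Fin q) :
    fstDelta d q i (Fin.natAdd d j) = 0 := by
  rw [fstDelta, splitE_natAdd]
  simp

@[simp] lemma sndDelta_natAdd (i j : Fin q) :
    sndDelta d q (Fin.natAdd d i) (Fin.natAdd d j) = if i = j then 1 else 0 := by
  rw [sndDelta, splitE_natAdd, splitE_natAdd]
  simp [EuclideanSpace.inner_single_right, PiLp.single_apply, eq_comm]

@[simp] lemma sndDelta_castAdd_left (i : Fin d) (j : Fin (d + q)) :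
    sndDelta d q (Fin.castAdd q i) j = 0 := by
  rw [sndDelta, splitE_castAdd]
  simp

@[simp] lemma sndDelta_castAdd_right (i : Fin (d + q)) (j : Fin d) :
    sndDelta d q i (Fin.castAdd q j) = 0 := by
  rw [sndDelta, splitE_castAdd]
  simp

lemma fstDelta_comm (i j : Fin (d + q)) : fstDelta d q i j = fstDelta d q j i :=
  real_inner_comm _ _

lemma sndDelta_comm (i j : Fin (d + q)) : sndDelta d q i j = sndDelta d q j i :=
  real_inner_comm _ _

/-- The first factor of `splitE`. -/
def splitFst (d q : ℕ) : EuclideanSpace ℝ (Fin (d + q)) →L[ℝ] EuclideanSpace ℝ (Fin d) :=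
  (ContinuousLinearMap.fst ℝ _ _).comp (splitE d q).toContinuousLinearMap

/-- The second factor of `splitE`. -/
def splitSnd (d q : ℕ) : EuclideanSpace ℝ (Fin (d + q)) →L[ℝ] EuclideanSpace ℝ (Fin q) :=
  (ContinuousLinearMap.snd ℝ _ _).comp (splitE d q).toContinuousLinearMap

/-- The derivative of `16/(t+4)²` at `0` is `-1/2`, and it multiplies the Hessian `2 δ`; the first
derivatives of `Q` vanish. -/
lemma hasJet_roundFactor {n : ℕ} {Q : EuclideanSpace ℝ (Fin n) → ℝ} {δ : Fin n → Fin n → ℝ}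
    (hQ : HasJet Q 0 0 fun i j => 2 * δ i j) :
    HasJet (fun y => 16 / (Q y + 4) ^ 2) 1 0 fun i j => -δ i j := by
  have hd : ∀ t : ℝ, t + 4 ≠ 0 →
      HasDerivAt (fun t : ℝ => 16 / (t + 4) ^ 2) (-32 / (t + 4) ^ 3) t := fun t ht => by
    have h := ((((hasDerivAt_id' t).add_const 4).fun_pow 2).fun_inv (pow_ne_zero 2 ht)).const_mul 16
    simp only [← div_eq_mul_inv] at h
    refine h.congr_deriv ?_
    simp
    field_simp
    norm_num
  have hs : ContDiffAt ℝ 2 (fun t : ℝ => 16 / (t + 4) ^ 2) 0 :=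
    contDiffAt_const.div ((contDiffAt_id.add contDiffAt_const).pow 2) (by norm_num)
  refine (hQ.comp hs).congr (by norm_num) (fun i => by simp) fun i j => ?_
  rw [(hd 0 (by norm_num)).deriv]
  simp
  ring

/-- The round metric has vanishing first derivatives at the centre of the chart, so the second
derivatives express `Hess z = -z g` for the height of the sphere. -/
lemma hasJet_height {n : ℕ} {Q L : EuclideanSpace ℝ (Fin n) → ℝ} {δ : Fin n → Fin n → ℝ}
    {σ : Fin n → ℝ} (hQ : HasJet Q 0 0 fun i j => 2 * δ i j) (hL : HasJet L 0 σ 0) (z : ℝ) :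
    HasJet (fun y => (4 * L y + (4 - Q y) * z) / (Q y + 4)) z σ fun i j => -z * δ i j := by
  have hd : ∀ t : ℝ, t + 4 ≠ 0 →
      HasDerivAt (fun t : ℝ => (t + 4)⁻¹) (-1 / (t + 4) ^ 2) t := fun t ht => by
    simpa using ((hasDerivAt_id t).add_const 4).fun_inv ht
  have hs : ContDiffAt ℝ 2 (fun t : ℝ => (t + 4)⁻¹) 0 :=
    (contDiffAt_id.add contDiffAt_const).inv (by norm_num)
  have h1 := ((hasJet_const 4).mul hL).add
    ((hasJet_const (4 * z)).add ((hasJet_const (-z)).mul hQ))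
  have h2 := (h1.mul (hQ.comp hs)).congr (f0' := z) (f1' := σ) (f2' := fun i j => -z * δ i j)
    (by ring) (fun i => by simp; ring) fun i j => by
      rw [(hd 0 (by norm_num)).deriv]
      simp
      ring
  convert h2 using 2 with y
  rw [div_eq_mul_inv]
  ring

/-- The first derivatives of the coefficients of a warped product. -/
def warpedD1 (σ : Fin (d + q) → ℝ) (Θ' Ξ' : ℝ) (m i : Fin (d + q)) : ℝ :=
  Fin.addCases (motive := fun _ => ℝ) (fun _ => Θ' * σ i) (fun _ => Ξ' * σ i) m

/-- The second derivatives of the coefficients of a warped product. -/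
def warpedD2 (σ : Fin (d + q) → ℝ) (z Θ Ξ Θ' Ξ' Θ'' Ξ'' : ℝ) (m i j : Fin (d + q)) : ℝ :=
  Fin.addCases (motive := fun _ => ℝ)
    (fun _ => Θ'' * σ i * σ j - (Θ' * z + Θ) * fstDelta d q i j)
    (fun _ => Ξ'' * σ i * σ j - Ξ' * z * fstDelta d q i j - Ξ * sndDelta d q i j) m

/-- The values of the coefficients of a warped product. -/
def warpedD0 (d q : ℕ) (Θ Ξ : ℝ) (m : Fin (d + q)) : ℝ :=
  Fin.addCases (motive := fun _ => ℝ) (fun _ => Θ) (fun _ => Ξ) m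

/-- Each coefficient is a function of the height times a round conformal factor, so its jet follows
from the product and chain rules. The vector `s` is the gradient of the height, whence its norm. -/
lemma hasJet_warpedCoeff {Θ Ξ : ℝ → ℝ} (hΘ : IsWeight Θ) (hΞ : IsWeight Ξ) (p : Sph d) :
    ∃ s : EuclideanSpace ℝ (Fin d), ‖s‖ ^ 2 = 1 - height p ^ 2 ∧
      ∀ m, HasJet (warpedCoeff d q (chartHeight p) Θ Ξ m) (warpedD0 d q (Θ (height p))
        (Ξ (height p)) m)
        (warpedD1 (extendZero q s) (deriv Θ (height p)) (deriv Ξ (height p)) m)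
        (warpedD2 (extendZero q s) (height p) (Θ (height p)) (Ξ (height p)) (deriv Θ (height p))
          (deriv Ξ (height p)) (deriv (deriv Θ) (height p)) (deriv (deriv Ξ) (height p)) m) := by
  obtain ⟨s, hs, hz⟩ := exists_height_chartAt_symm d (northPole d) (norm_northPole d) p
  refine ⟨s, hs, fun m => ?_⟩
  have hQ1 : HasJet (fun y => ‖(splitE d q y).1‖ ^ 2) 0 0 fun i j => 2 * fstDelta d q i j :=
    hasJet_norm_sq (splitFst d q)
  have hQ2 : HasJet (fun y => ‖(splitE d q y).2‖ ^ 2) 0 0 fun i j => 2 * sndDelta d q i j :=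
    hasJet_norm_sq (splitSnd d q)
  have hL : HasJet (fun y => inner ℝ s (splitE d q y).1) 0 (extendZero q s) 0 :=
    hasJet_clm ((innerSL ℝ s).comp (splitFst d q))
  have hH : HasJet (fun y => chartHeight p (splitE d q y).1) (height p) (extendZero q s)
      fun i j => -height p * fstDelta d q i j := by
    have h := hasJet_height hQ1 hL (height p)
    convert h using 2 with y
    exact hz _
  have hm := height_mem p
  have h2 : (2 : WithTop ℕ∞) ≤ (∞ : ℕ∞ω) := WithTop.coe_le_coe.2 le_top
  have hA := hH.comp ((hΘ.contDiffAt _ hm).of_le h2)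
  have hB := hH.comp ((hΞ.contDiffAt _ hm).of_le h2)
  refine Fin.addCases (fun a => ?_) (fun a => ?_) m
  · have h := hA.mul (hasJet_roundFactor hQ1)
    simp only [warpedD0, Fin.addCases_left]
    convert h.congr (f0' := Θ (height p)) (by simp) (fun i => ?_) (fun i j => ?_) using 1
    · funext y
      simp [warpedCoeff]
    · simp [warpedD1]
    · simp [warpedD2]
      ring
  · have h := hB.mul (hasJet_roundFactor hQ2)
    simp only [warpedD0, Fin.addCases_right]
    convert h.congr (f0' := Ξ (height p)) (by simp) (fun i => ?_) (fun i j => ?_) using 1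
    · funext y
      simp [warpedCoeff]
    · simp [warpedD1]
    · simp [warpedD2]
      ring

lemma warpedD2_comm (σ : Fin (d + q) → ℝ) (z Θ Ξ Θ' Ξ' Θ'' Ξ'' : ℝ) (m i j : Fin (d + q)) :
    warpedD2 σ z Θ Ξ Θ' Ξ' Θ'' Ξ'' m i j = warpedD2 σ z Θ Ξ Θ' Ξ' Θ'' Ξ'' m j i := by
  refine Fin.addCases (fun a => ?_) (fun a => ?_) m
  · simp only [warpedD2, Fin.addCases_left, fstDelta_comm i j]
    ring
  · simp only [warpedD2, Fin.addCases_right, fstDelta_comm i j, sndDelta_comm i j]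
    ring

/-- Half the scalar curvature of a warped product with a surface as first factor. -/
lemma sum_jetCurvature_warped (s : EuclideanSpace ℝ (Fin 2)) {z Θ Ξ : ℝ} (Θ' Ξ' Θ'' Ξ'' : ℝ)
    (hs : ‖s‖ ^ 2 = 1 - z ^ 2) (hΘ : Θ ≠ 0) (hΞ : Ξ ≠ 0) :
    1 / 2 * ∑ a, ∑ b, (warpedD0 2 q Θ Ξ a)⁻¹ * (warpedD0 2 q Θ Ξ b)⁻¹ *
      jetCurvature (warpedD0 2 q Θ Ξ) (warpedD1 (extendZero q s) Θ' Ξ')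
        (warpedD2 (extendZero q s) z Θ Ξ Θ' Ξ' Θ'' Ξ'') a b a b =
      Θ⁻¹ * (1 - 1 / 2 * (Θ'' * (1 - z ^ 2) - 2 * z * Θ') / Θ + 1 / 2 * (Θ' / Θ) ^ 2 * (1 - z ^ 2) +
        q * (-(1 / 2) * (Ξ'' * (1 - z ^ 2) - 2 * z * Ξ') / Ξ +
          1 / 4 * (Ξ' / Ξ) ^ 2 * (1 - z ^ 2)) +
        q * (q - 1) / 2 * (Θ / Ξ - 1 / 4 * (Ξ' / Ξ) ^ 2 * (1 - z ^ 2))) := by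
  set R := jetCurvature (warpedD0 2 q Θ Ξ) (warpedD1 (extendZero q s) Θ' Ξ')
        (warpedD2 (extendZero q s) z Θ Ξ Θ' Ξ' Θ'' Ξ'') with hR
  have hs' : s 0 ^ 2 + s 1 ^ 2 = 1 - z ^ 2 := by
    rw [← hs, EuclideanSpace.norm_sq_eq, Fin.sum_univ_two]
    simp
  -- This uses `|∇z|² = 1 - z²`. With the trace of `Hess z = -z g` it accounts for the Laplacians
  -- `f''(1 - z²) - 2 z f'` in the result.
  have hsum : ∀ x y : ℝ, ∑ c, (warpedD0 2 q Θ Ξ c)⁻¹ *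
      (x * extendZero q s c * (y * extendZero q s c)) = Θ⁻¹ * x * y * (1 - z ^ 2) := fun x y => by
    rw [Fin.sum_univ_add, Fin.sum_univ_two, ← hs']
    simp [warpedD0]
    ring
  have h01 : R (Fin.castAdd q 0) (Fin.castAdd q 1) (Fin.castAdd q 0) (Fin.castAdd q 1) =
      -(1 / 2) * (Θ'' * (1 - z ^ 2) - 2 * (Θ' * z + Θ)) + 1 / 2 * Θ' ^ 2 * (1 - z ^ 2) / Θ := by
    have hne : (Fin.castAdd q (0 : Fin 2)) ≠ Fin.castAdd q 1 := by simp
    rw [hR, jetCurvature_pair _ _ _ hne]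
    simp only [warpedD1, warpedD2, Fin.addCases_left, hsum, extendZero_castAdd, fstDelta_castAdd]
    simp only [warpedD0, Fin.addCases_left, ← hs', if_true]
    field_simp
    ring
  have hmix : ∀ (a : Fin 2) (β : Fin q),
      R (Fin.castAdd q a) (Fin.natAdd 2 β) (Fin.castAdd q a) (Fin.natAdd 2 β) =
      -(1 / 2) * (Ξ'' * s a ^ 2 - Ξ' * z) + 1 / 4 * (Ξ' * s a) ^ 2 / Ξ +
        1 / 2 * (Θ' * Ξ' * s a ^ 2) / Θ - 1 / 4 * Θ' * Ξ' * (1 - z ^ 2) / Θ := fun a β => by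
    have hne : (Fin.castAdd q a) ≠ Fin.natAdd 2 β := by
      rw [Ne, Fin.ext_iff, Fin.val_castAdd, Fin.val_natAdd]; omega
    rw [hR, jetCurvature_pair _ _ _ hne]
    simp only [warpedD1, warpedD2, Fin.addCases_left, Fin.addCases_right, hsum,
      extendZero_castAdd, fstDelta_castAdd, extendZero_natAdd, fstDelta_natAdd_left,
      sndDelta_castAdd_left]
    simp only [warpedD0, Fin.addCases_left, Fin.addCases_right, if_true]
    field_simp
    ring
  have hmix' : ∀ (a : Fin 2) (β : Fin q),
      R (Fin.natAdd 2 β) (Fin.castAdd q a) (Fin.natAdd 2 β) (Fin.castAdd q a) =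
      R (Fin.castAdd q a) (Fin.natAdd 2 β) (Fin.castAdd q a) (Fin.natAdd 2 β) := fun a β =>
    jetCurvature_swap_swap _ _ (warpedD2_comm _ _ _ _ _ _ _ _) _ _ _ _
  have h10 : R (Fin.castAdd q 1) (Fin.castAdd q 0) (Fin.castAdd q 1) (Fin.castAdd q 0) =
      R (Fin.castAdd q 0) (Fin.castAdd q 1) (Fin.castAdd q 0) (Fin.castAdd q 1) :=
    jetCurvature_swap_swap _ _ (warpedD2_comm _ _ _ _ _ _ _ _) _ _ _ _
  have hsnd : ∀ β γ : Fin q, R (Fin.natAdd 2 β) (Fin.natAdd 2 γ) (Fin.natAdd 2 β) (Fin.natAdd 2 γ) =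
      if β = γ then 0 else Ξ - 1 / 4 * Ξ' ^ 2 * (1 - z ^ 2) / Θ := fun β γ => by
    split_ifs with h
    · rw [h]
      exact jetCurvature_self _ _ _ _
    have hne : (Fin.natAdd 2 β) ≠ Fin.natAdd 2 γ := by simpa using h
    rw [hR, jetCurvature_pair _ _ _ hne]
    simp only [warpedD1, warpedD2, Fin.addCases_right, hsum,
      extendZero_natAdd, fstDelta_natAdd_left, sndDelta_natAdd, if_true]
    simp only [warpedD0, Fin.addCases_right]
    field_simp
    ring
  have hself : ∀ a, R a a a a = 0 := fun a => jetCurvature_self _ _ _ _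
  have hq : ∀ x : ℝ, ∑ β : Fin q, ∑ γ : Fin q, (if β = γ then 0 else x) = q * (q - 1) * x := by
    intro x
    have : ∀ β γ : Fin q, (if β = γ then 0 else x) = x - if β = γ then x else 0 := fun β γ => by
      split_ifs <;> simp
    simp only [this, Finset.sum_sub_distrib, Finset.sum_const, Finset.sum_ite_eq, Finset.mem_univ,
      if_true, Finset.card_univ, Fintype.card_fin, nsmul_eq_mul]
    ring
  simp only [Fin.sum_univ_add, Fin.sum_univ_two, hmix', h10, h01, hmix, hsnd, hself]
  simp only [warpedD0, Fin.addCases_left, Fin.addCases_right, ← Finset.mul_sum, hq,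
    Finset.sum_add_distrib, Finset.sum_const, Finset.card_univ, Fintype.card_fin, nsmul_eq_mul]
  have h1 : s 1 ^ 2 = 1 - z ^ 2 - s 0 ^ 2 := by rw [← hs']; ring
  rw [mul_pow, mul_pow, h1]
  field_simp
  ring
end warpedJets

/-! ### Lower bounds for the intermediate curvatures -/

section warpedCurvature
variable {d q : ℕ} {Y : Type} [TopologicalSpace Y] [ChartedSpace (EuclideanSpace ℝ (Fin q)) Y]
  {j : Y → EuclideanSpace ℝ (Fin (q + 1))} [IsManifold (𝓡 q) ∞ Y] [T2Space Y] [CompactSpace Y]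
  [ConnectedSpace Y]

/-- The chart at `p` sends `p` to the origin, so the curvature and the metric at `p` both depend
only on jets at the origin, with one vector `s` for both. -/
lemma exists_curvatureTensor_warpedProduct [ConnectedSpace (Sph d)] (hj : IsRound q j)
    {Θ Ξ : ℝ → ℝ} (hΘ : IsWeight Θ) (hΞ : IsWeight Ξ) (p : ProdSpace (Sph d) Y) :
    ∃ s : EuclideanSpace ℝ (Fin d), ‖s‖ ^ 2 = 1 - heightFst p ^ 2 ∧
    (∀ x y : TangentSpace (𝓡 (d + q)) p,
      (warpedProduct d hj hΘ hΞ).curvatureTensor p x y x y =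
      tensorValue (jetCurvature (warpedD0 d q (Θ (heightFst p)) (Ξ (heightFst p)))
        (warpedD1 (extendZero q s) (deriv Θ (heightFst p)) (deriv Ξ (heightFst p)))
        (warpedD2 (extendZero q s) (heightFst p) (Θ (heightFst p)) (Ξ (heightFst p))
          (deriv Θ (heightFst p)) (deriv Ξ (heightFst p)) (deriv (deriv Θ) (heightFst p))
          (deriv (deriv Ξ) (heightFst p))))
        (fun i => (show EuclideanSpace ℝ (Fin (d + q)) from x) i)
        (fun i => (show EuclideanSpace ℝ (Fin (d + q)) from y) i)) ∧
    ∀ x y : TangentSpace (𝓡 (d + q)) p, (warpedMetric d hj hΘ hΞ).inner p x y =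
      ∑ i, warpedD0 d q (Θ (heightFst p)) (Ξ (heightFst p)) i *
        ((show EuclideanSpace ℝ (Fin (d + q)) from x) i *
          (show EuclideanSpace ℝ (Fin (d + q)) from y) i) := by
  obtain ⟨s, hs, h⟩ := hasJet_warpedCoeff (q := q) hΘ hΞ p.1
  have hpos : ∀ m, warpedD0 d q (Θ (height p.1)) (Ξ (height p.1)) m ≠ 0 := fun m => by
    refine Fin.addCases (fun a => ?_) (fun a => ?_) m
    · simpa [warpedD0] using (hΘ.pos _ (height_mem p.1)).ne'
    · simpa [warpedD0] using (hΞ.pos _ (height_mem p.1)).ne'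
  refine ⟨s, hs, fun x y => ?_, fun x y => ?_⟩
  · have h0 : extChartAt (𝓡 (d + q)) p p = 0 := by
      change chartAt (EuclideanSpace ℝ (Fin (d + q))) p p = 0
      rw [chartAt_prod_apply, (isRound_sph d).chartAt_self, hj.chartAt_self]
      exact map_zero _
    have hg : (warpedProduct d hj hΘ hΞ).metricCoeff p =
        fun y => Matrix.diagonal fun i => warpedCoeff d q (chartHeight p.1) Θ Ξ i y :=
      funext fun y => warpedProduct_metricCoeff hj hΘ hΞ p y
    have hc : ∀ a b k l, curvatureCoeff ((warpedProduct d hj hΘ hΞ).metricCoeff p) a b k l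
        (extChartAt (𝓡 (d + q)) p p) = curvatureCoeff (fun y => Matrix.diagonal fun i =>
          warpedCoeff d q (chartHeight p.1) Θ Ξ i y) a b k l 0 := fun a b k l => by
      rw [hg, h0]
    exact Finset.sum_congr rfl fun a _ => Finset.sum_congr rfl fun b _ =>
      Finset.sum_congr rfl fun k _ => Finset.sum_congr rfl fun l _ =>
        congrArg (fun t => _ * t) ((hc a b k l).trans (curvatureCoeff_diagonal h hpos a b k l))
  · rw [warpedMetric_inner_chartAt]
    exact Finset.sum_congr rfl fun i _ => by rw [(h i).zero]; rfl

/-- Half the scalar curvature of a warped product `S² × Y` at height `z`. -/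
def halfScalar (q : ℕ) (Θ Ξ : ℝ → ℝ) (z : ℝ) : ℝ :=
  (Θ z)⁻¹ * (1 - 1 / 2 * (deriv (deriv Θ) z * (1 - z ^ 2) - 2 * z * deriv Θ z) / Θ z +
    1 / 2 * (deriv Θ z / Θ z) ^ 2 * (1 - z ^ 2) +
    q * (-(1 / 2) * (deriv (deriv Ξ) z * (1 - z ^ 2) - 2 * z * deriv Ξ z) / Ξ z +
      1 / 4 * (deriv Ξ z / Ξ z) ^ 2 * (1 - z ^ 2)) +
    q * (q - 1) / 2 * (Θ z / Ξ z - 1 / 4 * (deriv Ξ z / Ξ z) ^ 2 * (1 - z ^ 2)))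

/-- Here `n = q + 2`, so `C_{q+1}` is half the scalar curvature, the same for every frame. -/
theorem intermediateCurvatureGE_warpedProduct [ConnectedSpace (Sph 2)] (hj : IsRound q j)
    {Θ Ξ : ℝ → ℝ} (hΘ : IsWeight Θ) (hΞ : IsWeight Ξ) {c : ℝ}
    (h : ∀ z ∈ Set.Icc (-1 : ℝ) 1, c ≤ halfScalar q Θ Ξ z) :
    (warpedProduct 2 hj hΘ hΞ).IntermediateCurvatureGE (q + 1) c := by
  intro (p : ProdSpace (Sph 2) Y) e he
  obtain ⟨s, hs, hR, hg⟩ := exists_curvatureTensor_warpedProduct hj hΘ hΞ p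
  set z := heightFst p with hz
  have hz1 : z ∈ Set.Icc (-1 : ℝ) 1 := height_mem p.1
  have hΘ0 := (hΘ.pos z hz1).ne'
  have hΞ0 := (hΞ.pos z hz1).ne'
  refine (h z hz1).trans (le_of_eq ?_)
  have hW : ∀ a, warpedD0 2 q (Θ z) (Ξ z) a ≠ 0 := fun a => by
    refine Fin.addCases (fun a => ?_) (fun a => ?_) a <;> simpa [warpedD0]
  have he' : ∀ i k, ∑ a, warpedD0 2 q (Θ z) (Ξ z) a *
      ((show EuclideanSpace ℝ (Fin (2 + q)) from e i) a *
        (show EuclideanSpace ℝ (Fin (2 + q)) from e k) a) = if i = k then 1 else 0 :=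
    fun i k => (hg (e i) (e k)).symm.trans (he i k)
  rw [halfScalar, ← sum_jetCurvature_warped s _ _ _ _ hs hΘ0 hΞ0,
    ← sum_tensorValue hW he', ← two_mul_sum_lt (fun i k => tensorValue_comm
      (jetCurvature_swap_swap _ _ (warpedD2_comm _ _ _ _ _ _ _ _)) _ _)
      (fun i => tensorValue_self (jetCurvature_swap _ _ _) _),
    ← sum_lt_eq_of_succ (m := q + 1) (by omega), ← mul_assoc, one_div,
    inv_mul_cancel₀ two_ne_zero, one_mul]
  exact Finset.sum_congr rfl fun i _ => Finset.sum_congr rfl fun k _ => (hR _ _).symm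

lemma isWeight_const {c : ℝ} (hc : 0 < c) : IsWeight fun _ => c :=
  ⟨fun _ _ => contDiffAt_const, fun _ _ => hc⟩

/-- With constant weights the Christoffel symbols vanish at the centre and only second derivatives
of the round factors remain. -/
lemma jetCurvature_round (s : EuclideanSpace ℝ (Fin d)) (z c : ℝ) (a b k l : Fin (d + q)) :
    jetCurvature (warpedD0 d q c c) (warpedD1 (extendZero q s) 0 0)
      (warpedD2 (extendZero q s) z c c 0 0 0 0) a b k l =
      c * (fstDelta d q a k * fstDelta d q b l - fstDelta d q a l * fstDelta d q b k +
        (sndDelta d q a k * sndDelta d q b l - sndDelta d q a l * sndDelta d q b k)) := by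
  have h1 : ∀ a b k, lowChristoffel (warpedD1 (extendZero q s) 0 0) a b k = 0 := fun a b k => by
    have : ∀ m i, warpedD1 (extendZero q s) 0 0 m i = 0 := fun m i => by
      refine Fin.addCases (fun a => ?_) (fun a => ?_) m <;> simp [warpedD1]
    simp [lowChristoffel, metricD1, this]
  have h2 : ∀ i i' k l, metricD2 (warpedD2 (extendZero q s) z c c 0 0 0 0) i i' k l =
      -c * (fstDelta d q i i' * fstDelta d q k l + sndDelta d q i i' * sndDelta d q k l) := by
    intro i i' k l
    refine Fin.addCases (fun x => ?_) (fun x => ?_) k <;>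
      refine Fin.addCases (fun y => ?_) (fun y => ?_) l
    · simp [metricD2, warpedD2]
    · have : (Fin.castAdd q x) ≠ Fin.natAdd d y := by
        rw [Ne, Fin.ext_iff, Fin.val_castAdd, Fin.val_natAdd]; omega
      simp [metricD2, this]
    · have : (Fin.natAdd d x) ≠ Fin.castAdd q y := by
        rw [Ne, Fin.ext_iff, Fin.val_castAdd, Fin.val_natAdd]; omega
      simp [metricD2, this]
    · simp [metricD2, warpedD2]
  simp only [jetCurvature, h1, h2, fstDelta_comm b a, sndDelta_comm b a, fstDelta_comm l k,
    sndDelta_comm l k]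
  simp
  rw [fstDelta_comm b k, sndDelta_comm b k, fstDelta_comm b l, sndDelta_comm b l]
  ring

/-- Here `n = q + 3`, so `C_{q+1}` is half the scalar curvature, at least `3/c`, minus a single
sectional curvature, at most `1/c`. -/
theorem intermediateCurvatureGE_roundProduct [ConnectedSpace (Sph 3)] (hj : IsRound q j)
    {c : ℝ} (hc : 0 < c) :
    (warpedProduct 3 hj (isWeight_const hc) (isWeight_const hc)).IntermediateCurvatureGE (q + 1)
      (2 / c) := by
  intro (p : ProdSpace (Sph 3) Y) e he
  obtain ⟨s, hs, hR, hg⟩ :=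
    exists_curvatureTensor_warpedProduct hj (isWeight_const hc) (isWeight_const hc) p
  set z := heightFst p with hz
  have hd : deriv (fun _ : ℝ => c) = fun _ => 0 := by
    funext; simp
  simp only [hd, deriv_const] at hR
  have hD0 : ∀ a, warpedD0 3 q c c a = c := fun a => by
    refine Fin.addCases (fun a => ?_) (fun a => ?_) a <;> simp [warpedD0]
  have hW : ∀ a, warpedD0 3 q c c a ≠ 0 := fun a => by rw [hD0]; exact hc.ne'
  set E : Fin (3 + q) → Fin (3 + q) → ℝ :=
    fun i a => (show EuclideanSpace ℝ (Fin (3 + q)) from e i) a with hE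
  have he' : ∀ i k, ∑ a, warpedD0 3 q c c a * (E i a * E k a) = if i = k then 1 else 0 :=
    fun i k => (hg (e i) (e k)).symm.trans (he i k)
  set R := jetCurvature (warpedD0 3 q c c) (warpedD1 (extendZero q s) 0 0)
      (warpedD2 (extendZero q s) z c c 0 0 0 0) with hRdef
  -- The scalar curvature is `(6 + q(q-1))/c`; the part of the second factor is dropped.
  have hsum : 6 / c ≤ ∑ i, ∑ k, tensorValue R (E i) (E k) := by
    rw [sum_tensorValue hW he']
    have hq : ∑ β : Fin q, ∑ γ : Fin q, (1 - if β = γ then (1 : ℝ) else 0) = q * (q - 1) := by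
      simp only [Finset.sum_sub_distrib, Finset.sum_const, Finset.sum_ite_eq, Finset.mem_univ,
        if_true, Finset.card_univ, Fintype.card_fin, nsmul_eq_mul]
      ring
    have hq0 : (0 : ℝ) ≤ q * (q - 1) := by
      rcases Nat.eq_zero_or_pos q with rfl | h
      · simp
      · have : (1 : ℝ) ≤ q := by exact_mod_cast h
        exact mul_nonneg (by positivity) (by linarith)
    have hsq : ∀ P : Prop, [Decidable P] → (if P then (1 : ℝ) else 0) * (if P then (1 : ℝ) else 0) =
        if P then 1 else 0 := fun P _ => by split_ifs <;> simp
    have : ∑ a, ∑ b, (warpedD0 3 q c c a)⁻¹ * (warpedD0 3 q c c b)⁻¹ * R a b a b =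
        c⁻¹ * (6 + q * (q - 1)) := by
      rw [← hq]
      simp only [hD0, hRdef, jetCurvature_round, Fin.sum_univ_add, Fin.sum_univ_three,
        fstDelta_castAdd, fstDelta_natAdd_left, fstDelta_natAdd_right, sndDelta_natAdd,
        sndDelta_castAdd_left, sndDelta_castAdd_right]
      simp only [Fin.isValue, if_true, mul_one, mul_zero, sub_zero, add_zero, zero_add,
        Finset.sum_const_zero, eq_comm, hsq, ← Finset.mul_sum]
      simp
      field_simp
      ring
    rw [this, div_eq_inv_mul]
    gcongr
    linarith
  -- For orthonormal vectors the curvature is at most `c (x y + x' y')`, where `x, x'` and `y, y'`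
  -- are the squared Euclidean coordinate norms of the components, with `c (x + x') = c (y + y') =
  -- 1`.
  have hle : ∀ i k, i < k → tensorValue R (E i) (E k) ≤ 1 / c := by
    intro i k hik
    have hv : tensorValue R (E i) (E k) = c * ((∑ a : Fin 3, E i (Fin.castAdd q a) ^ 2) *
        (∑ a : Fin 3, E k (Fin.castAdd q a) ^ 2) -
        (∑ a : Fin 3, E i (Fin.castAdd q a) * E k (Fin.castAdd q a)) ^ 2 +
        ((∑ a : Fin q, E i (Fin.natAdd 3 a) ^ 2) * (∑ a : Fin q, E k (Fin.natAdd 3 a) ^ 2) -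
        (∑ a : Fin q, E i (Fin.natAdd 3 a) * E k (Fin.natAdd 3 a)) ^ 2)) := by
      have hpoly : ∀ (A B : Fin (3 + q) → Fin (3 + q) → ℝ) (x y : Fin (3 + q) → ℝ),
          ∑ a, ∑ b, ∑ k, ∑ l, x a * y b * x k * y l * (A a k * B b l) =
          (∑ a, ∑ k, x a * x k * A a k) * ∑ b, ∑ l, y b * y l * B b l := by
        intro A B x y
        rw [Finset.sum_mul_sum]
        refine Finset.sum_congr rfl fun a _ => Finset.sum_congr rfl fun b _ => ?_
        rw [Finset.sum_mul_sum]
        exact Finset.sum_congr rfl fun k _ => Finset.sum_congr rfl fun l _ => by ring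
      have hpoly' : ∀ (A B : Fin (3 + q) → Fin (3 + q) → ℝ) (x y : Fin (3 + q) → ℝ),
          ∑ a, ∑ b, ∑ k, ∑ l, x a * y b * x k * y l * (A a l * B b k) =
          (∑ a, ∑ l, x a * y l * A a l) * ∑ b, ∑ k, y b * x k * B b k := by
        intro A B x y
        rw [Finset.sum_mul_sum]
        refine Finset.sum_congr rfl fun a _ => Finset.sum_congr rfl fun b _ => ?_
        rw [Finset.sum_mul_sum, Finset.sum_comm]
        exact Finset.sum_congr rfl fun k _ => Finset.sum_congr rfl fun l _ => by ring
      have hf : ∀ x y : Fin (3 + q) → ℝ, ∑ a, ∑ k, x a * y k * fstDelta 3 q a k =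
          ∑ a : Fin 3, x (Fin.castAdd q a) * y (Fin.castAdd q a) := fun x y => by
        rw [Fin.sum_univ_add]
        simp only [fstDelta_natAdd_left, mul_zero, Finset.sum_const_zero, add_zero]
        refine Finset.sum_congr rfl fun a _ => ?_
        rw [Fin.sum_univ_add]
        simp
      have hs : ∀ x y : Fin (3 + q) → ℝ, ∑ a, ∑ k, x a * y k * sndDelta 3 q a k =
          ∑ a : Fin q, x (Fin.natAdd 3 a) * y (Fin.natAdd 3 a) := fun x y => by
        rw [Fin.sum_univ_add]
        simp only [sndDelta_castAdd_left, mul_zero, Finset.sum_const_zero, zero_add]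
        refine Finset.sum_congr rfl fun a _ => ?_
        rw [Fin.sum_univ_add]
        simp
      rw [tensorValue]
      simp only [hRdef, jetCurvature_round, mul_left_comm _ c, ← Finset.mul_sum]
      congr 1
      simp only [mul_add, mul_sub, Finset.sum_add_distrib, Finset.sum_sub_distrib, hpoly, hpoly',
        hf, hs, pow_two]
      simp only [mul_comm (E k _) (E i _)]
    have hn : ∀ i, c * (∑ a : Fin 3, E i (Fin.castAdd q a) ^ 2 +
        ∑ a : Fin q, E i (Fin.natAdd 3 a) ^ 2) = 1 := fun i => by
      have := he' i i
      simp only [hD0, if_true, ← Finset.mul_sum, Fin.sum_univ_add, ← pow_two] at this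
      exact this
    have h0 : ∀ i, 0 ≤ ∑ a : Fin 3, E i (Fin.castAdd q a) ^ 2 :=
      fun i => Finset.sum_nonneg fun a _ => sq_nonneg _
    have h0' : ∀ i, 0 ≤ ∑ a : Fin q, E i (Fin.natAdd 3 a) ^ 2 :=
      fun i => Finset.sum_nonneg fun a _ => sq_nonneg _
    have hi := hn i
    have hk := hn k
    have hi0 := h0 i
    have hk0 := h0 k
    have hi0' := h0' i
    have hk0' := h0' k
    rw [hv, le_div_iff₀ hc]
    generalize ∑ a : Fin 3, E i (Fin.castAdd q a) ^ 2 = x at *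
    generalize ∑ a : Fin 3, E k (Fin.castAdd q a) ^ 2 = y at *
    generalize ∑ a : Fin q, E i (Fin.natAdd 3 a) ^ 2 = x' at *
    generalize ∑ a : Fin q, E k (Fin.natAdd 3 a) ^ 2 = y' at *
    generalize ∑ a : Fin 3, E i (Fin.castAdd q a) * E k (Fin.castAdd q a) = u
    generalize ∑ a : Fin q, E i (Fin.natAdd 3 a) * E k (Fin.natAdd 3 a) = v
    have h1 : c ^ 2 * ((x + x') * (y + y')) = 1 := by
      calc c ^ 2 * ((x + x') * (y + y')) = (c * (x + x')) * (c * (y + y')) := by ring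
        _ = 1 := by rw [hi, hk, one_mul]
    have h2 : 0 ≤ c ^ 2 * (x * y' + x' * y + u ^ 2 + v ^ 2) := by positivity
    nlinarith
  have hsymm : ∀ i k, tensorValue R (E i) (E k) = tensorValue R (E k) (E i) := fun i k =>
    tensorValue_comm (jetCurvature_swap_swap _ _ (warpedD2_comm _ _ _ _ _ _ _ _)) _ _
  have htwo := two_mul_sum_lt hsymm fun i => tensorValue_self (jetCurvature_swap _ _ _) _
  have hfin := sum_lt_ge_of_succ_succ (m := q + 1) (by omega) hle
  have : (2 : ℝ) / c = 6 / c / 2 - 1 / c := by ring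
  have heq : (warpedProduct 3 hj (isWeight_const hc) (isWeight_const hc)).intermediateCurvature
      (q + 1) p e = ∑ i : Fin (3 + q) with i.val < q + 1, ∑ k with i < k,
        tensorValue R (E i) (E k) :=
    Finset.sum_congr rfl fun i _ => Finset.sum_congr rfl fun k _ => hR _ _
  rw [heq]
  linarith
end warpedCurvature

/-! ### The homology class and the diameter of a slice -/

section sliceHomology
variable {q : ℕ} {Y : Type} [TopologicalSpace Y] [ChartedSpace (EuclideanSpace ℝ (Fin q)) Y]
  {j : Y → EuclideanSpace ℝ (Fin (q + 1))} [IsManifold (𝓡 q) ∞ Y] [T2Space Y] [CompactSpace Y]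
  [ConnectedSpace Y]

/-- Projection to the first factor retracts the product onto the slice. -/
lemma homologicallyNontrivial_warpedSlice (k : ℕ) [ConnectedSpace (Sph (k + 2))]
    (hj : IsRound q j) {Θ Ξ : ℝ → ℝ} (hΘ : IsWeight Θ) (hΞ : IsWeight Ξ) (y₀ : Y) :
    (warpedSlice (d := k + 2) hj hΘ hΞ y₀).HomologicallyNontrivial := by
  obtain ⟨μ, hμ, hμ0⟩ := exists_isFundamentalClass_sphere k
  let r : TopCat.of (warpedProduct (k + 2) hj hΘ hΞ).Carrier ⟶ TopCat.of (Sph (k + 2)) :=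
    TopCat.ofHom ⟨fun p : ProdSpace (Sph (k + 2)) Y => p.1, (contMDiff_prod_fst (d := k + 2) (q := q)).continuous⟩
  exact ⟨μ, hμ, singularHomology_map_ne_zero (warpedSlice (d := k + 2) hj hΘ hΞ y₀).inclusion r rfl
    (k + 2) hμ0⟩

lemma diam_warpedSlice {d : ℕ} [ConnectedSpace (Sph d)]
    (hj : IsRound q j) {Θ Ξ : ℝ → ℝ} (hΘ : IsWeight Θ) (hΞ : IsWeight Ξ) (y₀ : Y) :
    (warpedSlice (d := d) hj hΘ hΞ y₀).diam = (conformalSphere d hΘ).diam := rfl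
end sliceHomology

/-! ### Upper and lower bounds for Riemannian distances -/

section distance
open MeasureTheory
variable {n : ℕ} (M : ClosedRiemannianManifold n)

lemma ClosedRiemannianManifold.dist_triangle (x y z : M.Carrier) :
    M.dist x z ≤ M.dist x y + M.dist y z := by
  let _ : RiemannianBundle (fun x : M.Carrier => TangentSpace (𝓡 n) x) :=
    ⟨M.metric.toRiemannianMetric⟩
  exact riemannianEDist_triangle

lemma ClosedRiemannianManifold.dist_comm (x y : M.Carrier) : M.dist x y = M.dist y x := by
  let _ : RiemannianBundle (fun x : M.Carrier => TangentSpace (𝓡 n) x) :=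
    ⟨M.metric.toRiemannianMetric⟩
  exact riemannianEDist_comm

lemma ClosedRiemannianManifold.dist_le_lintegral {γ : ℝ → M.Carrier} {a b : ℝ} (hab : a ≤ b)
    (hγ : ContMDiff 𝓘(ℝ, ℝ) (𝓡 n) 1 γ) : M.dist (γ a) (γ b) ≤
      ∫⁻ t in Set.Icc a b, ENNReal.ofReal (Real.sqrt (M.metric.inner (γ t)
        (mfderiv 𝓘(ℝ, ℝ) (𝓡 n) γ t (1 : ℝ)) (mfderiv 𝓘(ℝ, ℝ) (𝓡 n) γ t (1 : ℝ)))) := by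
  let _ : RiemannianBundle (fun x : M.Carrier => TangentSpace (𝓡 n) x) :=
    ⟨M.metric.toRiemannianMetric⟩
  refine (riemannianEDist_le_pathELength hγ.contMDiffOn rfl rfl hab).trans_eq ?_
  rw [pathELength_eq_lintegral_mfderiv_Icc]
  refine lintegral_congr fun t => ?_
  rw [← ofReal_norm, norm_eq_sqrt_real_inner]
  rfl

/-- A function with gradient at most `1` does not increase lengths: `f ∘ γ` is a path in `ℝ` no
longer than `γ`, and on `ℝ` the Riemannian distance is the usual one. -/
lemma ClosedRiemannianManifold.le_dist_of_gradient_le {f : M.Carrier → ℝ}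
    (hf : ContMDiff (𝓡 n) 𝓘(ℝ, ℝ) 1 f)
    (h : ∀ x (v : TangentSpace (𝓡 n) x), (diffAt f x v) ^ 2 ≤ M.metric.inner x v v)
    (x y : M.Carrier) : ENNReal.ofReal |f x - f y| ≤ M.dist x y := by
  let _ : RiemannianBundle (fun x : M.Carrier => TangentSpace (𝓡 n) x) :=
    ⟨M.metric.toRiemannianMetric⟩
  refine le_of_forall_gt fun r hr => ?_
  obtain ⟨γ, h0, h1, hγ, hlen⟩ := exists_lt_of_riemannianEDist_lt hr
  refine lt_of_le_of_lt ?_ hlen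
  have hd : ENNReal.ofReal |f x - f y| = riemannianEDist 𝓘(ℝ, ℝ) (f x) (f y) := by
    rw [← IsRiemannianManifold.out, edist_dist, Real.dist_eq]
  have hfγ : ContMDiffOn 𝓘(ℝ, ℝ) 𝓘(ℝ, ℝ) 1 (f ∘ γ) (Set.Icc 0 1) := hf.comp_contMDiffOn hγ
  rw [hd]
  refine (riemannianEDist_le_pathELength hfγ (by simp [h0]) (by simp [h1]) zero_le_one).trans ?_
  rw [pathELength_eq_lintegral_mfderiv_Ioo, pathELength_eq_lintegral_mfderiv_Ioo]
  refine setLIntegral_mono' measurableSet_Ioo fun t ht => ?_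
  have hγt : MDifferentiableAt 𝓘(ℝ, ℝ) (𝓡 n) γ t :=
    ((hγ t ⟨ht.1.le, ht.2.le⟩).contMDiffAt (Icc_mem_nhds ht.1 ht.2)).mdifferentiableAt (by simp)
  have hc := congr($(mfderiv_comp t ((hf (γ t)).mdifferentiableAt (by simp)) hγt) (1 : ℝ))
  let r : ℝ := mfderiv 𝓘(ℝ, ℝ) 𝓘(ℝ, ℝ) (f ∘ γ) t (1 : ℝ)
  suffices hle : ‖r‖ ≤ ‖mfderiv 𝓘(ℝ, ℝ) (𝓡 n) γ t (1 : ℝ)‖ by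
    refine enorm_tangentSpace_vectorSpace.trans_le ?_
    change ‖r‖ₑ ≤ _
    rw [← ofReal_norm, ← ofReal_norm]
    exact ENNReal.ofReal_le_ofReal hle
  refine (Real.le_sqrt_of_sq_le ?_).trans_eq
    (norm_eq_sqrt_real_inner (mfderiv 𝓘(ℝ, ℝ) (𝓡 n) γ t (1 : ℝ))).symm
  refine le_trans (le_of_eq ?_) (h (γ t) (mfderiv 𝓘(ℝ, ℝ) (𝓡 n) γ t (1 : ℝ)))
  rw [Real.norm_eq_abs, sq_abs]
  exact congrArg (fun t : ℝ => t ^ 2) hc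
end distance

/-! ### Meridians of the sphere -/

section meridian
open MeasureTheory
open scoped EuclideanSpace
variable {d : ℕ}

/-- The great circle through the north pole in the direction of `u`. -/
def meridian (u : EuclideanSpace ℝ (Fin (d + 1))) (hu : ‖u‖ = 1)
    (hu' : inner ℝ u (northPole d) = 0) (t : ℝ) : Sph d :=
  ⟨Real.cos t • northPole d + Real.sin t • u, by
    rw [mem_sphere_zero_iff_norm, ← sq_eq_sq₀ (norm_nonneg _) zero_le_one, norm_add_sq_real,
      norm_smul, norm_smul, norm_northPole, hu, inner_smul_left, inner_smul_right,
      real_inner_comm, hu', Real.norm_eq_abs, Real.norm_eq_abs, mul_one, mul_one, sq_abs, sq_abs]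
    simp⟩

variable {u : EuclideanSpace ℝ (Fin (d + 1))} (hu : ‖u‖ = 1)
    (hu' : inner ℝ u (northPole d) = 0)

lemma meridian_val (t : ℝ) : (meridian u hu hu' t).1 = Real.cos t • northPole d + Real.sin t • u :=
  rfl

lemma height_meridian (t : ℝ) : height (meridian u hu hu' t) = Real.cos t := by
  rw [height, meridian, inner_add_left, inner_smul_left, inner_smul_left, hu',
    real_inner_self_eq_norm_sq, norm_northPole]
  simp

lemma contMDiff_meridian : ContMDiff 𝓘(ℝ, ℝ) (𝓡 d) ∞ (meridian u hu hu') := by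
  have h : ContDiff ℝ ∞ fun t : ℝ => Real.cos t • northPole d + Real.sin t • u :=
    (Real.contDiff_cos.smul contDiff_const).add (Real.contDiff_sin.smul contDiff_const)
  exact h.contMDiff.codRestrict_sphere fun t => (meridian u hu hu' t).2

lemma norm_diffAt_mfderiv_meridian (t : ℝ) :
    ‖diffAt (Subtype.val : Sph d → EuclideanSpace ℝ (Fin (d + 1))) (meridian u hu hu' t)
      (mfderiv 𝓘(ℝ, ℝ) (𝓡 d) (meridian u hu hu') t (1 : ℝ))‖ = 1 := by
  have h1 : HasDerivAt (fun t : ℝ => Real.cos t • northPole d + Real.sin t • u)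
      (-Real.sin t • northPole d + Real.cos t • u) t :=
    ((Real.hasDerivAt_cos t).smul_const _).add ((Real.hasDerivAt_sin t).smul_const _)
  have h2 := congr($(mfderiv_comp t
    (((isRound_sph d).contMDiff (meridian u hu hu' t)).mdifferentiableAt (by simp))
    ((contMDiff_meridian hu hu' t).mdifferentiableAt (by simp))) (1 : ℝ))
  have h3 : diffAt (Subtype.val : Sph d → EuclideanSpace ℝ (Fin (d + 1))) (meridian u hu hu' t)
      (mfderiv 𝓘(ℝ, ℝ) (𝓡 d) (meridian u hu hu') t (1 : ℝ)) =
      -Real.sin t • northPole d + Real.cos t • u := by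
    refine h2.symm.trans ?_
    rw [mfderiv_eq_fderiv]
    exact congr($(h1.hasFDerivAt.fderiv) (1 : ℝ)).trans (one_smul ℝ _)
  rw [h3, ← sq_eq_sq₀ (norm_nonneg _) zero_le_one, norm_add_sq_real,
      norm_smul, norm_smul, norm_northPole, hu, inner_smul_left, inner_smul_right,
      real_inner_comm, hu', Real.norm_eq_abs, Real.norm_eq_abs, mul_one, mul_one, sq_abs, sq_abs]
  simp

lemma exists_meridian_eq (hd : 0 < d) (p : Sph d) :
    ∃ (u : EuclideanSpace ℝ (Fin (d + 1))) (hu : ‖u‖ = 1) (hu' : inner ℝ u (northPole d) = 0),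
      meridian u hu hu' (Real.arccos (height p)) = p := by
  have hm := height_mem p
  have hc : Real.cos (Real.arccos (height p)) = height p := Real.cos_arccos hm.1 hm.2
  have hs : Real.sin (Real.arccos (height p)) = Real.sqrt (1 - height p ^ 2) := Real.sin_arccos _
  set w : EuclideanSpace ℝ (Fin (d + 1)) := p.1 - height p • northPole d with hw
  have hw1 : inner ℝ w (northPole d) = 0 := by
    rw [hw, inner_sub_left, inner_smul_left, real_inner_self_eq_norm_sq, norm_northPole, height]
    simp
  have hw2 : ‖w‖ = Real.sqrt (1 - height p ^ 2) := by
    have h : ‖w‖ ^ 2 = 1 - height p ^ 2 := by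
      rw [hw, norm_sub_sq_real, inner_smul_right, norm_smul, norm_northPole,
        norm_eq_of_mem_sphere p, Real.norm_eq_abs, mul_one, sq_abs, height]
      ring
    rw [← h, Real.sqrt_sq (norm_nonneg _)]
  by_cases h0 : w = 0
  -- At a pole every meridian passes through `p`, so any horizontal direction serves.
  · refine ⟨EuclideanSpace.single ⟨1, by omega⟩ 1, by simp, ?_, ?_⟩
    · rw [northPole, EuclideanSpace.inner_single_right]
      simp [Fin.ext_iff]
    · refine Subtype.ext ?_
      rw [h0, norm_zero] at hw2
      rw [meridian_val, hc, hs, ← hw2, zero_smul, add_zero]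
      exact (sub_eq_zero.1 h0).symm
  · have hn : ‖w‖ ≠ 0 := norm_ne_zero_iff.2 h0
    refine ⟨‖w‖⁻¹ • w, by rw [norm_smul, norm_inv, norm_norm, inv_mul_cancel₀ hn], by
      rw [inner_smul_left, hw1, mul_zero], Subtype.ext ?_⟩
    rw [meridian_val, hc, hs, ← hw2, smul_smul, mul_inv_cancel₀ hn, one_smul, hw]
    abel
end meridian

/-! ### The diameter of a rotationally symmetric sphere -/

section diameter
open MeasureTheory
open scoped EuclideanSpace
variable {d : ℕ} {Θ : ℝ → ℝ} (hΘ : IsWeight Θ)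

lemma conformalSphere_inner [ConnectedSpace (Sph d)] (p : Sph d) (v w : TangentSpace (𝓡 d) p) :
    (conformalSphere d hΘ).metric.inner p v w =
      Θ (height p) * inner ℝ (diffAt (Subtype.val : Sph d → EuclideanSpace ℝ (Fin (d + 1))) p v)
        (diffAt (Subtype.val : Sph d → EuclideanSpace ℝ (Fin (d + 1))) p w) :=
  conformalMetric_inner hΘ p v w

lemma inner_diffAt_val (p : Sph d) (v : TangentSpace (𝓡 d) p) :
    inner ℝ p.1 (diffAt (Subtype.val : Sph d → EuclideanSpace ℝ (Fin (d + 1))) p v) = 0 := by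
  have h : (diffAt (Subtype.val : Sph d → EuclideanSpace ℝ (Fin (d + 1))) p v) ∈
      (Submodule.span ℝ {p.1})ᗮ := by
    rw [← range_mvfderiv_subtypeVal (n := d) p]
    exact ⟨v, rfl⟩
  exact Submodule.mem_orthogonal_singleton_iff_inner_right.1 h

lemma diffAt_height (p : Sph d) (v : TangentSpace (𝓡 d) p) : diffAt height p v =
    inner ℝ (diffAt (Subtype.val : Sph d → EuclideanSpace ℝ (Fin (d + 1))) p v) (northPole d) := by
  have h1 : HasFDerivAt (fun x : EuclideanSpace ℝ (Fin (d + 1)) => inner ℝ x (northPole d))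
      (innerSL ℝ (northPole d)) p.1 := by
    have := (innerSL ℝ (northPole d)).hasFDerivAt (x := p.1)
    simpa [real_inner_comm] using this
  have h2 := congr($(mfderiv_comp p (g := fun x : EuclideanSpace ℝ (Fin (d + 1)) =>
    inner ℝ x (northPole d)) h1.differentiableAt.mdifferentiableAt
    (((isRound_sph d).contMDiff p).mdifferentiableAt (by simp))) v)
  refine h2.trans ?_
  rw [mfderiv_eq_fderiv, h1.fderiv]
  exact real_inner_comm (diffAt (Subtype.val : Sph d → EuclideanSpace ℝ (Fin (d + 1))) p v)
    (northPole d)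

/-- The gradient of the height is the tangential part of the north pole, of squared norm `1 - z²`;
the rest is Cauchy–Schwarz. -/
lemma sq_diffAt_height_le (p : Sph d) (v : TangentSpace (𝓡 d) p) : (diffAt height p v) ^ 2 ≤
    (1 - height p ^ 2) *
      ‖diffAt (Subtype.val : Sph d → EuclideanSpace ℝ (Fin (d + 1))) p v‖ ^ 2 := by
  set w := diffAt (Subtype.val : Sph d → EuclideanSpace ℝ (Fin (d + 1))) p v with hw
  have h1 : diffAt height p v = inner ℝ w (northPole d - height p • p.1) := by
    rw [diffAt_height, inner_sub_right, inner_smul_right, real_inner_comm w p.1 |>.symm,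
      inner_diffAt_val, mul_zero, sub_zero]
  have h2 : ‖northPole d - height p • p.1‖ ^ 2 = 1 - height p ^ 2 := by
    rw [norm_sub_sq_real, inner_smul_right, norm_smul, norm_northPole,
      norm_eq_of_mem_sphere p, Real.norm_eq_abs, mul_one, sq_abs, height, real_inner_comm]
    ring
  rw [h1, ← h2, ← mul_pow, mul_comm, ← sq_abs]
  exact pow_le_pow_left₀ (abs_nonneg _) (abs_real_inner_le_norm _ _) 2

/-- The function `σ` of the height describes `a` times the round sphere along the meridians: the
distance to the north pole is `a arccos σ`. -/
structure IsProfile (Θ σ : ℝ → ℝ) (a : ℝ) : Prop where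
  pos : 0 < a
  contDiffAt : ∀ z ∈ Set.Icc (-1 : ℝ) 1, ContDiffAt ℝ ∞ σ z
  one : σ 1 = 1
  neg_one : σ (-1) = -1
  deriv_pos : ∀ z ∈ Set.Icc (-1 : ℝ) 1, 0 < deriv σ z
  eq : ∀ z ∈ Set.Icc (-1 : ℝ) 1, a ^ 2 * deriv σ z ^ 2 * (1 - z ^ 2) = Θ z * (1 - σ z ^ 2)

variable {σ : ℝ → ℝ} {a : ℝ}

lemma IsProfile.strictMonoOn (hσ : IsProfile Θ σ a) : StrictMonoOn σ (Set.Icc (-1) 1) :=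
  strictMonoOn_of_deriv_pos (convex_Icc _ _)
    (fun z hz => (hσ.contDiffAt z hz).continuousAt.continuousWithinAt)
    fun z hz => hσ.deriv_pos z (interior_subset hz)

lemma IsProfile.mem_Icc (hσ : IsProfile Θ σ a) {z : ℝ} (hz : z ∈ Set.Icc (-1 : ℝ) 1) :
    σ z ∈ Set.Icc (-1 : ℝ) 1 :=
  ⟨hσ.neg_one ▸ hσ.strictMonoOn.monotoneOn (by simp) hz hz.1,
    hσ.one ▸ hσ.strictMonoOn.monotoneOn hz (by simp) hz.2⟩

lemma IsProfile.mem_Ioo (hσ : IsProfile Θ σ a) {z : ℝ} (hz : z ∈ Set.Ioo (-1 : ℝ) 1) :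
    σ z ∈ Set.Ioo (-1 : ℝ) 1 :=
  ⟨hσ.neg_one ▸ hσ.strictMonoOn (by simp) ⟨hz.1.le, hz.2.le⟩ hz.1,
    hσ.one ▸ hσ.strictMonoOn ⟨hz.1.le, hz.2.le⟩ (by simp) hz.2⟩

/-- The profile equation says that `a arccos σ(cos φ)` is a primitive of `√Θ(cos φ)`.
Differentiability fails at the poles, where continuity is enough. -/
lemma lintegral_sqrt_weight (hΘ : IsWeight Θ) (hσ : IsProfile Θ σ a) {s t : ℝ} (hs : 0 ≤ s) (hst : s ≤ t) (ht : t ≤ Real.pi) :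
    ∫⁻ φ in Set.Icc s t, ENNReal.ofReal (Real.sqrt (Θ (Real.cos φ))) =
      ENNReal.ofReal (a * Real.arccos (σ (Real.cos t)) - a * Real.arccos (σ (Real.cos s))) := by
  have hcos : ∀ φ, Real.cos φ ∈ Set.Icc (-1 : ℝ) 1 := Real.cos_mem_Icc
  have hcont : Continuous fun φ => Real.sqrt (Θ (Real.cos φ)) :=
    Real.continuous_sqrt.comp (continuous_iff_continuousAt.2 fun φ =>
      ContinuousAt.comp (hΘ.contDiffAt _ (hcos φ)).continuousAt Real.continuous_cos.continuousAt)
  have hcont' : Continuous fun φ => a * Real.arccos (σ (Real.cos φ)) :=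
    continuous_const.mul (Real.continuous_arccos.comp (continuous_iff_continuousAt.2 fun φ =>
      ContinuousAt.comp (hσ.contDiffAt _ (hcos φ)).continuousAt Real.continuous_cos.continuousAt))
  have hder : ∀ φ ∈ Set.Ioo s t, HasDerivAt (fun φ => a * Real.arccos (σ (Real.cos φ)))
      (Real.sqrt (Θ (Real.cos φ))) φ := fun φ hφ => by
    have hsin : 0 < Real.sin φ := Real.sin_pos_of_pos_of_lt_pi (hs.trans_lt hφ.1) (hφ.2.trans_le ht)
    have hc : Real.cos φ ∈ Set.Ioo (-1 : ℝ) 1 := by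
      have := Real.sin_sq_add_cos_sq φ
      constructor <;> nlinarith [hcos φ |>.1, hcos φ |>.2]
    have hz := hσ.mem_Ioo hc
    have hpos : 0 < 1 - σ (Real.cos φ) ^ 2 := by nlinarith [hz.1, hz.2]
    have h1 := (((Real.hasDerivAt_arccos hz.1.ne' hz.2.ne).comp φ
      (((hσ.contDiffAt _ (hcos φ)).differentiableAt (by simp)).hasDerivAt.comp φ
        (Real.hasDerivAt_cos φ))).const_mul a)
    refine h1.congr_deriv ?_
    have h2 : Θ (Real.cos φ) = (a * deriv σ (Real.cos φ) * Real.sin φ /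
        Real.sqrt (1 - σ (Real.cos φ) ^ 2)) ^ 2 := by
      rw [div_pow, Real.sq_sqrt hpos.le, eq_div_iff hpos.ne', ← hσ.eq _ (hcos φ), ← Real.sin_sq]
      ring
    rw [h2, Real.sqrt_sq (div_nonneg (mul_nonneg (mul_nonneg hσ.pos.le (hσ.deriv_pos _ (hcos φ)).le) hsin.le)
      (Real.sqrt_nonneg _))]
    ring
  rw [← intervalIntegral.integral_eq_sub_of_hasDerivAt_of_le hst hcont'.continuousOn hder
    (hcont.intervalIntegrable _ _), intervalIntegral.integral_of_le hst,
    ← integral_Icc_eq_integral_Ioc, ofReal_integral_eq_lintegral_ofReal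
      hcont.continuousOn.integrableOn_Icc (Filter.Eventually.of_forall fun _ => Real.sqrt_nonneg _)]

lemma dist_meridian_le [ConnectedSpace (Sph d)] (hσ : IsProfile Θ σ a) {u : EuclideanSpace ℝ (Fin (d + 1))} (hu : ‖u‖ = 1)
    (hu' : inner ℝ u (northPole d) = 0) {s t : ℝ} (hs : 0 ≤ s) (hst : s ≤ t) (ht : t ≤ Real.pi) :
    (conformalSphere d hΘ).dist (meridian u hu hu' s) (meridian u hu hu' t) ≤
      ENNReal.ofReal (a * Real.arccos (σ (Real.cos t)) - a * Real.arccos (σ (Real.cos s))) := by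
  rw [← lintegral_sqrt_weight hΘ hσ hs hst ht]
  refine ((conformalSphere d hΘ).dist_le_lintegral hst
    ((contMDiff_meridian hu hu').of_le (by norm_num))).trans_eq (lintegral_congr fun φ => ?_)
  have hn := norm_diffAt_mfderiv_meridian hu hu' φ
  refine congrArg (fun r => ENNReal.ofReal (Real.sqrt r)) ((conformalSphere_inner hΘ _ _ _).trans
    ((congrArg₂ (fun x y => Θ x * y) (height_meridian hu hu' φ)
      ((real_inner_self_eq_norm_sq _).trans ?_)).trans (mul_one _)))
  exact (congrArg (fun x : ℝ => x ^ 2) hn).trans (one_pow 2)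

/-- The content is `κ² (1 - s²) ≤ 1 - κ² s²`, which holds since `κ ≤ 1`. -/
lemma sq_gradient_le {a κ s s' z t x y : ℝ} (hκ : 0 ≤ κ) (hκ' : κ ≤ 1) (ht : 0 ≤ t) (hy : 0 ≤ y)
    (he : a ^ 2 * s' ^ 2 * (1 - z ^ 2) = t * (1 - s ^ 2)) (hle : x ^ 2 ≤ (1 - z ^ 2) * y)
    (hpos : 0 < 1 - (κ * s) ^ 2) :
    (a * (1 / Real.sqrt (1 - (κ * s) ^ 2) * (κ * s')) * x) ^ 2 ≤ t * y := by
  have hD := Real.sq_sqrt hpos.le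
  have hkey : κ ^ 2 * (1 - s ^ 2) ≤ 1 - (κ * s) ^ 2 := by nlinarith
  have hexp : (a * (1 / Real.sqrt (1 - (κ * s) ^ 2) * (κ * s')) * x) ^ 2 =
      a ^ 2 * κ ^ 2 * s' ^ 2 * x ^ 2 / (1 - (κ * s) ^ 2) := by
    rw [mul_pow, mul_pow, mul_pow, div_pow, hD]
    ring
  rw [hexp, div_le_iff₀ hpos]
  calc a ^ 2 * κ ^ 2 * s' ^ 2 * x ^ 2 ≤ a ^ 2 * κ ^ 2 * s' ^ 2 * ((1 - z ^ 2) * y) := by gcongr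
    _ = t * y * (κ ^ 2 * (1 - s ^ 2)) := by linear_combination κ ^ 2 * y * he
    _ ≤ _ := mul_le_mul_of_nonneg_left hkey (mul_nonneg ht hy)

/-- Going through the north pole or through the south pole joins any two points, which bounds the
diameter above. A function with gradient at most `1` that nearly separates the poles by `a π` bounds
it below. -/
theorem diam_conformalSphere [ConnectedSpace (Sph d)] (hσ : IsProfile Θ σ a) (hd : 0 < d) :
    (conformalSphere d hΘ).diam = ENNReal.ofReal (a * Real.pi) := by
  have hn : northPole d ∈ Sph d := mem_sphere_zero_iff_norm.2 (norm_northPole d)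
  set N : Sph d := ⟨northPole d, hn⟩ with hN
  set S : Sph d := ⟨-northPole d, mem_sphere_zero_iff_norm.2 (by
    rw [norm_neg, norm_northPole])⟩ with hS
  have hhN : height N = 1 := by
    rw [height, real_inner_self_eq_norm_sq, norm_northPole, one_pow]
  have hhS : height S = -1 := by
    rw [height, inner_neg_left, real_inner_self_eq_norm_sq, norm_northPole, one_pow]
  have hpole : ∀ x : Sph d,
      (conformalSphere d hΘ).dist N x ≤ ENNReal.ofReal (a * Real.arccos (σ (height x))) ∧
      (conformalSphere d hΘ).dist x S ≤
        ENNReal.ofReal (a * Real.pi - a * Real.arccos (σ (height x))) := by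
    intro x
    obtain ⟨u, hu, hu', hx⟩ := exists_meridian_eq hd x
    have h0 : meridian u hu hu' 0 = N := Subtype.ext (by simp [meridian_val, hN])
    have hπ : meridian u hu hu' Real.pi = S := Subtype.ext (by simp [meridian_val, hS])
    have hm := height_mem x
    have hc : Real.cos (Real.arccos (height x)) = height x := Real.cos_arccos hm.1 hm.2
    have h1 := dist_meridian_le hΘ hσ hu hu' le_rfl
      (Real.arccos_nonneg (height x)) (Real.arccos_le_pi _)
    have h2 := dist_meridian_le hΘ hσ hu hu'
      (Real.arccos_nonneg (height x)) (Real.arccos_le_pi _) le_rfl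
    rw [h0, hx, hc, Real.cos_zero, hσ.one, Real.arccos_one, mul_zero, sub_zero] at h1
    rw [hπ, hx, hc, Real.cos_pi, hσ.neg_one, Real.arccos_neg_one] at h2
    exact ⟨h1, h2⟩
  refine le_antisymm (iSup_le fun (x : Sph d) => iSup_le fun (y : Sph d) => ?_) ?_
  · have hx := hpole x
    have hy := hpole y
    have hα : ∀ x : Sph d, 0 ≤ a * Real.arccos (σ (height x)) ∧
        0 ≤ a * Real.pi - a * Real.arccos (σ (height x)) := fun x =>
      ⟨mul_nonneg hσ.pos.le (Real.arccos_nonneg _), by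
        rw [← mul_sub]; exact mul_nonneg hσ.pos.le (sub_nonneg.2 (Real.arccos_le_pi _))⟩
    have hαx := hα x
    have hαy := hα y
    generalize a * Real.arccos (σ (height x)) = α at *
    generalize a * Real.arccos (σ (height y)) = β at *
    -- The bounds for the two routes add up to `2 a π`, so one of them is at most `a π`.
    rcases le_total (α + β) (a * Real.pi) with hle | hle
    · calc (conformalSphere d hΘ).dist x y
          ≤ (conformalSphere d hΘ).dist x N + (conformalSphere d hΘ).dist N y :=
            (conformalSphere d hΘ).dist_triangle x N y
        _ ≤ ENNReal.ofReal α + ENNReal.ofReal β := by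
            rw [(conformalSphere d hΘ).dist_comm x N]
            exact add_le_add hx.1 hy.1
        _ = ENNReal.ofReal (α + β) := (ENNReal.ofReal_add hαx.1 hαy.1).symm
        _ ≤ ENNReal.ofReal (a * Real.pi) := ENNReal.ofReal_le_ofReal hle
    · calc (conformalSphere d hΘ).dist x y
          ≤ (conformalSphere d hΘ).dist x S + (conformalSphere d hΘ).dist S y :=
            (conformalSphere d hΘ).dist_triangle x S y
        _ ≤ ENNReal.ofReal (a * Real.pi - α) + ENNReal.ofReal (a * Real.pi - β) := by
            rw [(conformalSphere d hΘ).dist_comm S y]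
            exact add_le_add hx.2 hy.2
        _ = ENNReal.ofReal (a * Real.pi - α + (a * Real.pi - β)) :=
            (ENNReal.ofReal_add hαx.2 hαy.2).symm
        _ ≤ ENNReal.ofReal (a * Real.pi) := ENNReal.ofReal_le_ofReal (by linarith)
  -- The function `a arcsin σ` would be exact but `arcsin` is not differentiable at `±1`; the factor
  -- `κ < 1` avoids this and tends to `1` afterwards.
  · have hκ : ∀ κ ∈ Set.Ioo (0 : ℝ) 1,
        ENNReal.ofReal (a * (2 * Real.arcsin κ)) ≤ (conformalSphere d hΘ).diam := by
      intro κ hκ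
      have hlt : ∀ z ∈ Set.Icc (-1 : ℝ) 1, κ * σ z ∈ Set.Ioo (-1 : ℝ) 1 := fun z hz => by
        have := hσ.mem_Icc hz
        constructor <;> nlinarith [this.1, this.2, hκ.1, hκ.2]
      have hG : ∀ z ∈ Set.Icc (-1 : ℝ) 1,
          ContDiffAt ℝ ∞ (fun z => a * Real.arcsin (κ * σ z)) z := fun z hz =>
        contDiffAt_const.mul (ContDiffAt.comp (g := Real.arcsin) (f := fun z => κ * σ z) z
          (Real.contDiffAt_arcsin (hlt z hz).1.ne' (hlt z hz).2.ne)
          (contDiffAt_const.mul (hσ.contDiffAt z hz)))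
      have hf : ContMDiff (𝓡 d) 𝓘(ℝ, ℝ) ∞
          fun p : Sph d => a * Real.arcsin (κ * σ (height p)) := fun p =>
        (hG _ (height_mem p)).contMDiffAt.comp p (contMDiff_height d p)
      have hle := (conformalSphere d hΘ).le_dist_of_gradient_le (hf.of_le (by norm_num)) ?_ N S
      · refine le_trans (le_of_eq ?_) (hle.trans (le_iSup_of_le N (le_iSup_of_le S le_rfl)))
        congr 1
        rw [hhN, hhS, hσ.one, hσ.neg_one, mul_one, mul_neg_one, Real.arcsin_neg, abs_of_nonneg]
        · ring
        · have := Real.arcsin_nonneg.2 hκ.1.le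
          have := mul_nonneg hσ.pos.le this
          linarith
      · intro (p : Sph d) v
        refine le_trans (b := Θ (height p) *
          ‖diffAt (Subtype.val : Sph d → EuclideanSpace ℝ (Fin (d + 1))) p v‖ ^ 2) ?_
          (le_of_eq ((conformalSphere_inner hΘ p v v).trans
            (congrArg _ (real_inner_self_eq_norm_sq _))).symm)
        have hz := height_mem p
        have hd1 : HasDerivAt (fun z => a * Real.arcsin (κ * σ z))
            (a * (1 / Real.sqrt (1 - (κ * σ (height p)) ^ 2) * (κ * deriv σ (height p))))
            (height p) :=
          (HasDerivAt.comp (h₂ := Real.arcsin) (h := fun z => κ * σ z) (height p)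
            (Real.hasDerivAt_arcsin (hlt _ hz).1.ne' (hlt _ hz).2.ne)
            (((hσ.contDiffAt _ hz).differentiableAt (by simp)).hasDerivAt.const_mul κ)).const_mul a
        have hd2 : diffAt (fun p : Sph d => a * Real.arcsin (κ * σ (height p))) p v =
            (a * (1 / Real.sqrt (1 - (κ * σ (height p)) ^ 2) * (κ * deriv σ (height p)))) *
              diffAt height p v := by
          have h2 := congr($(mfderiv_comp p hd1.differentiableAt.mdifferentiableAt
            ((contMDiff_height d p).mdifferentiableAt (by simp))) v)
          refine h2.trans ?_
          rw [mfderiv_eq_fderiv, hd1.hasFDerivAt.fderiv]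
          change (diffAt height p v : ℝ) * (_ : ℝ) = (_ : ℝ)
          exact mul_comm _ _
        have hle := sq_diffAt_height_le p v
        have hpos : 0 < 1 - (κ * σ (height p)) ^ 2 := by
          nlinarith [(hlt _ hz).1, (hlt _ hz).2]
        refine (congrArg (fun t : ℝ => t ^ 2) hd2).trans_le ?_
        exact sq_gradient_le hκ.1.le hκ.2.le (hΘ.pos _ hz).le (sq_nonneg _) (hσ.eq _ hz) hle hpos
    have ht : Tendsto (fun κ : ℝ => ENNReal.ofReal (a * (2 * Real.arcsin κ))) (𝓝[<] 1)
        (𝓝 (ENNReal.ofReal (a * Real.pi))) := by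
      have hc : Continuous fun κ : ℝ => ENNReal.ofReal (a * (2 * Real.arcsin κ)) :=
        ENNReal.continuous_ofReal.comp
          (continuous_const.mul (continuous_const.mul Real.continuous_arcsin))
      have := hc.tendsto 1
      rw [Real.arcsin_one, mul_div_cancel₀ _ (two_ne_zero' ℝ)] at this
      exact this.mono_left nhdsWithin_le_nhds
    refine le_of_tendsto ht ?_
    filter_upwards [Ioo_mem_nhdsLT (zero_lt_one' ℝ)] with κ h using hκ κ h
end diameter

/-! ### Change of variable between height and profile -/

section reparametrization

/-- `z` is an increasing smooth reparametrization of a neighbourhood of `[-1, 1]` fixing `-1` and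
`1`, and `m` is the inverse of its derivative. -/
structure IsReparam (b : ℝ) (z m : ℝ → ℝ) : Prop where
  one_lt : 1 < b
  contDiffAt : ∀ s ∈ Set.Ioo (-b) b, ContDiffAt ℝ ∞ z s
  hasDerivAt : ∀ s ∈ Set.Ioo (-b) b, HasDerivAt z (m s)⁻¹ s
  pos : ∀ s ∈ Set.Ioo (-b) b, 0 < m s
  one : z 1 = 1
  neg_one : z (-1) = -1

/-- The inverse of a reparametrization. -/
def reparamInv (b : ℝ) (z : ℝ → ℝ) : ℝ → ℝ := Function.invFunOn z (Set.Ioo (-b) b)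

variable {b : ℝ} {z m : ℝ → ℝ} (hz : IsReparam b z m)

namespace IsReparam

lemma mem_Ioo (hz : IsReparam b z m) {s : ℝ} (hs : s ∈ Set.Icc (-1 : ℝ) 1) :
    s ∈ Set.Ioo (-b) b := by
  have := hz.one_lt
  exact ⟨by linarith [hs.1], by linarith [hs.2]⟩

lemma strictMonoOn (hz : IsReparam b z m) : StrictMonoOn z (Set.Ioo (-b) b) := by
  refine strictMonoOn_of_deriv_pos (convex_Ioo _ _)
    (fun s hs => (hz.contDiffAt s hs).continuousAt.continuousWithinAt) fun s hs => ?_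
  rw [interior_Ioo] at hs
  rw [(hz.hasDerivAt s hs).deriv]
  exact inv_pos.2 (hz.pos s hs)

lemma inv_apply (hz : IsReparam b z m) {s : ℝ} (hs : s ∈ Set.Ioo (-b) b) :
    reparamInv b z (z s) = s :=
  hz.strictMonoOn.injOn.leftInvOn_invFunOn hs

/-- The inverse function theorem. The second clause allows identities known in the variable `s` to
be differentiated in the variable `z`. -/
lemma eventually_inv (hz : IsReparam b z m) {s : ℝ} (hs : s ∈ Set.Ioo (-b) b) :
    ContDiffAt ℝ ∞ (reparamInv b z) (z s) ∧
    ∀ᶠ y in 𝓝 (z s), ∃ s' ∈ Set.Ioo (-b) b, z s' = y := by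
  have hne : (m s)⁻¹ ≠ 0 := inv_ne_zero (hz.pos s hs).ne'
  have hd : HasFDerivAt z
      ((ContinuousLinearEquiv.unitsEquivAut ℝ (Units.mk0 _ hne) : ℝ ≃L[ℝ] ℝ) : ℝ →L[ℝ] ℝ) s := by
    refine (hz.hasDerivAt s hs).hasFDerivAt.congr_fderiv ?_
    ext
    simp
  have hn : (∞ : ℕ∞ω) ≠ 0 := by simp
  set e := (hz.contDiffAt s hs).toOpenPartialHomeomorph z hd hn with he
  have hes : s ∈ e.source := (hz.contDiffAt s hs).mem_toOpenPartialHomeomorph_source hd hn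
  have hze : ∀ t, e t = z t := fun t => rfl
  have hcd : ContDiffAt ℝ ∞ e.symm (z s) := (hz.contDiffAt s hs).to_localInverse hd hn
  have hsymm : e.symm (z s) = s := e.left_inv hes
  have h1 : ∀ᶠ y in 𝓝 (z s), e.symm y ∈ Set.Ioo (-b) b :=
    hcd.continuousAt.eventually (by rw [hsymm]; exact Ioo_mem_nhds hs.1 hs.2)
  have h2 : ∀ᶠ y in 𝓝 (z s), y ∈ e.target := e.open_target.mem_nhds (e.map_source hes)
  have h3 : ∀ᶠ y in 𝓝 (z s), e.symm y ∈ Set.Ioo (-b) b ∧ z (e.symm y) = y := by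
    filter_upwards [h1, h2] with y hy1 hy2 using ⟨hy1, e.right_inv hy2⟩
  refine ⟨hcd.congr_of_eventuallyEq ?_, h3.mono fun y hy => ⟨_, hy.1, hy.2⟩⟩
  filter_upwards [h3] with y hy
  conv_lhs => rw [← hy.2]
  exact hz.inv_apply hy.1

lemma hasDerivAt_inv (hz : IsReparam b z m) {s : ℝ} (hs : s ∈ Set.Ioo (-b) b) :
    HasDerivAt (reparamInv b z) (m s) (z s) := by
  have h1 := ((hz.eventually_inv hs).1.differentiableAt (by simp)).hasDerivAt
  have h2 := h1.comp s (hz.hasDerivAt s hs)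
  have h3 : (reparamInv b z ∘ z) =ᶠ[𝓝 s] id := by
    filter_upwards [Ioo_mem_nhds hs.1 hs.2] with t ht using hz.inv_apply ht
  have h4 := h2.unique ((hasDerivAt_id s).congr_of_eventuallyEq h3)
  have h5 : deriv (reparamInv b z) (z s) = m s := by
    have := (hz.pos s hs).ne'
    field_simp at h4
    exact h4
  rwa [h5] at h1

lemma hasDerivAt_comp_inv (hz : IsReparam b z m) {f : ℝ → ℝ} {f' s : ℝ}
    (hs : s ∈ Set.Ioo (-b) b) (hf : HasDerivAt f f' s) :
    HasDerivAt (fun y => f (reparamInv b z y)) (f' * m s) (z s) := by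
  have h := hz.hasDerivAt_inv hs
  have hf' : HasDerivAt f f' (reparamInv b z (z s)) := by rwa [hz.inv_apply hs]
  exact hf'.comp (z s) h

/-- Since `m = ds/dz`, differentiation in `z` is `m d/ds`, applied twice. -/
lemma deriv_deriv_comp_inv (hz : IsReparam b z m) {f f1 : ℝ → ℝ} {f2 m1 s : ℝ}
    (hs : s ∈ Set.Ioo (-b) b) (hf : ∀ s ∈ Set.Ioo (-b) b, HasDerivAt f (f1 s) s)
    (hf1 : HasDerivAt f1 f2 s) (hm : HasDerivAt m m1 s) :
    deriv (deriv fun y => f (reparamInv b z y)) (z s) = (f2 * m s + f1 s * m1) * m s := by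
  have h : (deriv fun y => f (reparamInv b z y)) =ᶠ[𝓝 (z s)]
      fun y => f1 (reparamInv b z y) * m (reparamInv b z y) := by
    filter_upwards [(hz.eventually_inv hs).2] with y hy
    obtain ⟨t, ht, rfl⟩ := hy
    rw [(hz.hasDerivAt_comp_inv ht (hf t ht)).deriv, hz.inv_apply ht]
  rw [h.deriv_eq]
  exact (hz.hasDerivAt_comp_inv hs (hf1.fun_mul hm)).deriv

lemma exists_eq (hz : IsReparam b z m) {y : ℝ} (hy : y ∈ Set.Icc (-1 : ℝ) 1) :
    ∃ s ∈ Set.Icc (-1 : ℝ) 1, z s = y := by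
  have hc : ContinuousOn z (Set.Icc (-1) 1) := fun s hs =>
    (hz.contDiffAt s (hz.mem_Ioo hs)).continuousAt.continuousWithinAt
  have := intermediate_value_Icc (by norm_num) hc
  rw [hz.one, hz.neg_one] at this
  exact this hy

lemma inv_mem (hz : IsReparam b z m) {y : ℝ} (hy : y ∈ Set.Icc (-1 : ℝ) 1) :
    reparamInv b z y ∈ Set.Icc (-1 : ℝ) 1 := by
  obtain ⟨s, hs, rfl⟩ := hz.exists_eq hy
  rwa [hz.inv_apply (hz.mem_Ioo hs)]

lemma isWeight (hz : IsReparam b z m) {f : ℝ → ℝ}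
    (hf : ∀ s ∈ Set.Icc (-1 : ℝ) 1, ContDiffAt ℝ ∞ f s) (hf0 : ∀ s ∈ Set.Icc (-1 : ℝ) 1, 0 < f s) :
    IsWeight fun y => f (reparamInv b z y) where
  contDiffAt y hy := by
    obtain ⟨s, hs, rfl⟩ := hz.exists_eq hy
    have h := hf s hs
    rw [← hz.inv_apply (hz.mem_Ioo hs)] at h
    exact h.comp (z s) (hz.eventually_inv (hz.mem_Ioo hs)).1
  pos y hy := hf0 _ (hz.inv_mem hy)

/-- With `s = cos τ`, the hypothesis `hX` makes the metric `a² (dτ² + β² sin² τ dφ²)`, whose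
meridians are those of a round sphere of radius `a`. -/
lemma isProfile (hz : IsReparam b z m) {β : ℝ → ℝ} {a : ℝ} (ha : 0 < a)
    (hX : ∀ s ∈ Set.Ioo (-b) b, (1 - z s ^ 2) * m s = (1 - s ^ 2) * β s) :
    IsProfile (fun y => a ^ 2 * β (reparamInv b z y) * m (reparamInv b z y)) (reparamInv b z) a where
  pos := ha
  contDiffAt y hy := by
    obtain ⟨s, hs, rfl⟩ := hz.exists_eq hy
    exact (hz.eventually_inv (hz.mem_Ioo hs)).1
  one := by
    conv_lhs => rw [← hz.one]
    exact hz.inv_apply (hz.mem_Ioo (by simp))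
  neg_one := by
    conv_lhs => rw [← hz.neg_one]
    exact hz.inv_apply (hz.mem_Ioo (by simp))
  deriv_pos y hy := by
    obtain ⟨s, hs, rfl⟩ := hz.exists_eq hy
    rw [(hz.hasDerivAt_inv (hz.mem_Ioo hs)).deriv]
    exact hz.pos s (hz.mem_Ioo hs)
  eq y hy := by
    obtain ⟨s, hs, rfl⟩ := hz.exists_eq hy
    rw [(hz.hasDerivAt_inv (hz.mem_Ioo hs)).deriv, hz.inv_apply (hz.mem_Ioo hs)]
    linear_combination a ^ 2 * m s * hX s (hz.mem_Ioo hs)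

/-- The half scalar curvature rewritten in the intrinsic variable `s`, in which `z` and `m`
disappear. The only loss is the nonnegative curvature of the second factor. -/
lemma halfScalar_ge (hz : IsReparam b z m) {β β1 β2 η η1 η2 : ℝ → ℝ} {a : ℝ} (ha : 0 < a) (q : ℕ)
    (hq : 1 ≤ q)
    (hm : ∀ s ∈ Set.Ioo (-b) b, ContDiffAt ℝ ∞ m s)
    (hβ0 : ∀ s ∈ Set.Ioo (-b) b, 0 < β s)
    (hβ : ∀ s ∈ Set.Ioo (-b) b, HasDerivAt β (β1 s) s)
    (hβ1 : ∀ s ∈ Set.Ioo (-b) b, HasDerivAt β1 (β2 s) s)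
    (hη : ∀ s ∈ Set.Ioo (-b) b, HasDerivAt η (η1 s) s)
    (hη1 : ∀ s ∈ Set.Ioo (-b) b, HasDerivAt η1 (η2 s) s)
    (hX : ∀ s ∈ Set.Ioo (-b) b, (1 - z s ^ 2) * m s = (1 - s ^ 2) * β s)
    {s : ℝ} (hs : s ∈ Set.Ioo (-b) b) :
    (a ^ 2 * β s)⁻¹ * (β s + 3 * s * β1 s - (1 - s ^ 2) * β2 s -
      q * (((1 - s ^ 2) * β1 s - 2 * s * β s) * η1 s + (1 - s ^ 2) * β s * η2 s) -
      q * (q + 1) / 2 * ((1 - s ^ 2) * β s * η1 s ^ 2)) ≤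
    halfScalar q (fun y => a ^ 2 * β (reparamInv b z y) * m (reparamInv b z y))
      (fun y => Real.exp (2 * η (reparamInv b z y))) (z s) := by
  have hm1 : ∀ s ∈ Set.Ioo (-b) b, HasDerivAt m (deriv m s) s := fun s hs =>
    ((hm s hs).differentiableAt (by simp)).hasDerivAt
  have hm2 : HasDerivAt (deriv m) (deriv (deriv m) s) s := by
    have h2 : ContDiffAt ℝ 1 (fun x => fderiv ℝ m x 1) s :=
      ((hm s hs).fderiv_right (m := 1) (WithTop.coe_le_coe.2 le_top)).clm_apply contDiffAt_const
    exact (h2.differentiableAt (by simp)).hasDerivAt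
  have hc : ∀ s : ℝ, HasDerivAt (fun s : ℝ => 1 - s ^ 2) (-(2 * s)) s := fun s => by
    simpa using ((hasDerivAt_id s).pow 2).const_sub 1
  -- Derivatives of `m` are known only through `hX`; differentiating it once and twice gives the
  -- relations that eliminate them.
  have hX1 : ∀ s ∈ Set.Ioo (-b) b,
      (1 - z s ^ 2) * deriv m s = (1 - s ^ 2) * β1 s - 2 * s * β s + 2 * z s := fun s hs => by
    have h1 := (((hz.hasDerivAt s hs).fun_pow 2).const_sub 1).fun_mul (hm1 s hs)
    have h2 := (hc s).fun_mul (hβ s hs)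
    have h3 := h1.unique (h2.congr_of_eventuallyEq (by
      filter_upwards [Ioo_mem_nhds hs.1 hs.2] with t ht using hX t ht))
    have := (hz.pos s hs).ne'
    simp at h3
    field_simp at h3
    linear_combination h3
  have hX2 : (1 - z s ^ 2) * deriv (deriv m) s = 2 * z s * (m s)⁻¹ * deriv m s +
      (1 - s ^ 2) * β2 s - 4 * s * β1 s - 2 * β s + 2 * (m s)⁻¹ := by
    have h1 := (((hz.hasDerivAt s hs).fun_pow 2).const_sub 1).fun_mul hm2
    have h2 := (((hc s).fun_mul (hβ1 s hs)).fun_sub (((hasDerivAt_id' s).const_mul 2).fun_mul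
      (hβ s hs))).fun_add ((hz.hasDerivAt s hs).const_mul 2)
    have h3 := h1.unique (h2.congr_of_eventuallyEq (by
      filter_upwards [Ioo_mem_nhds hs.1 hs.2] with t ht using hX1 t ht))
    simp at h3
    linear_combination h3
  have hΘ : ∀ s ∈ Set.Ioo (-b) b, HasDerivAt (fun s => a ^ 2 * β s * m s)
      (a ^ 2 * β1 s * m s + a ^ 2 * β s * deriv m s) s := fun s hs =>
    ((hβ s hs).const_mul (a ^ 2)).fun_mul (hm1 s hs)
  have hΘ1 : HasDerivAt (fun s => a ^ 2 * β1 s * m s + a ^ 2 * β s * deriv m s) _ s :=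
    (((hβ1 s hs).const_mul (a ^ 2)).fun_mul (hm1 s hs)).fun_add
      (((hβ s hs).const_mul (a ^ 2)).fun_mul hm2)
  have hΞ : ∀ s ∈ Set.Ioo (-b) b, HasDerivAt (fun s => Real.exp (2 * η s))
      (Real.exp (2 * η s) * (2 * η1 s)) s := fun s hs => ((hη s hs).const_mul 2).exp
  have hΞ1 : HasDerivAt (fun s => Real.exp (2 * η s) * (2 * η1 s)) _ s :=
    (hΞ s hs).fun_mul ((hη1 s hs).const_mul 2)
  have e1 := (hz.hasDerivAt_comp_inv hs (hΘ s hs)).deriv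
  have e2 := hz.deriv_deriv_comp_inv hs hΘ hΘ1 (hm1 s hs)
  have e3 := (hz.hasDerivAt_comp_inv hs (hΞ s hs)).deriv
  have e4 := hz.deriv_deriv_comp_inv hs hΞ hΞ1 (hm1 s hs)
  rw [halfScalar, e1, e2, e3, e4, hz.inv_apply hs]
  have g0 := hX s hs
  have g1 := hX1 s hs
  have g2 := hX2
  have p0 := hz.pos s hs
  have p1 := hβ0 s hs
  have p2 := Real.exp_pos (2 * η s)
  have hq' : (1 : ℝ) ≤ q := by exact_mod_cast hq
  generalize z s = Z at *
  generalize deriv (deriv m) s = m2 at *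
  generalize deriv m s = m1 at *
  generalize m s = M at *
  generalize β s = B at *
  generalize β1 s = B1 at *
  generalize β2 s = B2 at *
  generalize η1 s = H1 at *
  generalize η2 s = H2 at *
  generalize Real.exp (2 * η s) = e at *
  have g2' : (1 - Z ^ 2) * m2 * M = 2 * Z * m1 +
      ((1 - s ^ 2) * B2 - 4 * s * B1 - 2 * B) * M + 2 := by
    rw [g2]
    field_simp
    ring
  -- The contribution of the Gauss curvature of the surface; `i2` and `i3` convert the terms of the
  -- warping factor `e^η`.
  have i1 : 1 - 1 / 2 * (((a ^ 2 * B2 * M + a ^ 2 * B1 * m1 + (a ^ 2 * B1 * m1 + a ^ 2 * B * m2)) *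
      M + (a ^ 2 * B1 * M + a ^ 2 * B * m1) * m1) * M * (1 - Z ^ 2) -
      2 * Z * ((a ^ 2 * B1 * M + a ^ 2 * B * m1) * M)) / (a ^ 2 * B * M) +
      1 / 2 * ((a ^ 2 * B1 * M + a ^ 2 * B * m1) * M / (a ^ 2 * B * M)) ^ 2 * (1 - Z ^ 2) =
      M * (B + 3 * s * B1 - (1 - s ^ 2) * B2) := by
    have h : ∀ r t : ℝ, 2 * B ^ 2 * r = 2 * B ^ 2 * t → r = t := fun r t h =>
      mul_left_cancel₀ (by positivity) h
    refine h _ _ ?_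
    field_simp
    linear_combination (-(B * B2 * M) + B1 ^ 2 * M) * g0 - B * B1 * M * g1 - B ^ 2 * g2'
  have i2 : -(1 / 2) * (((e * (2 * H1) * (2 * H1) + e * (2 * H2)) * M + e * (2 * H1) * m1) * M *
      (1 - Z ^ 2) - 2 * Z * (e * (2 * H1) * M)) / e +
      1 / 4 * (e * (2 * H1) * M / e) ^ 2 * (1 - Z ^ 2) =
      -M * (((1 - s ^ 2) * B1 - 2 * s * B) * H1 + (1 - s ^ 2) * B * H2 +
        (1 - s ^ 2) * B * H1 ^ 2) := by
    field_simp
    linear_combination -4 * (H1 ^ 2 + H2) * g0 - 4 * H1 * g1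
  have i3 : (e * (2 * H1) * M / e) ^ 2 * (1 - Z ^ 2) = 4 * M * ((1 - s ^ 2) * B * H1 ^ 2) := by
    have h : e * (2 * H1) * M / e = 2 * H1 * M := by field_simp
    rw [h]
    linear_combination 4 * H1 ^ 2 * M * g0
  -- This is the intrinsic curvature of the second factor, which is discarded.
  have hnn : 0 ≤ (a ^ 2 * B * M)⁻¹ * (q * (q - 1) / 2 * (a ^ 2 * B * M / e)) := by
    have : (0 : ℝ) ≤ q - 1 := by linarith
    positivity
  refine le_of_add_le_of_nonneg_left (le_of_eq ?_) hnn
  rw [i1, i2, mul_assoc (1 / 4 : ℝ), i3, inv_mul_eq_div, inv_mul_eq_div, inv_mul_eq_div]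
  field_simp
  ring
end IsReparam
end reparametrization

/-! ### Constructing the change of variable -/

section existsReparam
open MeasureTheory

/-- At `0` the difference quotient of an analytic function is analytic; elsewhere it is an honest
quotient. -/
lemma contDiffAt_dslope_rpow (r : ℝ) {t : ℝ} (ht : -1 < t) :
    ContDiffAt ℝ ∞ (dslope (fun t : ℝ => (1 + t) ^ r) 0) t := by
  have hf : ∀ t : ℝ, -1 < t → ContDiffAt ℝ ω (fun t : ℝ => (1 + t) ^ r) t := fun t ht =>
    ContDiffAt.rpow_const_of_ne (contDiffAt_const.add contDiffAt_id) (by simp; linarith)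
  rcases eq_or_ne t 0 with rfl | h0
  · obtain ⟨p, hp⟩ := (hf 0 ht).analyticAt
    exact AnalyticAt.contDiffAt ⟨_, hp.has_fpower_series_dslope_fslope⟩
  · refine ContDiffAt.congr_of_eventuallyEq ?_ (dslope_eventuallyEq_slope_of_ne _ h0)
    have h1 : ContDiffAt ℝ ∞ (fun t : ℝ => (1 + t) ^ r) t := (hf t ht).of_le le_top
    simp only [slope_fun_def, vsub_eq_sub, sub_zero, smul_eq_mul]
    exact (contDiffAt_id.inv h0).mul (h1.sub contDiffAt_const)

lemma exists_primitive {b : ℝ} (hb : 0 < b) {R : ℝ → ℝ}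
    (hR : ∀ s ∈ Set.Ioo (-b) b, ContDiffAt ℝ ∞ R s) :
    ∃ P : ℝ → ℝ, ∀ s ∈ Set.Ioo (-b) b, ContDiffAt ℝ ∞ P s ∧ HasDerivAt P (R s) s := by
  have hc : ContinuousOn R (Set.Ioo (-b) b) := fun s hs =>
    (hR s hs).continuousAt.continuousWithinAt
  have hd : ∀ s ∈ Set.Ioo (-b) b, HasDerivAt (fun s => ∫ x in (0 : ℝ)..s, R x) (R s) s := by
    intro s hs
    refine intervalIntegral.integral_hasDerivAt_right ?_
      (hc.stronglyMeasurableAtFilter isOpen_Ioo s hs) (hR s hs).continuousAt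
    refine (hc.mono fun x hx => ?_).intervalIntegrable
    have h0 : (0 : ℝ) ∈ Set.Ioo (-b) b := ⟨by linarith, hb⟩
    exact (Set.ordConnected_Ioo.uIcc_subset h0 hs) hx
  have hcd : ContDiffOn ℝ ∞ (fun s => ∫ x in (0 : ℝ)..s, R x) (Set.Ioo (-b) b) := by
    rw [contDiffOn_infty_iff_deriv_of_isOpen isOpen_Ioo]
    refine ⟨fun s hs => (hd s hs).differentiableAt.differentiableWithinAt,
      ContDiffOn.congr (f := R) (fun s hs => (hR s hs).contDiffWithinAt)
        fun s hs => (hd s hs).deriv⟩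
  exact ⟨_, fun s hs => ⟨hcd.contDiffAt (Ioo_mem_nhds hs.1 hs.2), hd s hs⟩⟩

/-- With `β = (1 + (1 - s²) R)⁻¹` the equation is `dz/(1 - z²) = ds/(1 - s²) + R ds`. So `artanh z =
artanh s + P` with `P` a primitive of `R`; in terms of `w = e^{2P}` the solution is rational and
extends across `s = ±1`. -/
theorem exists_isReparam {b₀ : ℝ} (hb₀ : 1 < b₀) {R : ℝ → ℝ}
    (hR : ∀ s ∈ Set.Ioo (-b₀) b₀, ContDiffAt ℝ ∞ R s)
    (hR0 : ∀ s ∈ Set.Ioo (-b₀) b₀, 0 < 1 + (1 - s ^ 2) * R s) :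
    ∃ (b : ℝ) (z m : ℝ → ℝ), b ≤ b₀ ∧ IsReparam b z m ∧
      (∀ s ∈ Set.Ioo (-b) b, ContDiffAt ℝ ∞ m s) ∧
      ∀ s ∈ Set.Ioo (-b) b, (1 - z s ^ 2) * m s = (1 - s ^ 2) * (1 + (1 - s ^ 2) * R s)⁻¹ := by
  obtain ⟨P, hP⟩ := exists_primitive (zero_lt_one.trans hb₀) hR
  set w : ℝ → ℝ := fun s => Real.exp (2 * P s) with hw
  set N : ℝ → ℝ := fun s => (1 + s) * w s + (1 - s) with hN
  have hw0 : ∀ s, 0 < w s := fun s => Real.exp_pos _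
  have hwc : ∀ s ∈ Set.Ioo (-b₀) b₀, ContDiffAt ℝ ∞ w s := fun s hs =>
    (contDiffAt_const.mul (hP s hs).1).exp
  have hNc : ∀ s ∈ Set.Ioo (-b₀) b₀, ContDiffAt ℝ ∞ N s := fun s hs =>
    ((contDiffAt_const.add contDiffAt_id).mul (hwc s hs)).add (contDiffAt_const.sub contDiffAt_id)
  have hopen : IsOpen (Set.Ioo (-b₀) b₀ ∩ N ⁻¹' Set.Ioi 0) :=
    ContinuousOn.isOpen_inter_preimage (fun s hs => (hNc s hs).continuousAt.continuousWithinAt)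
      isOpen_Ioo isOpen_Ioi
  have hsub : Set.Icc (-1 : ℝ) 1 ⊆ Set.Ioo (-b₀) b₀ ∩ N ⁻¹' Set.Ioi 0 := fun s hs => by
    refine ⟨⟨by linarith [hs.1], by linarith [hs.2]⟩, ?_⟩
    change 0 < (1 + s) * w s + (1 - s)
    have h1 : 0 ≤ (1 + s) * w s := mul_nonneg (by linarith [hs.1]) (hw0 s).le
    rcases eq_or_lt_of_le hs.2 with rfl | h
    · have := hw0 1
      linarith
    · linarith
  -- The denominator `N` is positive on `[-1, 1]`, hence by compactness on a slightly larger
  -- interval.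
  obtain ⟨ε, hε, hεsub⟩ := isCompact_Icc.exists_thickening_subset_open hopen hsub
  have hmem : ∀ s ∈ Set.Ioo (-(1 + ε)) (1 + ε), s ∈ Set.Ioo (-b₀) b₀ ∧ 0 < N s := fun s hs => by
    refine hεsub (Metric.mem_thickening_iff.2 ?_)
    rcases lt_or_ge s (-1) with h | h
    · refine ⟨-1, by simp, ?_⟩
      rw [Real.dist_eq, abs_lt]
      constructor <;> linarith [hs.1]
    · rcases lt_or_ge 1 s with h' | h'
      · refine ⟨1, by simp, ?_⟩
        rw [Real.dist_eq, abs_lt]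
        constructor <;> linarith [hs.2]
      · exact ⟨s, ⟨h, h'⟩, by simpa using hε⟩
  set b := min (1 + ε) b₀ with hb
  have hmem' : ∀ s ∈ Set.Ioo (-b) b, s ∈ Set.Ioo (-b₀) b₀ ∧ 0 < N s := fun s hs =>
    hmem s ⟨by linarith [hs.1, min_le_left (1 + ε) b₀], by linarith [hs.2, min_le_left (1 + ε) b₀]⟩
  refine ⟨b, fun s => ((1 + s) * w s - (1 - s)) / N s,
    fun s => (1 + (1 - s ^ 2) * R s)⁻¹ * N s ^ 2 / (4 * w s), min_le_right _ _,
    ⟨lt_min (by linarith) hb₀, fun s hs => ?_, fun s hs => ?_, fun s hs => ?_, ?_, ?_⟩,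
    fun s hs => ?_, fun s hs => ?_⟩
  · obtain ⟨h1, h2⟩ := hmem' s hs
    exact (((contDiffAt_const.add contDiffAt_id).mul (hwc s h1)).sub
      (contDiffAt_const.sub contDiffAt_id)).div (hNc s h1) h2.ne'
  · obtain ⟨h1, h2⟩ := hmem' s hs
    have hd : HasDerivAt w (w s * (2 * R s)) s := ((hP s h1).2.const_mul 2).exp
    have hU := ((hasDerivAt_id' s).const_add 1).fun_mul hd
    have hV := (hasDerivAt_id' s).const_sub 1
    have h3 := (hU.fun_sub hV).fun_div (hU.fun_add hV) h2.ne'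
    refine h3.congr_deriv ?_
    have h4 := hR0 s h1
    have h5 := hw0 s
    simp only [hN] at h2 ⊢
    field_simp
    ring
  · obtain ⟨h1, h2⟩ := hmem' s hs
    have := hR0 s h1
    have := hw0 s
    positivity
  · have := hw0 1
    simp [hN, this.ne']
  · simp [hN]
    norm_num
  · obtain ⟨h1, h2⟩ := hmem' s hs
    exact ((((contDiffAt_const.add ((contDiffAt_const.sub (contDiffAt_id.pow 2)).mul
      (hR s h1))).inv (hR0 s h1).ne').mul ((hNc s h1).pow 2)).div (contDiffAt_const.mul (hwc s h1))
      (by have := hw0 s; positivity))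
  · obtain ⟨h1, h2⟩ := hmem' s hs
    have h4 := hR0 s h1
    have h5 := hw0 s
    simp only [hN] at h2 ⊢
    field_simp
    ring
end existsReparam

/-! ### The weights and the curvature estimate -/

section weights

lemma half_le_quartic (μ : ℝ) : 1 / 2 ≤ 1 - μ + μ ^ 2 - 2 * μ ^ 3 + 3 * μ ^ 4 := by
  nlinarith [sq_nonneg (μ ^ 2 - μ / 3 - 1 / 6), sq_nonneg (μ - 2 / 5)]

/-- The curvature estimate in terms of `μ = (1 + (1 - s²) / δ) ^ (-1 / 4)`. -/
lemma curvature_estimate {κ δ ε s μ : ℝ} (hκ : 0 ≤ κ) (hκ' : κ ≤ 1) (hδ : 0 < δ)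
    (hδ' : δ ≤ 1 / 16) (hε : 0 ≤ ε) (hδε : 18 * δ ≤ ε ^ 4) (hs : s ^ 2 ≤ 1) (hμ : 0 < μ)
    (hμ4 : μ ^ 4 * (δ + (1 - s ^ 2)) = δ) :
    1 + κ * (1 - 2 * ε) ≤ 1 - κ * ((1 - s ^ 2) * (δ + (1 - s ^ 2))⁻¹) +
      2 * κ * ((1 - s ^ 2) * (δ + (1 - s ^ 2))⁻¹) * (1 + μ)⁻¹ +
      κ * s ^ 2 * (δ + (1 - s ^ 2))⁻¹ * (3 - (κ + 2) * ((1 - s ^ 2) * (δ + (1 - s ^ 2))⁻¹) +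
        2 * κ * ((1 - s ^ 2) * (δ + (1 - s ^ 2))⁻¹) * (1 + μ)⁻¹ - 4 * (1 + μ)⁻¹ +
        4 * ((1 - s ^ 2) * (δ + (1 - s ^ 2))⁻¹) * (1 + μ)⁻¹ -
        ((1 - s ^ 2) * (δ + (1 - s ^ 2))⁻¹) * (1 - (1 + μ)⁻¹) * (1 + μ)⁻¹ -
        (1 + κ) * ((1 - s ^ 2) * (δ + (1 - s ^ 2))⁻¹) * (1 + μ)⁻¹ ^ 2) := by
  have hpos : 0 < δ + (1 - s ^ 2) := by linarith
  have hp : (1 - s ^ 2) * (δ + (1 - s ^ 2))⁻¹ = 1 - μ ^ 4 := by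
    field_simp
    linarith
  have hμ1 : μ ≤ 1 := by
    by_contra! h
    have : 1 < μ ^ 4 := one_lt_pow₀ h (by norm_num)
    nlinarith
  set r := (1 - μ) * (1 + μ ^ 2) with hr
  have hr0 : 0 ≤ r := mul_nonneg (by linarith) (by positivity)
  have hpr : (1 - μ ^ 4) * (1 + μ)⁻¹ = r := by
    rw [hr]
    field_simp
    ring
  -- `B` is the bracket of the right-hand side after substituting `(1 - s²)/(δ + 1 - s²) = 1 - μ⁴`.
  -- What remains outside it is `1 + κ (1 - μ)² (1 + μ²)`.
  set B := 3 - (κ + 2) * (1 - μ ^ 4) + 2 * κ * r - 4 * (1 + μ)⁻¹ + 4 * r - r * (1 - (1 + μ)⁻¹) -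
    (1 + κ) * r * (1 + μ)⁻¹ with hB
  have hB1 : (1 + μ) * B = μ * (1 - μ + μ ^ 2 - 2 * μ ^ 3 + 3 * μ ^ 4) +
      (1 - κ) * (r * μ ^ 2) := by
    rw [hB, hr]
    field_simp
    ring
  have hB2 : μ / 4 ≤ B := by
    have h1 : μ * (1 / 2) ≤ (1 + μ) * B := by
      rw [hB1]
      have h2 := mul_le_mul_of_nonneg_left (half_le_quartic μ) hμ.le
      have h3 : 0 ≤ (1 - κ) * (r * μ ^ 2) := mul_nonneg (by linarith) (by positivity)
      linarith
    by_contra! h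
    nlinarith
  have hL : 1 + κ * ((1 - μ) ^ 2 * (1 + μ ^ 2)) + κ * (s ^ 2 * (δ + (1 - s ^ 2))⁻¹) * B =
      1 - κ * ((1 - s ^ 2) * (δ + (1 - s ^ 2))⁻¹) +
      2 * κ * ((1 - s ^ 2) * (δ + (1 - s ^ 2))⁻¹) * (1 + μ)⁻¹ +
      κ * s ^ 2 * (δ + (1 - s ^ 2))⁻¹ * (3 - (κ + 2) * ((1 - s ^ 2) * (δ + (1 - s ^ 2))⁻¹) +
        2 * κ * ((1 - s ^ 2) * (δ + (1 - s ^ 2))⁻¹) * (1 + μ)⁻¹ - 4 * (1 + μ)⁻¹ +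
        4 * ((1 - s ^ 2) * (δ + (1 - s ^ 2))⁻¹) * (1 + μ)⁻¹ -
        ((1 - s ^ 2) * (δ + (1 - s ^ 2))⁻¹) * (1 - (1 + μ)⁻¹) * (1 + μ)⁻¹ -
        (1 + κ) * ((1 - s ^ 2) * (δ + (1 - s ^ 2))⁻¹) * (1 + μ)⁻¹ ^ 2) := by
    rw [hp, hB, ← hpr]
    have h1 : (1 - μ) ^ 2 * (1 + μ ^ 2) = -(1 - μ ^ 4) + 2 * ((1 - μ ^ 4) * (1 + μ)⁻¹) := by
      rw [hpr, hr]
      ring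
    rw [h1]
    ring
  rw [← hL]
  have h2 : 1 - 2 * μ ≤ (1 - μ) ^ 2 * (1 + μ ^ 2) := by nlinarith [sq_nonneg (μ * (1 - μ)), hμ]
  have h3 : 0 ≤ s ^ 2 * (δ + (1 - s ^ 2))⁻¹ := by positivity
  -- The main term loses at most `2 μ κ`. Near the poles `s²/(δ + 1 - s²) ≥ (17/18)/(1/16 + 1/18) =
  -- 8`, and `8 · μ/4` makes up for the loss; elsewhere `μ⁴ ≤ 18 δ ≤ ε⁴`, so the loss is at most `2
  -- ε κ`.
  rcases lt_or_ge (1 - s ^ 2) (1 / 18) with hc | hc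
  · have h4 : 8 ≤ s ^ 2 * (δ + (1 - s ^ 2))⁻¹ := by
      rw [← div_eq_mul_inv, le_div_iff₀ hpos]
      linarith
    have h5 : 2 * μ ≤ s ^ 2 * (δ + (1 - s ^ 2))⁻¹ * B := by
      calc 2 * μ = 8 * (μ / 4) := by ring
        _ ≤ _ := mul_le_mul h4 hB2 (by positivity) h3
    have h6 := mul_le_mul_of_nonneg_left h2 hκ
    have h7 := mul_le_mul_of_nonneg_left h5 hκ
    have h8 := mul_nonneg hκ hε
    rw [mul_assoc κ]
    linarith
  · have h4 : μ ^ 4 ≤ ε ^ 4 := by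
      have : μ ^ 4 * (1 / 18) ≤ δ := by
        rw [← hμ4]
        exact mul_le_mul_of_nonneg_left (by linarith) (by positivity)
      linarith
    have h5 : μ ≤ ε := le_of_pow_le_pow_left₀ (by norm_num) hε h4
    have h6 := mul_le_mul_of_nonneg_left h2 hκ
    have h7 : 0 ≤ κ * (s ^ 2 * (δ + (1 - s ^ 2))⁻¹) * B :=
      mul_nonneg (mul_nonneg hκ h3) (le_trans (by positivity) hB2)
    have h8 := mul_le_mul_of_nonneg_left h5 hκ
    linarith

/-- Weights for which the length of the meridians is `a π`, with half scalar curvature almost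
`2 (n - 1) / (n a²)`, where `n = q + 2`. -/
theorem exists_weights {q : ℕ} (hq : 1 ≤ q) {θ a : ℝ} (hθ : θ < 1) (ha : 0 < a) :
    ∃ Θ Ξ σ : ℝ → ℝ, IsWeight Θ ∧ IsWeight Ξ ∧ IsProfile Θ σ a ∧
      ∀ z ∈ Set.Icc (-1 : ℝ) 1, θ * (1 + q / (q + 2)) / a ^ 2 ≤ halfScalar q Θ Ξ z := by
  set κ : ℝ := q / (q + 2) with hκ
  have hq0 : (1 : ℝ) ≤ q := by exact_mod_cast hq
  have hκ0 : 0 ≤ κ := by positivity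
  have hκ1 : κ ≤ 1 := by
    rw [hκ, div_le_one (by positivity)]
    linarith
  -- Chosen so that `1 - 2 ε = θ`, whence `θ (1 + κ) ≤ 1 + κ (1 - 2 ε)`.
  set ε : ℝ := (1 - θ) / 2 with hε
  have hε0 : 0 < ε := by linarith
  set δ : ℝ := min (1 / 16) (ε ^ 4 / 18) with hδ
  have hδ0 : 0 < δ := lt_min (by norm_num) (by positivity)
  have hδ1 : δ ≤ 1 / 16 := min_le_left _ _
  have hδε : 18 * δ ≤ ε ^ 4 := by
    have := min_le_right (1 / 16 : ℝ) (ε ^ 4 / 18)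
    linarith
  -- On `(-b₀, b₀)` the function `Y` below is positive.
  set b₀ := Real.sqrt (1 + δ) with hb₀
  have hb₀1 : 1 < b₀ := by
    rw [hb₀, Real.lt_sqrt zero_le_one]
    linarith
  have hD : ∀ s ∈ Set.Ioo (-b₀) b₀, 0 < δ + (1 - s ^ 2) := fun s hs => by
    have h1 := Real.sq_sqrt (show 0 ≤ 1 + δ by linarith)
    have h2 := abs_lt.2 hs
    have h3 : s ^ 2 < b₀ ^ 2 := sq_lt_sq' hs.1 hs.2
    rw [hb₀, h1] at h3
    linarith
  set Y : ℝ → ℝ := fun s => 1 + (1 - s ^ 2) / δ with hY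
  have hY0 : ∀ s ∈ Set.Ioo (-b₀) b₀, 0 < Y s := fun s hs => by
    have h : Y s = (δ + (1 - s ^ 2)) / δ := by simp only [hY]; field_simp
    rw [h]
    exact div_pos (hD s hs) hδ0
  have hYD : ∀ s, (δ + (1 - s ^ 2)) = δ * Y s := fun s => by simp only [hY]; field_simp
  -- `R` must satisfy `1 + (1 - s²) R = Y^{κ/2} = 1/β`; the divided difference makes it smooth at `s
  -- = ±1`.
  set R : ℝ → ℝ := fun s => δ⁻¹ * dslope (fun t : ℝ => (1 + t) ^ (κ / 2)) 0 ((1 - s ^ 2) / δ) with hR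
  have hRY : ∀ s, 1 + (1 - s ^ 2) * R s = Y s ^ (κ / 2) := fun s => by
    have h := sub_smul_dslope (fun t : ℝ => (1 + t) ^ (κ / 2)) 0 ((1 - s ^ 2) / δ)
    simp only [sub_zero, smul_eq_mul, add_zero, Real.one_rpow] at h
    simp only [hR, hY]
    rw [← mul_assoc, ← div_eq_mul_inv, h]
    ring
  have hRc : ∀ s ∈ Set.Ioo (-b₀) b₀, ContDiffAt ℝ ∞ R s := fun s hs => by
    have h1 : -1 < (1 - s ^ 2) / δ := by have := hY0 s hs; simp only [hY] at this; linarith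
    exact contDiffAt_const.mul (ContDiffAt.comp s (contDiffAt_dslope_rpow _ h1)
      ((contDiffAt_const.sub (contDiffAt_id.pow 2)).div_const δ))
  obtain ⟨b, z, m, hb, hz, hmc, hX⟩ := exists_isReparam hb₀1 hRc fun s hs => by
    rw [hRY]
    exact Real.rpow_pos_of_pos (hY0 s hs) _
  have hJ : ∀ s ∈ Set.Ioo (-b) b, s ∈ Set.Ioo (-b₀) b₀ := fun s hs =>
    ⟨by linarith [hs.1], by linarith [hs.2]⟩
  set β : ℝ → ℝ := fun s => Y s ^ (-(κ / 2)) with hβ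
  set ν : ℝ → ℝ := fun s => Y s ^ (1 / 4 : ℝ) with hν
  set P : ℝ → ℝ := fun s => (δ + (1 - s ^ 2))⁻¹ with hP
  set g : ℝ → ℝ := fun s => ν s / (1 + ν s) with hg
  -- For small `δ` this makes `e^η` comparable to `Y^{1/(q+2)}`, the power of the extremal model.
  -- The summand `1` and the exponent `1/4` in `ν` give the positivity of the bracket `B` in
  -- `curvature_estimate`, where `μ = 1/ν`.
  set η : ℝ → ℝ := fun s => 4 / (q + 2) * Real.log (1 + ν s) with hη
  have hβ0 : ∀ s ∈ Set.Ioo (-b) b, 0 < β s := fun s hs => Real.rpow_pos_of_pos (hY0 s (hJ s hs)) _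
  have hν0 : ∀ s ∈ Set.Ioo (-b) b, 0 < ν s := fun s hs => Real.rpow_pos_of_pos (hY0 s (hJ s hs)) _
  have hX' : ∀ s ∈ Set.Ioo (-b) b, (1 - z s ^ 2) * m s = (1 - s ^ 2) * β s := fun s hs => by
    rw [hX s hs, hRY, hβ]
    simp only
    rw [Real.rpow_neg (hY0 s (hJ s hs)).le]
  have hYd : ∀ s, HasDerivAt Y (-(2 * s) / δ) s := fun s => by
    have h := ((((hasDerivAt_id' s).fun_pow 2).const_sub 1).div_const δ).const_add 1
    exact h.congr_deriv (by simp)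
  have hYr : ∀ r : ℝ, ∀ s ∈ Set.Ioo (-b) b,
      HasDerivAt (fun s => Y s ^ r) (-2 * r * s * P s * Y s ^ r) s := fun r s hs => by
    have h0 := hY0 s (hJ s hs)
    refine ((hYd s).rpow_const (p := r) (Or.inl h0.ne')).congr_deriv ?_
    rw [Real.rpow_sub_one h0.ne', hP]
    simp only
    rw [hYD]
    field_simp
  have hPd : ∀ s ∈ Set.Ioo (-b) b, HasDerivAt P (2 * s * P s ^ 2) s := fun s hs => by
    have h0 := hD s (hJ s hs)
    have h := ((((hasDerivAt_id s).fun_pow 2).const_sub 1).const_add δ).fun_inv h0.ne'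
    refine h.congr_deriv ?_
    simp only [hP, id]
    field_simp
    simp
    ring
  have hβd : ∀ s ∈ Set.Ioo (-b) b, HasDerivAt β (κ * s * P s * β s) s := fun s hs =>
    (hYr _ s hs).congr_deriv (by simp only [hβ]; ring)
  have hβd2 : ∀ s ∈ Set.Ioo (-b) b, HasDerivAt (fun s => κ * s * P s * β s)
      (β s * (κ ^ 2 * s ^ 2 * P s ^ 2 + κ * P s + 2 * κ * s ^ 2 * P s ^ 2)) s := fun s hs =>
    ((((hasDerivAt_id' s).const_mul κ).fun_mul (hPd s hs)).fun_mul (hβd s hs)).congr_deriv (by ring)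
  have hνd : ∀ s ∈ Set.Ioo (-b) b, HasDerivAt ν (-(1 / 2) * s * P s * ν s) s := fun s hs =>
    (hYr _ s hs).congr_deriv (by simp only [hν]; ring)
  have hgd : ∀ s ∈ Set.Ioo (-b) b, HasDerivAt g (-(1 / 2) * s * P s * g s * (1 - g s)) s :=
    fun s hs => by
      have h0 := hν0 s hs
      have h1 : 1 + ν s ≠ 0 := by positivity
      refine ((hνd s hs).fun_div ((hνd s hs).const_add 1) h1).congr_deriv ?_
      simp only [hg]
      field_simp
      ring
  have hηd : ∀ s ∈ Set.Ioo (-b) b, HasDerivAt η (-(2 / (q + 2)) * (s * P s * g s)) s :=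
    fun s hs => by
      have h0 := hν0 s hs
      have h1 : 1 + ν s ≠ 0 := by positivity
      refine ((((hνd s hs).const_add 1).log h1).const_mul (4 / ((q : ℝ) + 2))).congr_deriv ?_
      simp only [hg]
      field_simp
      ring
  have hηd2 : ∀ s ∈ Set.Ioo (-b) b, HasDerivAt (fun s => -(2 / ((q : ℝ) + 2)) * (s * P s * g s))
      (-(2 / (q + 2)) * (P s * g s + 2 * s ^ 2 * P s ^ 2 * g s -
        1 / 2 * s ^ 2 * P s ^ 2 * g s * (1 - g s))) s := fun s hs =>
    ((((hasDerivAt_id' s).fun_mul (hPd s hs)).fun_mul (hgd s hs)).const_mul _).congr_deriv (by ring)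
  have hYc : ∀ r : ℝ, ∀ s ∈ Set.Icc (-1 : ℝ) 1, ContDiffAt ℝ ∞ (fun s => Y s ^ r) s :=
    fun r s hs => ContDiffAt.rpow_const_of_ne
      (contDiffAt_const.add ((contDiffAt_const.sub (contDiffAt_id.pow 2)).div_const δ))
      (hY0 s (hJ s (hz.mem_Ioo hs))).ne'
  refine ⟨_, fun y => Real.exp (2 * η (reparamInv b z y)), _, hz.isWeight
    (f := fun s => a ^ 2 * β s * m s)
    (fun s hs => (contDiffAt_const.mul (hYc _ s hs)).mul (hmc s (hz.mem_Ioo hs)))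
    (fun s hs => mul_pos (mul_pos (by positivity) (hβ0 s (hz.mem_Ioo hs)))
      (hz.pos s (hz.mem_Ioo hs))), hz.isWeight (f := fun s => Real.exp (2 * η s))
    (fun s hs => ?_) (fun s hs => Real.exp_pos _), hz.isProfile ha hX', fun y hy => ?_⟩
  · have h0 := hν0 s (hz.mem_Ioo hs)
    exact (contDiffAt_const.mul (contDiffAt_const.mul
      ((contDiffAt_const.add (hYc _ s hs)).log (by positivity)))).exp
  · obtain ⟨s, hs, rfl⟩ := hz.exists_eq hy
    have hsJ := hz.mem_Ioo hs
    refine le_trans ?_ (hz.halfScalar_ge ha q hq hmc hβ0 hβd hβd2 hηd hηd2 hX' hsJ)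
    have hβs := hβ0 s hsJ
    have hνs := hν0 s hsJ
    have hDs := hD s (hJ s hsJ)
    have hμ4 : (ν s)⁻¹ ^ 4 * (δ + (1 - s ^ 2)) = δ := by
      have h4 : ν s ^ 4 = Y s := by
        simp only [hν]
        rw [← Real.rpow_natCast, ← Real.rpow_mul (hY0 s (hJ s hsJ)).le]
        norm_num
      rw [inv_pow, h4, hYD]
      have := (hY0 s (hJ s hsJ)).ne'
      field_simp
    have hest := curvature_estimate hκ0 hκ1 hδ0 hδ1 hε0.le hδε
      (by nlinarith [hs.1, hs.2] : s ^ 2 ≤ 1) (inv_pos.2 hνs) hμ4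
    have hgs : (1 + (ν s)⁻¹)⁻¹ = g s := by
      simp only [hg]
      field_simp
      ring
    have hθκ : θ * (1 + κ) ≤ 1 + κ * (1 - 2 * ε) := by
      have : κ * (1 - 2 * ε) = κ * θ := by rw [hε]; ring
      rw [this]
      linarith
    have hest' := hθκ.trans hest
    rw [hgs] at hest'
    have hPs : (δ + (1 - s ^ 2))⁻¹ = P s := rfl
    rw [hPs] at hest'
    rw [div_le_iff₀ (by positivity)]
    refine hest'.trans (le_of_eq ?_)
    have e0 : ∀ S : ℝ, (a ^ 2 * β s)⁻¹ * S * a ^ 2 = (β s)⁻¹ * S := fun S => by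
      have := ha.ne'
      field_simp
    rw [e0, eq_inv_mul_iff_mul_eq₀ hβs.ne']
    have e1 : q * (((1 - s ^ 2) * (κ * s * P s * β s) - 2 * s * β s) *
        (-(2 / ((q : ℝ) + 2)) * (s * P s * g s)) + (1 - s ^ 2) * β s * (-(2 / ((q : ℝ) + 2)) *
        (P s * g s + 2 * s ^ 2 * P s ^ 2 * g s - 1 / 2 * s ^ 2 * P s ^ 2 * g s * (1 - g s)))) =
        -(2 * κ) * (((1 - s ^ 2) * (κ * s * P s * β s) - 2 * s * β s) * (s * P s * g s) +
          (1 - s ^ 2) * β s * (P s * g s + 2 * s ^ 2 * P s ^ 2 * g s -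
            1 / 2 * s ^ 2 * P s ^ 2 * g s * (1 - g s))) := by
      rw [hκ]
      field_simp
      ring
    have e2 : q * ((q : ℝ) + 1) / 2 * ((1 - s ^ 2) * β s *
        (-(2 / ((q : ℝ) + 2)) * (s * P s * g s)) ^ 2) =
        κ * (1 + κ) * ((1 - s ^ 2) * β s * (s * P s * g s) ^ 2) := by
      rw [hκ]
      field_simp
      ring
    rw [e1, e2]
    ring
end weights

/-! ### The examples and the sequence -/

section examples

/-- A closed Riemannian `n`-manifold with `C_m ≥ c` and a homologically nontrivial closed
submanifold of dimension `d` and diameter `ρ`. -/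
def HasSlice (n d m : ℕ) (c ρ : ℝ) : Prop :=
  ∃ (N : ClosedRiemannianManifold n) (S : ClosedSubmanifold N d),
    N.IntermediateCurvatureGE m c ∧ S.HomologicallyNontrivial ∧ S.diam = ENNReal.ofReal ρ

/-- The reciprocal of the curvature constant `1 + κ` of `exists_weights`, which is what makes the
diameters sharp. -/
lemma diameterConstant_surface {q : ℕ} :
    diameterConstant (2 + q) (q + 1) = (1 + (q : ℝ) / (q + 2))⁻¹ := by
  have h : (q : ℝ) + 1 ≠ 0 := by positivity
  have h2 : (q : ℝ) + 2 ≠ 0 := by positivity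
  have e : 1 + (q : ℝ) / (q + 2) = 2 * (q + 1) / (q + 2) := by field_simp; ring
  rw [e, inv_div, diameterConstant]
  push_cast
  congr 1 <;> ring

lemma diameterConstant_threefold {q : ℕ} : diameterConstant (3 + q) (q + 1) = 1 / 2 := by
  rw [diameterConstant]
  push_cast
  rw [div_eq_div_iff (by ring_nf; norm_num) (by norm_num)]
  ring

/-- The scale `a = θ/√(c C₀)` is smaller than the critical one; this multiplies the curvature by
`θ⁻²` and leaves room for the factor `θ² < 1` lost in `exists_weights`. -/
theorem hasSlice_surface {q : ℕ} (hq : 1 ≤ q) {c θ : ℝ} (hc : 0 < c) (hθ0 : 0 < θ) (hθ1 : θ < 1) :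
    HasSlice (2 + q) 2 (q + 1) c
      (θ * (Real.pi / Real.sqrt (c * diameterConstant (2 + q) (q + 1)))) := by
  -- A positive dimension makes the second sphere connected.
  obtain ⟨q, rfl⟩ : ∃ r, q = r + 1 := ⟨q - 1, by omega⟩
  have := connectedSpace_sph 1
  have := connectedSpace_sph q
  have hκ : 0 < 1 + ((q + 1 : ℕ) : ℝ) / ((q + 1 : ℕ) + 2) := by positivity
  have hC : 0 < c * diameterConstant (2 + (q + 1)) (q + 1 + 1) := by
    rw [diameterConstant_surface]
    positivity
  set s := Real.sqrt (c * diameterConstant (2 + (q + 1)) (q + 1 + 1)) with hs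
  have hs0 : 0 < s := Real.sqrt_pos.2 hC
  obtain ⟨Θ, Ξ, σ, hΘ, hΞ, hσ, h⟩ := exists_weights hq (show θ ^ 2 < 1 by nlinarith)
    (show 0 < θ / s by positivity)
  have hcv : c = θ ^ 2 * (1 + ((q + 1 : ℕ) : ℝ) / ((q + 1 : ℕ) + 2)) / (θ / s) ^ 2 := by
    rw [div_pow, hs, Real.sq_sqrt hC.le, diameterConstant_surface]
    field_simp
  rw [← hcv] at h
  refine ⟨warpedProduct 2 (isRound_sph (q + 1)) hΘ hΞ,
    warpedSlice (d := 2) (isRound_sph (q + 1)) hΘ hΞ (Classical.arbitrary _),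
    intermediateCurvatureGE_warpedProduct _ hΘ hΞ h,
    homologicallyNontrivial_warpedSlice 0 _ hΘ hΞ _, ?_⟩
  rw [diam_warpedSlice, diam_conformalSphere hΘ hσ two_pos]
  congr 1
  ring

lemma isProfile_const {r : ℝ} (hr : 0 < r) : IsProfile (fun _ => r ^ 2) id r where
  pos := hr
  contDiffAt _ _ := contDiffAt_id
  one := rfl
  neg_one := rfl
  deriv_pos _ _ := by simp
  eq _ _ := by simp

lemma hasSlice_roundProduct {q : ℕ} {Y : Type} [TopologicalSpace Y]
    [ChartedSpace (EuclideanSpace ℝ (Fin q)) Y] {j : Y → EuclideanSpace ℝ (Fin (q + 1))}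
    [IsManifold (𝓡 q) ∞ Y] [T2Space Y] [CompactSpace Y] [ConnectedSpace Y] (hj : IsRound q j)
    {c r : ℝ} (hr : 0 < r) (hc : c ≤ 2 / r ^ 2) :
    HasSlice (3 + q) 3 (q + 1) c (r * Real.pi) := by
  have := connectedSpace_sph 2
  have hr2 : 0 < r ^ 2 := by positivity
  refine ⟨_, warpedSlice (d := 3) hj (isWeight_const hr2) (isWeight_const hr2)
    (Classical.arbitrary _), fun p e he => hc.trans
      (intermediateCurvatureGE_roundProduct hj hr2 p e he),
    homologicallyNontrivial_warpedSlice 1 _ _ _ _, ?_⟩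
  rw [diam_warpedSlice, diam_conformalSphere _ (isProfile_const hr) three_pos]

/-- The radius `r = θ √(2/c)` gives `2/r² = c/θ² ≥ c`. -/
theorem hasSlice_threefold {q : ℕ} {c θ : ℝ} (hc : 0 < c) (hθ0 : 0 < θ) (hθ1 : θ < 1) :
    HasSlice (3 + q) 3 (q + 1) c
      (θ * (Real.pi / Real.sqrt (c * diameterConstant (3 + q) (q + 1)))) := by
  rw [diameterConstant_threefold]
  set s := Real.sqrt (c * (1 / 2)) with hs
  have hs0 : 0 < s := Real.sqrt_pos.2 (by positivity)
  have hr : 0 < θ / s := by positivity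
  have hcr : c ≤ 2 / (θ / s) ^ 2 := by
    rw [div_pow, hs, Real.sq_sqrt (by positivity), le_div_iff₀ (by positivity)]
    have : c * (θ ^ 2 / (c * (1 / 2))) = 2 * θ ^ 2 := by field_simp
    rw [this]
    nlinarith
  have e : θ * (Real.pi / s) = θ / s * Real.pi := by ring
  rw [e]
  obtain rfl | ⟨q, rfl⟩ : q = 0 ∨ ∃ r, q = r + 1 := by
    rcases q with _ | q
    · exact Or.inl rfl
    · exact Or.inr ⟨q, rfl⟩
  · exact hasSlice_roundProduct isRound_point hr hcr
  · have := connectedSpace_sph q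
    exact hasSlice_roundProduct (isRound_sph (q + 1)) hr hcr

theorem exists_seq_of_hasSlice {n d m : ℕ} {c ρ : ℝ} (hρ : 0 < ρ)
    (h : ∀ θ : ℝ, 0 < θ → θ < 1 → HasSlice n d m c (θ * ρ)) :
    ∃ (N : ℕ → ClosedRiemannianManifold n) (S : ∀ k, ClosedSubmanifold (N k) d),
      (∀ k, (N k).IntermediateCurvatureGE m c) ∧ (∀ k, (S k).HomologicallyNontrivial) ∧
      StrictMono (fun k => (S k).diam) ∧
      Tendsto (fun k => (S k).diam) atTop (𝓝 (ENNReal.ofReal ρ)) := by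
  -- Each diameter is exactly `u k * ρ`, so strict monotonicity and the limit are inherited from
  -- `u`.
  obtain ⟨u, hu, hu1, hul⟩ := exists_seq_strictMono_tendsto' (show (0 : ℝ) < 1 from one_pos)
  choose N S hN hS hd using fun k => h (u k) (hu1 k).1 (hu1 k).2
  refine ⟨N, S, hN, hS, fun k l hkl => ?_, ?_⟩
  · simp only [hd]
    exact (ENNReal.ofReal_lt_ofReal_iff (mul_pos (hu1 l).1 hρ)).2
      (mul_lt_mul_of_pos_right (hu hkl) hρ)
  · simp only [hd]
    exact ENNReal.tendsto_ofReal (by simpa using hul.mul_const ρ)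

end examples

end IntermediateCurvature

end

theorem mainTheorem7 (n m : ℕ) (hn : 3 ≤ n) (hn' : n ≤ 7) (hm : m = n - 1 ∨ m = n - 2)
    (lam : ℝ) (hlam : 0 < lam) :
    0 < IntermediateCurvature.diameterConstant n m ∧
    ∃ (N : ℕ → IntermediateCurvature.ClosedRiemannianManifold n)
      (S : ∀ k, IntermediateCurvature.ClosedSubmanifold (N k) (n - m + 1)),
      (∀ k, (N k).IntermediateCurvatureGE m lam) ∧
      (∀ k, (S k).HomologicallyNontrivial) ∧
      StrictMono (fun k => (S k).diam) ∧
      Tendsto (fun k => (S k).diam) atTop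
        (𝓝 (ENNReal.ofReal
          (Real.pi / Real.sqrt (lam * IntermediateCurvature.diameterConstant n m)))) := by
  have key : 0 < IntermediateCurvature.diameterConstant n m ∧ ∀ θ : ℝ, 0 < θ → θ < 1 →
      IntermediateCurvature.HasSlice n (n - m + 1) m lam
        (θ * (Real.pi / Real.sqrt (lam * IntermediateCurvature.diameterConstant n m))) := by
    rcases hm with hm | hm
    -- `m = n - 1`: with `n = 2 + q` the slice is a surface, and `n ≥ 3` gives `q ≥ 1`.
    · obtain ⟨q, rfl⟩ := Nat.exists_eq_add_of_le (show 2 ≤ n by omega)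
      obtain rfl : m = q + 1 := by omega
      rw [show 2 + q - (q + 1) + 1 = 2 by omega]
      refine ⟨?_, fun θ h0 h1 => IntermediateCurvature.hasSlice_surface (by omega) hlam h0 h1⟩
      rw [IntermediateCurvature.diameterConstant_surface]
      positivity
    -- `m = n - 2`: with `n = 3 + q` the slice is a `3`-sphere, and `q = 0` is allowed.
    · obtain ⟨q, rfl⟩ := Nat.exists_eq_add_of_le hn
      obtain rfl : m = q + 1 := by omega
      rw [show 3 + q - (q + 1) + 1 = 3 by omega]
      refine ⟨?_, fun θ h0 h1 => IntermediateCurvature.hasSlice_threefold hlam h0 h1⟩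
      rw [IntermediateCurvature.diameterConstant_threefold]
      norm_num
  obtain ⟨hC, h⟩ := key
  exact ⟨hC, IntermediateCurvature.exists_seq_of_hasSlice
    (div_pos Real.pi_pos (Real.sqrt_pos.2 (mul_pos hlam hC))) h⟩
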